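/- Stochastic block model with revealed labels. Let $0<p<1$, $q\in[0,1]$, and let $a,b,c,d$ satisfy $pa+(1-p)b=pb+(1-p)c=1$; put $\lambda=d(1-b)^2$. On the vertices $1,\dots,n$ draw independent labels $X_i\in\{1,2\}$ with $\mathbb P(X_i=1)=p$; given the labels, draw independently each edge $\{i,j\}$ of the graph $G$ with probability $M_{X_i,X_j}$, where $M=\frac dn\begin{pmatrix}a&b\\ b&c\end{pmatrix}$; independently of everything else, reveal each label with probability $q$. An estimator is a function $T=(T_1,\dots,T_n)\in\{1,2\}^n$ of the graph and of the revealed labels $Y$, and $$P_{succ}(T)=\frac1n\sum_{i=1}^n\big(\mathbb P(T_i=1\mid X_i=1)+\mathbb P(T_i=2\mid X_i=2)-1\big).$$ The optimal test is $T^{opt}_i=1$ if $\log\frac{\mathbb P(X_i=1\mid G,Y)}{\mathbb P(X_i=2\mid G,Y)}\ge\log\frac p{1-p}$ and $T_i^{opt}=2$ otherwise. A test is $t$-local if each $T_i$ is a function of the subgraph induced by the vertices at distance at most $t$ from $i$, together with the labels revealed in it. A local test ($T\in Loc$) is a family of tests, one for each $d$ and $n$, that are $t$-local for some $t$ that does not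 depend on $d$ and $n$. For $\mu\ge0$ and $Z\sim\mathcal N(0,1)$ let $$\mathcal G(\mu)=\mathcal G_{\lambda,p}(\mu)=\frac{\lambda}{(1-p)^2}\,\mathbb E\Big[\frac1{p+(1-p)\exp(\sqrt\mu Z-\mu/2)}-1\Big],$$ and let $\lambda_{sp}(p)=\sup\{\lambda\ge0 : 0\text{ is the unique fixed point of }\mathcal G_{\lambda,p}\text{ in }[0,\infty)\}$ and $p^*=\frac12-\frac1{2\sqrt3}$. **Proposition.** Let $0<p<p^*$ and $\lambda_{sp}(p)<\lambda<1$, and suppose that $\mathcal G_{\lambda,p}$ has exactly three fixed points $0<\beta<\alpha$ in $[0,\infty)$. Let $\frac{\beta p(1-p)}{\lambda}<q\le1$. Let $d\to\infty$ with $p$, $q$ and $\lambda$ fixed, where $a,b,c$ depend on $d$ and satisfy $pa+(1-p)b=pb+(1-p)c=1$ and $d(1-b)^2=\lambda$ for all large $d$. Then $$\liminf_{d\to\infty}\liminf_{n\to\infty}P_{succ}(T^{opt})\ \ge\ \sup_{T}\ \lim_{d\to\infty}\liminf_{n\to\infty}P_{succ}(T)\ \ge\ 2\,\mathbb P\big(\mathcal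 N(\alpha/2,\alpha)>0\big)-1,$$ where the supremum is over the local tests $T\in Loc$ for which the limit in $d$ exists (and is finite). Moreover, for every local test $T\in Loc$, $$\liminf_{d\to\infty}\liminf_{n\to\infty}P_{succ}(T)\ \le\ \liminf_{d\to\infty}\liminf_{n\to\infty}P_{succ}(T^{opt}).$$ -/

import Mathlib

open Filter Topology MeasureTheory ProbabilityTheory

namespace SBM

/-! ### The scalar function `G` and the spinodal curve -/

/-- `G(μ) = λ / (1-p)² · E[ 1 / (p + (1-p) exp(√μ Z - μ/2)) - 1 ]`, with `Z ∼ N(0,1)`. -/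
noncomputable def G (lam p μ : ℝ) : ℝ :=
  lam / (1 - p) ^ 2 *
    ∫ z, (1 / (p + (1 - p) * Real.exp (Real.sqrt μ * z - μ / 2)) - 1) ∂(gaussianReal 0 1)

/-- The spinodal curve: the supremum of the `λ ≥ 0` such that `0` is the unique fixed point of
`G : [0, ∞) → ℝ`. -/
noncomputable def spinodal (p : ℝ) : ℝ :=
  sSup {lam : ℝ | 0 ≤ lam ∧ ∀ μ : ℝ, 0 ≤ μ → (G lam p μ = μ ↔ μ = 0)}

/-- `p* = 1/2 - 1/(2√3)`. -/
noncomputable def pStar : ℝ := 1 / 2 - 1 / (2 * Real.sqrt 3)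

/-! ### The stochastic block model with partially revealed labels

The two communities `1` and `2` are the elements `0` and `1` of `Fin 2`, and the vertices are the
elements of `Fin n`. -/

/-- A realisation: the labels of the vertices, the graph, and the set of the vertices whose label
is revealed. -/
abbrev Outcome (n : ℕ) : Type := (Fin n → Fin 2) × SimpleGraph (Fin n) × Finset (Fin n)

/-- What is observed of the labels: the label of each revealed vertex, nothing at the others. -/
abbrev Revealed (n : ℕ) : Type := Fin n → Option (Fin 2)

/-- The observed labels, when `x` are the labels and `E` is the set of revealed vertices. -/
def reveal {n : ℕ} (x : Fin n → Fin 2) (E : Finset (Fin n)) : Revealed n :=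
  fun v => if v ∈ E then some (x v) else none

/-- The law of the label of a vertex: community `1` has probability `p`. -/
def labelProb (p : ℝ) (k : Fin 2) : ℝ := if k = 0 then p else 1 - p

open Classical in
/-- The probability of an outcome under the stochastic block model with parameters `(M, n, p)`,
each label being revealed with probability `q`: the labels are independent with law `labelProb p`;
given the labels, the edges `{i, j}` are independent Bernoulli variables of mean `M (x i) (x j)`;
the revealed vertices are chosen independently of everything else. (These are the point masses of
a probability measure as soon as `p`, `q` and the entries of `M` are in `[0, 1]`.) -/
noncomputable def weight {n : ℕ} (p q : ℝ) (M : Matrix (Fin 2) (Fin 2) ℝ) (ω : Outcome n) : ℝ :=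
  (∏ i : Fin n, labelProb p (ω.1 i)) *
    (∏ e ∈ (Finset.univ : Finset (Fin n × Fin n)).filter (fun e => e.1 < e.2),
      if ω.2.1.Adj e.1 e.2 then M (ω.1 e.1) (ω.1 e.2) else 1 - M (ω.1 e.1) (ω.1 e.2)) *
    (∏ i : Fin n, if i ∈ ω.2.2 then q else 1 - q)

open Classical in
/-- The probability of an event. -/
noncomputable def prob {n : ℕ} (p q : ℝ) (M : Matrix (Fin 2) (Fin 2) ℝ) (A : Set (Outcome n)) : ℝ :=
  ∑ ω : Outcome n, if ω ∈ A then weight p q M ω else 0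

/-- The conditional probability `P(A | B)`. -/
noncomputable def condProb {n : ℕ} (p q : ℝ) (M : Matrix (Fin 2) (Fin 2) ℝ)
    (A B : Set (Outcome n)) : ℝ :=
  prob p q M (A ∩ B) / prob p q M B

/-- The connectivity matrix `(d/n) (a b; b c)`. -/
noncomputable def connectivity (a b c d : ℝ) (n : ℕ) : Matrix (Fin 2) (Fin 2) ℝ :=
  (d / n) • !![a, b; b, c]

/-! ### Estimators -/

/-- An estimator `T = (T_1, …, T_n)`: a function of the graph and of the revealed labels. -/
abbrev Estimator (n : ℕ) : Type := SimpleGraph (Fin n) → Revealed n → Fin n → Fin 2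

/-- The rescaled average success probability
`(1/n) ∑ i, (P(T_i = 1 | X_i = 1) + P(T_i = 2 | X_i = 2) - 1)`. -/
noncomputable def Psucc {n : ℕ} (p q : ℝ) (M : Matrix (Fin 2) (Fin 2) ℝ) (T : Estimator n) : ℝ :=
  (1 / (n : ℝ)) * ∑ i : Fin n,
    (condProb p q M {ω | T ω.2.1 (reveal ω.1 ω.2.2) i = 0} {ω | ω.1 i = 0} +
      condProb p q M {ω | T ω.2.1 (reveal ω.1 ω.2.2) i = 1} {ω | ω.1 i = 1} - 1)

/-- The posterior probability `P(X_i = k | G = g, revealed labels = y)`. -/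
noncomputable def posterior {n : ℕ} (p q : ℝ) (M : Matrix (Fin 2) (Fin 2) ℝ)
    (g : SimpleGraph (Fin n)) (y : Revealed n) (i : Fin n) (k : Fin 2) : ℝ :=
  condProb p q M {ω | ω.1 i = k} {ω | ω.2.1 = g ∧ reveal ω.1 ω.2.2 = y}

open Classical in
/-- The optimal test: `T_i = 1` if `P(X_i = 1 | G, Y) / P(X_i = 2 | G, Y) ≥ p / (1 - p)`, and
`T_i = 2` otherwise. The comparison of the two ratios (equivalently, of their logarithms) is
written without division, which accounts for the posterior probabilities `0`. -/
noncomputable def Topt {n : ℕ} (p q : ℝ) (M : Matrix (Fin 2) (Fin 2) ℝ) : Estimator n :=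
  fun g y i =>
    if p * posterior p q M g y i 1 ≤ (1 - p) * posterior p q M g y i 0 then 0 else 1

/-- `T` is `t`-local: each `T_i` is a function of the subgraph induced by the vertices at distance
at most `t` from `i`, and of the labels revealed in it. -/
def IsLocal {n : ℕ} (t : ℕ) (T : Estimator n) : Prop :=
  ∀ (i : Fin n) (g g' : SimpleGraph (Fin n)) (y y' : Revealed n),
    (∀ v, g.edist i v ≤ t ↔ g'.edist i v ≤ t) →
    (∀ u v, g.edist i u ≤ t → g.edist i v ≤ t → (g.Adj u v ↔ g'.Adj u v)) →
    (∀ v, g.edist i v ≤ t → y v = y' v) →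
    T g y i = T g' y' i

/-- The set `Loc` of local tests: families of estimators, one for each average degree `d` and each
size `n`, that are `t`-local for some `t` that does not depend on `d` and `n`. -/
def Loc : Set (ℝ → (n : ℕ) → Estimator n) :=
  {T | ∃ t : ℕ, ∀ (d : ℝ) (n : ℕ), IsLocal t (T d n)}

/-- `liminf_{n → ∞} P_succ(T)`, for the model with average degree `d` and a sequence of estimators
`T n`. -/
noncomputable def rate (p q a b c d : ℝ) (T : (n : ℕ) → Estimator n) : ℝ :=
  liminf (fun n : ℕ => Psucc p q (connectivity a b c d n) (T n)) atTop

/-- `liminf_{n → ∞} P_succ(T^opt)`, for the model with average degree `d`. -/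
noncomputable def optRate (p q a b c d : ℝ) : ℝ :=
  rate p q a b c d fun n => Topt p q (connectivity a b c d n)

/-- The values of `lim_{d → ∞} liminf_{n → ∞} P_succ(T)`, for the local tests `T` for which this
limit exists. -/
def localLimits (p q : ℝ) (a b c : ℝ → ℝ) : Set ℝ :=
  {l | ∃ T ∈ Loc, Tendsto (fun d => rate p q (a d) (b d) (c d) d (T d)) atTop (𝓝 l)}

end SBM

/-! Optimality. At a vertex i the success probability is, up to the constant -1, a sum over
observations o of P(o, X_i = T_i) / P(X_i = T_i). `Topt` selects the larger of the two possible
terms for every o, so it dominates every test for all valid d and n (`Valid.Psucc_le_Topt`). Passing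
to the liminfs gives the upper bounds.

Lower bound. The local tests are message passing algorithms. The revealed labels enter only at the
initial round; messages are then summed over neighbours through bounded nonlinearities (posterior
means), for a fixed number of rounds, and the last message is compared with a threshold.

As n → ∞, no coupling with a tree is built. `lln` shows by induction on the rounds that the
empirical laws of the messages converge to explicit compound Poisson laws. Characters suffice: the
messages of two vertices, each computed without the other, are conditionally independent, and
integrating out the edges at a vertex turns its character into nearly the exponential of an
empirical mean of the previous round (`lln_char_succ`).

As d → ∞ with λ fixed, these laws become Gaussian with means μ(1-p) and -μp and variance μ
(`weakLim_treeLaw`). Here μ starts from λq/(p(1-p)) and is iterated by `G`. The Bayes identity E[m²]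
= p E₀[m] for the centred posterior m keeps the gap between the means equal to the variance. A
threshold midway between the means has success 2P(N(μ/2, μ) > 0) - 1.

Scalar recursion. The assumption on q says that the initial μ exceeds β. `G` is nondecreasing
(`G_mono`) and lies above the diagonal on (β, α): otherwise it would lie below the diagonal
everywhere, and since `G` is linear in λ this would contradict λ > λ_sp (`lt_G_of_mem_Ioo`). The
iterates therefore dominate a sequence that increases to α, and the supremum over the number of
rounds gives the claimed bound. -/

namespace SBM

/-! ### Expectations under the stochastic block model -/

section Expectation

variable {n : ℕ} {p q : ℝ} {M : Matrix (Fin 2) (Fin 2) ℝ}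
variable {F : Type*} [NormedAddCommGroup F] [NormedSpace ℝ F]

/-- The expectation of a function of the outcome. -/
noncomputable def expect (p q : ℝ) (M : Matrix (Fin 2) (Fin 2) ℝ) (f : Outcome n → F) : F :=
  ∑ ω : Outcome n, weight p q M ω • f ω

/-- The parameters are probabilities. -/
structure Valid (p q : ℝ) (M : Matrix (Fin 2) (Fin 2) ℝ) : Prop where
  p_pos : 0 < p
  p_lt : p < 1
  q_nonneg : 0 ≤ q
  q_le : q ≤ 1
  symm : ∀ k l, M k l = M l k
  nonneg : ∀ k l, 0 ≤ M k l
  le_one : ∀ k l, M k l ≤ 1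

lemma Valid.labelProb_pos (h : Valid p q M) (k : Fin 2) : 0 < labelProb p k := by
  unfold labelProb; split_ifs <;> linarith [h.p_pos, h.p_lt]

lemma labelProb_sum (p : ℝ) : ∑ k, labelProb p k = 1 := by
  simp [labelProb]

lemma Valid.weight_nonneg (h : Valid p q M) (ω : Outcome n) : 0 ≤ weight p q M ω := by
  unfold weight
  refine mul_nonneg (mul_nonneg (Finset.prod_nonneg fun i _ => (h.labelProb_pos _).le)
    (Finset.prod_nonneg fun e _ => ?_)) (Finset.prod_nonneg fun i _ => ?_)
  · split_ifs
    · exact h.nonneg _ _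
    · linarith [h.le_one (ω.1 e.1) (ω.1 e.2)]
  · split_ifs <;> linarith [h.q_nonneg, h.q_le]

lemma expect_add (f g : Outcome n → F) :
    expect p q M (fun ω => f ω + g ω) = expect p q M f + expect p q M g := by
  simp [expect, smul_add, Finset.sum_add_distrib]

lemma expect_sub (f g : Outcome n → F) :
    expect p q M (fun ω => f ω - g ω) = expect p q M f - expect p q M g := by
  simp [expect, smul_sub, Finset.sum_sub_distrib]

lemma expect_sum {ι : Type*} (s : Finset ι) (f : ι → Outcome n → F) :
    expect p q M (fun ω => ∑ i ∈ s, f i ω) = ∑ i ∈ s, expect p q M (f i) := by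
  simp only [expect, Finset.smul_sum]
  exact Finset.sum_comm

lemma expect_const_mul {𝕜 : Type*} [RCLike 𝕜] (c : 𝕜) (f : Outcome n → 𝕜) :
    expect p q M (fun ω => c * f ω) = c * expect p q M f := by
  simp only [expect, Finset.mul_sum, mul_smul_comm]

lemma Valid.expect_mono (h : Valid p q M) {f g : Outcome n → ℝ} (hfg : ∀ ω, f ω ≤ g ω) :
    expect p q M f ≤ expect p q M g :=
  Finset.sum_le_sum fun ω _ => mul_le_mul_of_nonneg_left (hfg ω) (h.weight_nonneg ω)

lemma Valid.expect_nonneg (h : Valid p q M) {f : Outcome n → ℝ} (hf : ∀ ω, 0 ≤ f ω) :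
    0 ≤ expect p q M f :=
  Finset.sum_nonneg fun ω _ => mul_nonneg (h.weight_nonneg ω) (hf ω)

lemma Valid.norm_expect_le (h : Valid p q M) (f : Outcome n → F) :
    ‖expect p q M f‖ ≤ expect p q M (fun ω => ‖f ω‖) := by
  refine (norm_sum_le _ _).trans (le_of_eq (Finset.sum_congr rfl fun ω _ => ?_))
  rw [norm_smul, Real.norm_of_nonneg (h.weight_nonneg ω), smul_eq_mul]

/-! #### Resampling an edge -/

/-- `f` does not depend on the presence of the edge `{i, j}`. -/
def EdgeFree {α : Type*} (i j : Fin n) (f : Outcome n → α) : Prop :=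
  ∀ x (g g' : SimpleGraph (Fin n)) E,
    (∀ u v, ¬ (u = i ∧ v = j ∨ u = j ∧ v = i) → (g.Adj u v ↔ g'.Adj u v)) →
      f (x, g, E) = f (x, g', E)

lemma EdgeFree.swap {α : Type*} {i j : Fin n} {f : Outcome n → α} (h : EdgeFree i j f) :
    EdgeFree j i f := fun x g g' E hg => h x g g' E fun u v huv => hg u v (by tauto)

-- Toggling the edge {i, j} is an involution of the outcomes under which `f₁` and `f₀` are
-- invariant. The two weights of a pair are M R and (1 - M) R with a common factor R, so both sides,
-- doubled and summed over pairs, agree term by term.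
open Classical in
lemma expect_edge_of_lt {i j : Fin n} (hij : i < j) {f₁ f₀ : Outcome n → F}
    (h₁ : EdgeFree i j f₁) (h₀ : EdgeFree i j f₀) :
    expect p q M (fun ω => if ω.2.1.Adj i j then f₁ ω else f₀ ω) =
      expect p q M (fun ω => M (ω.1 i) (ω.1 j) • f₁ ω + (1 - M (ω.1 i) (ω.1 j)) • f₀ ω) := by
  set T : SimpleGraph (Fin n) → SimpleGraph (Fin n) := fun g => symmDiff g (SimpleGraph.edge i j)
    with hT
  have hinv : Function.Involutive T := fun g => symmDiff_symmDiff_cancel_right _ _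
  have hadj : ∀ g u v, (T g).Adj u v ↔
      (g.Adj u v ∧ ¬ (u = i ∧ v = j ∨ u = j ∧ v = i) ∨
        (u = i ∧ v = j ∨ u = j ∧ v = i) ∧ ¬ g.Adj u v) := by
    intro g u v
    have h1 : (SimpleGraph.edge i j).Adj u v ↔ (u = i ∧ v = j ∨ u = j ∧ v = i) := by
      rw [SimpleGraph.edge_adj]
      constructor
      · rintro ⟨h, -⟩; tauto
      · rintro (⟨rfl, rfl⟩ | ⟨rfl, rfl⟩)
        · exact ⟨by tauto, hij.ne⟩
        · exact ⟨by tauto, hij.ne'⟩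
    simp only [hT, symmDiff, SimpleGraph.sup_adj, SimpleGraph.sdiff_adj, h1]
  have hoff : ∀ g u v, ¬ (u = i ∧ v = j ∨ u = j ∧ v = i) → (g.Adj u v ↔ (T g).Adj u v) := by
    intro g u v h; rw [hadj]; tauto
  have hon : ∀ g, (T g).Adj i j ↔ ¬ g.Adj i j := by
    intro g; rw [hadj]; tauto
  have key : ∀ f : Outcome n → F, (2 : ℝ) • expect p q M f =
      ∑ ω : Outcome n, (weight p q M ω • f ω +
        weight p q M (ω.1, T ω.2.1, ω.2.2) • f (ω.1, T ω.2.1, ω.2.2)) := by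
    intro f
    rw [Finset.sum_add_distrib, two_smul]
    congr 1
    let e : Outcome n ≃ Outcome n :=
      (Equiv.refl _).prodCongr ((hinv.toPerm T).prodCongr (Equiv.refl _))
    exact (Equiv.sum_comp e (fun ω => weight p q M ω • f ω)).symm
  have h2 : (2 : ℝ) ≠ 0 := two_ne_zero
  apply smul_right_injective F h2
  simp only [key]
  refine Finset.sum_congr rfl fun ω _ => ?_
  obtain ⟨x, g, E⟩ := ω
  set s := (Finset.univ : Finset (Fin n × Fin n)).filter (fun e => e.1 < e.2) with hs
  have hmem : (i, j) ∈ s := by simp [hs, hij]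
  set R : ℝ := (∏ i : Fin n, labelProb p (x i)) *
    (∏ e ∈ s.erase (i, j), if g.Adj e.1 e.2 then M (x e.1) (x e.2) else 1 - M (x e.1) (x e.2)) *
    (∏ i : Fin n, if i ∈ E then q else 1 - q) with hR
  have hw : weight p q M (x, g, E) =
      (if g.Adj i j then M (x i) (x j) else 1 - M (x i) (x j)) * R := by
    rw [weight, ← hs, ← Finset.mul_prod_erase _ _ hmem, hR]; ring
  have hw' : weight p q M (x, T g, E) =
      (if g.Adj i j then 1 - M (x i) (x j) else M (x i) (x j)) * R := by
    rw [weight, ← hs, ← Finset.mul_prod_erase _ _ hmem, hR]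
    have : ∏ e ∈ s.erase (i, j), (if (T g).Adj e.1 e.2 then M (x e.1) (x e.2)
        else 1 - M (x e.1) (x e.2)) = ∏ e ∈ s.erase (i, j),
          (if g.Adj e.1 e.2 then M (x e.1) (x e.2) else 1 - M (x e.1) (x e.2)) := by
      refine Finset.prod_congr rfl fun e he => ?_
      have he1 := Finset.ne_of_mem_erase he
      have he2 : e.1 < e.2 := by simpa [hs] using Finset.mem_of_mem_erase he
      have : g.Adj e.1 e.2 ↔ (T g).Adj e.1 e.2 := hoff g _ _ (by
        rintro (⟨h1, h2⟩ | ⟨h1, h2⟩)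
        · exact he1 (Prod.ext h1 h2)
        · rw [h1, h2] at he2; exact absurd he2 hij.not_gt)
      simp only [this]
    simp only [this]
    by_cases hg : g.Adj i j
    · simp only [hon, hg, not_true, if_true, if_false]; ring
    · simp only [hon, hg, not_false_eq_true, if_true, if_false]; ring
  have e1 : f₁ (x, T g, E) = f₁ (x, g, E) := (h₁ x g (T g) E (hoff g)).symm
  have e0 : f₀ (x, T g, E) = f₀ (x, g, E) := (h₀ x g (T g) E (hoff g)).symm
  simp only [hw, hw', e1, e0, hon]
  by_cases hg : g.Adj i j
  · simp only [hg, not_true, if_true, if_false, smul_add, smul_smul]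
    module
  · simp only [hg, not_false_eq_true, if_true, if_false, smul_add, smul_smul]
    module

open Classical in
lemma expect_edge (hM : ∀ k l, M k l = M l k) {i j : Fin n} (hij : i ≠ j) {f₁ f₀ : Outcome n → F}
    (h₁ : EdgeFree i j f₁) (h₀ : EdgeFree i j f₀) :
    expect p q M (fun ω => if ω.2.1.Adj i j then f₁ ω else f₀ ω) =
      expect p q M (fun ω => M (ω.1 i) (ω.1 j) • f₁ ω + (1 - M (ω.1 i) (ω.1 j)) • f₀ ω) := by
  rcases lt_or_gt_of_ne hij with h | h
  · exact expect_edge_of_lt h h₁ h₀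
  · have := expect_edge_of_lt (p := p) (q := q) (M := M) h h₁.swap h₀.swap
    simp only [SimpleGraph.adj_comm _ i j]
    rw [this]
    simp only [hM (_) (_)]

open Classical in
/-- Integrating out the edges between `j` and the vertices of `I`. -/
lemma expect_star (hM : ∀ k l, M k l = M l k) {j : Fin n} (I : Finset (Fin n)) (hj : j ∉ I)
    (z : Fin n → Outcome n → ℂ) (f : Outcome n → ℂ)
    (hz : ∀ i ∈ I, ∀ l ∈ I, EdgeFree j l (z i)) (hf : ∀ l ∈ I, EdgeFree j l f) :
    expect p q M (fun ω => (∏ i ∈ I, if ω.2.1.Adj j i then z i ω else 1) * f ω) =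
      expect p q M (fun ω => (∏ i ∈ I, (1 + M (ω.1 j) (ω.1 i) * (z i ω - 1))) * f ω) := by
  induction I using Finset.induction_on generalizing f with
  | empty => simp
  | insert a I ha ih =>
    have hja : j ≠ a := fun h => hj (by simp [h])
    have hjI : j ∉ I := fun h => hj (by simp [h])
    -- The factors of the other vertices do not see the edge {j, a}, so this edge can be integrated
    -- out alone; its factor is then absorbed into `f` for the induction.
    set P : Outcome n → ℂ := fun ω => (∏ i ∈ I, if ω.2.1.Adj j i then z i ω else 1) * f ω with hP
    have hPf : EdgeFree j a P := by
      intro x g g' E hg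
      have hf' := hf a (by simp) x g g' E hg
      simp only [hP]
      rw [hf']
      congr 1
      refine Finset.prod_congr rfl fun i hi => ?_
      have hia : i ≠ a := fun h => ha (h ▸ hi)
      have h1 : g.Adj j i ↔ g'.Adj j i := hg j i (by
        rintro (⟨-, h⟩ | ⟨h, -⟩)
        · exact hia h
        · exact hja h)
      have h2 := hz i (by simp [hi]) a (by simp) x g g' E hg
      simp only [h1, h2]
    have hzP : EdgeFree j a (fun ω => z a ω * P ω) := by
      intro x g g' E hg
      simp only
      rw [hPf x g g' E hg, hz a (by simp) a (by simp) x g g' E hg]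
    have e1 := expect_edge (p := p) (q := q) hM hja hzP hPf
    have e2 : (fun ω : Outcome n => (∏ i ∈ insert a I, if ω.2.1.Adj j i then z i ω else 1) * f ω) =
        fun ω => if ω.2.1.Adj j a then z a ω * P ω else P ω := by
      funext ω
      rw [Finset.prod_insert ha]
      split_ifs <;> simp [hP, mul_assoc]
    rw [e2, e1]
    have e3 : (fun ω : Outcome n => M (ω.1 j) (ω.1 a) • (z a ω * P ω) +
        (1 - M (ω.1 j) (ω.1 a)) • P ω) =
        fun ω => (∏ i ∈ I, if ω.2.1.Adj j i then z i ω else 1) *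
          ((1 + M (ω.1 j) (ω.1 a) * (z a ω - 1)) * f ω) := by
      funext ω
      simp only [hP, Complex.real_smul]
      push_cast
      ring
    rw [e3, ih hjI _ (fun i hi l hl => hz i (by simp [hi]) l (by simp [hl]))]
    · congr 1
      funext ω
      rw [Finset.prod_insert ha]; ring
    · intro l hl x g g' E hg
      have h1 := hf l (by simp [hl]) x g g' E hg
      have h2 := hz a (by simp) l (by simp [hl]) x g g' E hg
      simp only [h1, h2]

open Classical in
lemma Valid.expect_adj_mul_le (h : Valid p q M) {i j : Fin n} (hij : i ≠ j) {f : Outcome n → ℝ}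
    (hf : EdgeFree i j f) (hf0 : ∀ ω, 0 ≤ f ω) {B : ℝ} (hB : ∀ k l, M k l ≤ B) :
    expect p q M (fun ω => if ω.2.1.Adj i j then f ω else 0) ≤ B * expect p q M f := by
  have h0 : EdgeFree i j (fun _ : Outcome n => (0 : ℝ)) := fun _ _ _ _ _ => rfl
  rw [expect_edge h.symm hij hf h0, ← expect_const_mul]
  refine h.expect_mono fun ω => ?_
  simp only [smul_eq_mul, mul_zero, add_zero]
  exact mul_le_mul_of_nonneg_right (hB _ _) (hf0 ω)

/-! #### Functions of the labels and of the revealed set -/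

-- Graphs on `Fin n` correspond to sets of pairs u < v, so expanding the product of sums enumerates
-- the graphs. With g = 1 - f this says that the edge probabilities sum to one.
open Classical in
lemma sum_simpleGraph_prod (f g : Fin n × Fin n → ℝ) :
    ∑ G : SimpleGraph (Fin n), ∏ e ∈ (Finset.univ : Finset (Fin n × Fin n)).filter
      (fun e => e.1 < e.2), (if G.Adj e.1 e.2 then f e else g e) =
    ∏ e ∈ (Finset.univ : Finset (Fin n × Fin n)).filter (fun e => e.1 < e.2), (f e + g e) := by
  set s := (Finset.univ : Finset (Fin n × Fin n)).filter (fun e => e.1 < e.2) with hs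
  rw [Finset.prod_add]
  refine Finset.sum_bij' (fun G _ => s.filter fun e => G.Adj e.1 e.2)
    (fun t _ => SimpleGraph.fromRel fun u v => (u, v) ∈ t) ?_ ?_ ?_ ?_ ?_
  · intro G _
    exact Finset.mem_powerset.2 (Finset.filter_subset _ _)
  · intro t _; exact Finset.mem_univ _
  · intro G _
    ext u v
    simp only [SimpleGraph.fromRel_adj, Finset.mem_filter, hs, Finset.mem_univ, true_and]
    constructor
    · rintro ⟨-, h | h⟩
      · exact h.2
      · exact h.2.symm
    · intro h
      refine ⟨h.ne, ?_⟩
      rcases lt_or_gt_of_ne h.ne with h1 | h1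
      · exact Or.inl ⟨h1, h⟩
      · exact Or.inr ⟨h1, h.symm⟩
  · intro t ht
    have ht := Finset.mem_powerset.1 ht
    ext ⟨u, v⟩
    simp only [SimpleGraph.fromRel_adj, Finset.mem_filter]
    constructor
    · rintro ⟨h1, -, h | h⟩
      · exact h
      · have h2 := ht h
        simp only [hs, Finset.mem_filter, Finset.mem_univ, true_and] at h1 h2
        exact absurd h1 h2.not_gt
    · intro h
      have h2 := ht h
      refine ⟨h2, ?_, Or.inl h⟩
      simp only [hs, Finset.mem_filter, Finset.mem_univ, true_and] at h2
      exact h2.ne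
  · intro G _
    rw [Finset.prod_ite, Finset.filter_not]

open Classical in
lemma sum_graph_weight (x : Fin n → Fin 2) (E : Finset (Fin n)) :
    ∑ g : SimpleGraph (Fin n), weight p q M (x, g, E) =
      (∏ i : Fin n, labelProb p (x i)) * (∏ i : Fin n, if i ∈ E then q else 1 - q) := by
  have h1 := sum_simpleGraph_prod (fun e : Fin n × Fin n => M (x e.1) (x e.2))
    (fun e => 1 - M (x e.1) (x e.2))
  simp only [add_sub_cancel, Finset.prod_const_one] at h1
  calc ∑ g : SimpleGraph (Fin n), weight p q M (x, g, E)
      = ∑ g : SimpleGraph (Fin n), ((∏ i : Fin n, labelProb p (x i)) *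
          ∏ e ∈ (Finset.univ : Finset (Fin n × Fin n)).filter (fun e => e.1 < e.2),
            (if g.Adj e.1 e.2 then M (x e.1) (x e.2) else 1 - M (x e.1) (x e.2))) *
          (∏ i : Fin n, if i ∈ E then q else 1 - q) := rfl
    _ = _ := by rw [← Finset.sum_mul, ← Finset.mul_sum, h1, mul_one]

open Classical in
lemma sum_finset_prod {R : Type*} [CommSemiring R] (f g : Fin n → R) :
    ∑ E : Finset (Fin n), ∏ i, (if i ∈ E then f i else g i) = ∏ i, (f i + g i) := by
  rw [Finset.prod_add, Finset.powerset_univ]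
  refine Finset.sum_congr rfl fun E _ => ?_
  rw [Finset.prod_ite]
  congr 1
  · simp
  · congr 1; ext; simp

-- Once the graph is summed out, the labels and the revelations form a product measure, and the
-- expectation factors over the vertices. The `Prop` argument of `φ` tells whether the vertex is
-- revealed.
open Classical in
lemma expect_prod_vertex (φ : Fin n → Fin 2 → Prop → ℂ) :
    expect p q M (fun ω : Outcome n => ∏ i, φ i (ω.1 i) (i ∈ ω.2.2)) =
      ∏ i, ∑ k, (labelProb p k : ℂ) * (q * φ i k True + (1 - q) * φ i k False) := by
  have hE : ∀ x : Fin n → Fin 2, ∑ E : Finset (Fin n),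
      ∏ i, (if i ∈ E then (q : ℂ) else 1 - q) * φ i (x i) (i ∈ E) =
        ∏ i, ((q : ℂ) * φ i (x i) True + (1 - q) * φ i (x i) False) := by
    intro x
    rw [← sum_finset_prod]
    refine Finset.sum_congr rfl fun E _ => Finset.prod_congr rfl fun i _ => ?_
    split_ifs with h <;> simp [h]
  calc expect p q M (fun ω : Outcome n => ∏ i, φ i (ω.1 i) (i ∈ ω.2.2))
      = ∑ x : Fin n → Fin 2, ∑ E : Finset (Fin n), ∑ g : SimpleGraph (Fin n),
          (weight p q M (x, g, E) : ℂ) * ∏ i, φ i (x i) (i ∈ E) := by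
        rw [expect, Fintype.sum_prod_type]
        refine Finset.sum_congr rfl fun x _ => ?_
        rw [Fintype.sum_prod_type_right]
        simp only [Complex.real_smul]
    _ = ∑ x : Fin n → Fin 2, ∏ i, ((labelProb p (x i) : ℂ) *
          ((q : ℂ) * φ i (x i) True + (1 - q) * φ i (x i) False)) := by
        refine Finset.sum_congr rfl fun x _ => ?_
        rw [Finset.prod_mul_distrib, ← hE, Finset.mul_sum]
        refine Finset.sum_congr rfl fun E _ => ?_
        rw [← Finset.sum_mul, ← Complex.ofReal_sum, sum_graph_weight, Finset.prod_mul_distrib]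
        push_cast
        rw [mul_assoc]
        congr 2
        refine Finset.prod_congr rfl fun i _ => ?_
        split_ifs <;> simp
    _ = _ := by
        rw [Finset.prod_univ_sum, Fintype.piFinset_univ]

lemma ofReal_expect (f : Outcome n → ℝ) :
    ((expect p q M f : ℝ) : ℂ) = expect p q M (fun ω => (f ω : ℂ)) := by
  simp [expect]

/-- Expectation of a function of one vertex. -/
lemma expect_vertex (j : Fin n) (φ : Fin 2 → Prop → ℂ) :
    expect p q M (fun ω : Outcome n => φ (ω.1 j) (j ∈ ω.2.2)) =
      ∑ k, (labelProb p k : ℂ) * (q * φ k True + (1 - q) * φ k False) := by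
  classical
  have h := expect_prod_vertex (p := p) (q := q) (M := M)
    (fun i k b => if i = j then φ k b else 1)
  have hl : ∑ k, (labelProb p k : ℂ) = 1 := by exact_mod_cast labelProb_sum p
  rw [Finset.prod_eq_single j] at h
  · simp only [if_true] at h
    rw [← h]
    congr 1
    funext ω
    rw [Finset.prod_eq_single j] <;> simp +contextual
  · intro i _ hi
    simp only [hi, if_false, mul_one, add_sub_cancel, hl]
  · simp

/-- The labels and the revelations at two vertices are independent. -/
lemma expect_two_vertices {j l : Fin n} (hjl : j ≠ l) (φ ψ : Fin 2 → Prop → ℂ) :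
    expect p q M (fun ω : Outcome n => φ (ω.1 j) (j ∈ ω.2.2) * ψ (ω.1 l) (l ∈ ω.2.2)) =
      (∑ k, (labelProb p k : ℂ) * (q * φ k True + (1 - q) * φ k False)) *
      ∑ k, (labelProb p k : ℂ) * (q * ψ k True + (1 - q) * ψ k False) := by
  classical
  have h := expect_prod_vertex (p := p) (q := q) (M := M)
    (fun i k b => if i = j then φ k b else if i = l then ψ k b else 1)
  have hl : ∑ k, (labelProb p k : ℂ) = 1 := by exact_mod_cast labelProb_sum p
  rw [Fintype.prod_eq_mul j l hjl] at h
  · simp only [if_true, hjl.symm, if_false] at h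
    rw [← h]
    congr 1
    funext ω
    rw [Fintype.prod_eq_mul j l hjl]
    · simp [hjl.symm]
    · rintro x ⟨h1, h2⟩; simp [h1, h2]
  · rintro i ⟨h1, h2⟩
    simp only [h1, h2, if_false, mul_one, add_sub_cancel, hl]

lemma expect_const_one : expect p q M (fun _ : Outcome n => (1 : ℝ)) = 1 := by
  have h := expect_prod_vertex (n := n) (p := p) (q := q) (M := M) (fun _ _ _ => 1)
  have hl : ∑ k, (labelProb p k : ℂ) = 1 := by exact_mod_cast labelProb_sum p
  simp only [mul_one, add_sub_cancel, hl, Finset.prod_const_one] at h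
  have h2 := ofReal_expect (n := n) (p := p) (q := q) (M := M) (fun _ => 1)
  simp only [Complex.ofReal_one] at h2
  rw [h] at h2
  exact_mod_cast h2

lemma expect_const (c : ℝ) : expect p q M (fun _ : Outcome n => c) = c := by
  have := expect_const_mul (p := p) (q := q) (M := M) c (fun _ : Outcome n => (1 : ℝ))
  rw [expect_const_one] at this
  simpa using this

/-- Jensen's inequality for the square. -/
lemma Valid.sq_expect_le (h : Valid p q M) (f : Outcome n → ℝ) :
    expect p q M f ^ 2 ≤ expect p q M (fun ω => f ω ^ 2) := by
  have h0 := h.expect_nonneg (f := fun ω : Outcome n => (f ω - expect p q M f) ^ 2)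
    fun ω => sq_nonneg _
  have h1 : (fun ω : Outcome n => (f ω - expect p q M f) ^ 2) =
      fun ω => f ω ^ 2 - (2 * expect p q M f) * f ω + expect p q M f ^ 2 := by
    funext ω; ring
  rw [h1, expect_add, expect_sub, expect_const_mul, expect_const] at h0
  nlinarith

end Expectation

/-! ### Message passing -/

section Messages

variable {n : ℕ}

open Classical in
/-- The message sent by the vertex `j` after `t` rounds, in the graph from which the vertices of
`S` are removed. -/
noncomputable def msg (v : ℕ → ℝ → ℝ) (code : Option (Fin 2) → ℝ) (g : SimpleGraph (Fin n))
    (y : Revealed n) : ℕ → Finset (Fin n) → Fin n → ℝ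
  | 0, _, j => code (y j)
  -- The incoming messages are computed with j removed, hence do not depend on the edges at j. This
  -- replaces the independence of the branches of a tree.
  | t + 1, S, j => ∑ i ∈ (insert j S)ᶜ, if g.Adj j i then v t (msg v code g y t (insert j S) i) else 0

variable {v : ℕ → ℝ → ℝ} {code : Option (Fin 2) → ℝ}

lemma msg_congr {g g' : SimpleGraph (Fin n)} {y : Revealed n} (t : ℕ) {S : Finset (Fin n)}
    (hg : ∀ u ∉ S, ∀ w ∉ S, (g.Adj u w ↔ g'.Adj u w)) {j : Fin n} (hj : j ∉ S) :
    msg v code g y t S j = msg v code g' y t S j := by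
  classical
  induction t generalizing S j with
  | zero => rfl
  | succ t ih =>
    simp only [msg]
    refine Finset.sum_congr rfl fun i hi => ?_
    rw [Finset.mem_compl] at hi
    have hi' : i ∉ S := fun h => hi (Finset.mem_insert_of_mem h)
    rw [ih (S := insert j S) (fun u hu w hw => hg u (fun h => hu (Finset.mem_insert_of_mem h)) w
      (fun h => hw (Finset.mem_insert_of_mem h))) hi]
    simp only [hg j hj i hi']

/-- Here `r` bounds the distance already travelled from the root i: a message with t rounds left at
distance r explores distance at most r + t. -/
lemma msg_local {g g' : SimpleGraph (Fin n)} {y y' : Revealed n} {i : Fin n} {τ : ℕ}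
    (h₀ : ∀ v, g.edist i v ≤ τ ↔ g'.edist i v ≤ τ)
    (h₁ : ∀ u v, g.edist i u ≤ τ → g.edist i v ≤ τ → (g.Adj u v ↔ g'.Adj u v))
    (h₂ : ∀ v, g.edist i v ≤ τ → y v = y' v) (t r : ℕ) (htr : r + t ≤ τ) (S : Finset (Fin n))
    (j : Fin n) (hj : g.edist i j ≤ r) (hj' : g'.edist i j ≤ r) :
    msg v code g y t S j = msg v code g' y' t S j := by
  classical
  induction t generalizing S j r with
  | zero =>
    simp only [msg]
    rw [h₂ j (hj.trans (by exact_mod_cast (by omega : r ≤ τ)))]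
  | succ t ih =>
    have hrτ : ((r : ℕ∞) + 1) ≤ τ := by exact_mod_cast (by omega : r + 1 ≤ τ)
    have hjτ : g.edist i j ≤ τ := hj.trans (le_self_add.trans hrτ)
    have step : ∀ (G : SimpleGraph (Fin n)) l, G.edist i j ≤ r → G.Adj j l →
        G.edist i l ≤ ((r + 1 : ℕ) : ℕ∞) := by
      intro G l hG hl
      refine (G.edist_triangle (v := j)).trans ?_
      rw [SimpleGraph.edist_eq_one_iff_adj.2 hl]
      push_cast
      gcongr
    simp only [msg]
    refine Finset.sum_congr rfl fun l _ => ?_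
    by_cases hl : g.Adj j l
    · have hl1 := step g l hj hl
      have hl' : g'.Adj j l := (h₁ j l hjτ (hl1.trans (by exact_mod_cast hrτ))).1 hl
      simp only [hl, hl', if_true]
      rw [ih (r + 1) (by omega) _ l hl1 (step g' l hj' hl')]
    · have hl' : ¬ g'.Adj j l := by
        intro hl'
        have hl1 := step g' l hj' hl'
        exact hl ((h₁ j l hjτ ((h₀ l).2 (hl1.trans (by exact_mod_cast hrτ)))).2 hl')
      simp only [hl, hl', if_false]

/-- The message as a function of the outcome. -/
noncomputable def msgAt (v : ℕ → ℝ → ℝ) (code : Option (Fin 2) → ℝ) (t : ℕ) (S : Finset (Fin n))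
    (j : Fin n) (ω : Outcome n) : ℝ := msg v code ω.2.1 (reveal ω.1 ω.2.2) t S j

open Classical in
lemma msgAt_succ (t : ℕ) (S : Finset (Fin n)) (j : Fin n) (ω : Outcome n) :
    msgAt v code (t + 1) S j ω = ∑ i ∈ (insert j S)ᶜ,
      if ω.2.1.Adj j i then v t (msgAt v code t (insert j S) i ω) else 0 := by
  simp only [msgAt, msg]

lemma msgAt_edgeFree {t : ℕ} {S : Finset (Fin n)} {i j l : Fin n} (hi : i ∉ S)
    (hjl : j ∈ S ∨ l ∈ S) : EdgeFree j l (msgAt v code t S i) := by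
  intro x g g' E hg
  refine msg_congr t (fun u hu w hw => hg u w ?_) hi
  rintro (⟨rfl, rfl⟩ | ⟨rfl, rfl⟩) <;> tauto

variable {p q : ℝ} {M : Matrix (Fin 2) (Fin 2) ℝ}

open Classical in
/-- Removing one more vertex rarely changes a message. -/
lemma Valid.expect_msgAt_ne_le (h : Valid p q M) {B D : ℝ} (hB : ∀ k l, M k l ≤ B)
    (hBD : n * B ≤ D) (t : ℕ) (S : Finset (Fin n)) (j l : Fin n) (hjS : j ∉ S) (hl : l ∉ S)
    (hjl : j ≠ l) :
    expect p q M (fun ω : Outcome n =>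
      if msgAt v code t S j ω ≠ msgAt v code t (insert l S) j ω then (1 : ℝ) else 0) ≤
      B * ∑ s ∈ Finset.range t, D ^ s := by
  have hB0 : 0 ≤ B := (h.nonneg 0 0).trans (hB 0 0)
  have hD0 : 0 ≤ D := le_trans (by positivity) hBD
  induction t generalizing S j with
  | zero =>
    simp only [msgAt, msg]
    simp [expect]
  | succ t ih =>
    set S' := insert j (insert l S) with hS'
    have hS'2 : S' = insert l (insert j S) := Finset.insert_comm _ _ _
    -- A message changes only if j is adjacent to l or a neighbour sends a changed message. A union
    -- bound gives u(t+1) ≤ B + D u(t), whose solution is the geometric sum of the statement.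
    have hpt : ∀ ω : Outcome n,
        (if msgAt v code (t + 1) S j ω ≠ msgAt v code (t + 1) (insert l S) j ω
          then (1 : ℝ) else 0) ≤ (if ω.2.1.Adj j l then 1 else 0) +
          ∑ i ∈ S'ᶜ, if ω.2.1.Adj j i then
            (if msgAt v code t (insert j S) i ω ≠ msgAt v code t (insert l (insert j S)) i ω
              then (1 : ℝ) else 0) else 0 := by
      intro ω
      have hnn : ∀ i, (0 : ℝ) ≤ if ω.2.1.Adj j i then
            (if msgAt v code t (insert j S) i ω ≠ msgAt v code t (insert l (insert j S)) i ω
              then (1 : ℝ) else 0) else 0 := by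
        intro i; split_ifs <;> norm_num
      have hsn := Finset.sum_nonneg (s := S'ᶜ) fun i _ => hnn i
      split_ifs with h1 h2 h2
      · linarith
      · rw [zero_add]
        have : ∃ i ∈ S'ᶜ, ω.2.1.Adj j i ∧
            msgAt v code t (insert j S) i ω ≠ msgAt v code t (insert l (insert j S)) i ω := by
          by_contra hcon
          push Not at hcon
          apply h1
          rw [msgAt_succ, msgAt_succ, ← hS']
          have hins : (insert j S)ᶜ = insert l S'ᶜ := by
            ext a
            simp only [hS', Finset.mem_compl, Finset.mem_insert, not_or]
            constructor
            · rintro ⟨h3, h4⟩; tauto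
            · rintro (rfl | ⟨h3, h4, h5⟩)
              · exact ⟨hjl.symm, hl⟩
              · exact ⟨h3, h5⟩
          rw [hins, Finset.sum_insert (by simp [hS']), if_neg h2, zero_add]
          refine Finset.sum_congr rfl fun i hi => ?_
          split_ifs with h3
          · rw [hcon i hi h3, hS'2]
          · rfl
        obtain ⟨i, hi, h3, h4⟩ := this
        refine le_trans ?_ (Finset.single_le_sum (fun i _ => hnn i) hi)
        rw [if_pos h3, if_pos h4]
      · linarith
      · linarith
    refine (h.expect_mono hpt).trans ?_
    rw [expect_add, expect_sum]
    have e1 : expect p q M (fun ω : Outcome n => if ω.2.1.Adj j l then (1 : ℝ) else 0) ≤ B := by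
      have := h.expect_adj_mul_le (f := fun _ : Outcome n => (1 : ℝ)) hjl
        (fun _ _ _ _ _ => rfl) (fun _ => zero_le_one) hB
      rwa [expect_const_one, mul_one] at this
    have e2 : ∀ i ∈ S'ᶜ, expect p q M (fun ω : Outcome n => if ω.2.1.Adj j i then
            (if msgAt v code t (insert j S) i ω ≠ msgAt v code t (insert l (insert j S)) i ω
              then (1 : ℝ) else 0) else 0) ≤ B * (B * ∑ s ∈ Finset.range t, D ^ s) := by
      intro i hi
      simp only [hS', Finset.mem_compl, Finset.mem_insert, not_or] at hi
      have hijS : i ∉ insert j S := by simp [hi.1, hi.2.2]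
      refine (h.expect_adj_mul_le (Ne.symm hi.1) ?_ ?_ hB).trans ?_
      · intro x g g' E hg
        have h3 := msgAt_edgeFree (v := v) (code := code) (t := t) (S := insert j S) (i := i)
          (j := j) (l := i) hijS (by simp) x g g' E hg
        have h4 := msgAt_edgeFree (v := v) (code := code) (t := t) (S := insert l (insert j S))
          (i := i) (j := j) (l := i) (by simp [hi.1, hi.2.1, hi.2.2]) (by simp) x g g' E hg
        simp only [h3, h4]
      · intro ω; split_ifs <;> norm_num
      · refine mul_le_mul_of_nonneg_left (ih _ _ hijS ?_ hi.2.1) hB0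
        simp [hjl.symm, hl]
    refine (add_le_add e1 (Finset.sum_le_card_nsmul _ _ _ e2)).trans ?_
    have hcard : ((S'ᶜ.card : ℕ) : ℝ) ≤ n := by
      exact_mod_cast (Finset.card_le_univ _).trans (by simp)
    rw [nsmul_eq_mul, Finset.sum_range_succ', Finset.mul_sum, ← Finset.mul_sum]
    have hsum : 0 ≤ ∑ s ∈ Finset.range t, D ^ s := Finset.sum_nonneg fun s _ => by positivity
    have e3 : ∑ s ∈ Finset.range t, D ^ (s + 1) = D * ∑ s ∈ Finset.range t, D ^ s := by
      rw [Finset.mul_sum]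
      exact Finset.sum_congr rfl fun s _ => by ring
    rw [e3]
    calc B + (S'ᶜ.card : ℝ) * (B * (B * ∑ s ∈ Finset.range t, D ^ s))
        = B + ((S'ᶜ.card : ℝ) * B) * (B * ∑ s ∈ Finset.range t, D ^ s) := by ring
      _ ≤ B + D * (B * ∑ s ∈ Finset.range t, D ^ s) := by
          gcongr
          exact (mul_le_mul_of_nonneg_right hcard hB0).trans hBD
      _ = _ := by ring

-- At most n neighbours, each present with probability at most B and contributing at most V. The
-- bound is uniform in n and provides the tightness needed to pass from characters to all bounded
-- continuous functions.
open Classical in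
lemma Valid.expect_abs_msgAt_le (h : Valid p q M) {B D V : ℝ} (hB : ∀ k l, M k l ≤ B)
    (hBD : n * B ≤ D) (t : ℕ) (hV : ∀ x, |v t x| ≤ V) (S : Finset (Fin n)) (j : Fin n) :
    expect p q M (fun ω : Outcome n => |msgAt v code (t + 1) S j ω|) ≤ D * V := by
  have hB0 : 0 ≤ B := (h.nonneg 0 0).trans (hB 0 0)
  have hV0 : 0 ≤ V := (abs_nonneg _).trans (hV 0)
  have hpt : ∀ ω : Outcome n, |msgAt v code (t + 1) S j ω| ≤
      ∑ i ∈ (insert j S)ᶜ, if ω.2.1.Adj j i then V else 0 := by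
    intro ω
    rw [msgAt_succ]
    refine (Finset.abs_sum_le_sum_abs _ _).trans (Finset.sum_le_sum fun i _ => ?_)
    split_ifs
    · exact hV _
    · simp
  refine (h.expect_mono hpt).trans ?_
  rw [expect_sum]
  have e2 : ∀ i ∈ (insert j S)ᶜ, expect p q M (fun ω : Outcome n =>
      if ω.2.1.Adj j i then V else 0) ≤ B * V := by
    intro i hi
    simp only [Finset.mem_compl, Finset.mem_insert, not_or] at hi
    have := h.expect_adj_mul_le (f := fun _ : Outcome n => V) (Ne.symm hi.1)
        (fun _ _ _ _ _ => rfl) (fun _ => hV0) hB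
    rwa [expect_const] at this
  refine (Finset.sum_le_card_nsmul _ _ _ e2).trans ?_
  have hcard : (((insert j S)ᶜ.card : ℕ) : ℝ) ≤ n := by
    exact_mod_cast (Finset.card_le_univ _).trans (by simp)
  rw [nsmul_eq_mul]
  calc _ ≤ (n : ℝ) * (B * V) := by gcongr
    _ = n * B * V := by ring
    _ ≤ D * V := by gcongr

end Messages

/-! ### Elementary inequalities -/

lemma norm_prod_sub_prod_le_sum {ι : Type*} (s : Finset ι) (a b : ι → ℂ)
    (ha : ∀ i ∈ s, ‖a i‖ ≤ 1) (hb : ∀ i ∈ s, ‖b i‖ ≤ 1) :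
    ‖∏ i ∈ s, a i - ∏ i ∈ s, b i‖ ≤ ∑ i ∈ s, ‖a i - b i‖ := by
  classical
  induction s using Finset.induction_on with
  | empty => simp
  | insert i s hi ih =>
    rw [Finset.prod_insert hi, Finset.prod_insert hi, Finset.sum_insert hi]
    have h1 : ‖∏ i ∈ s, b i‖ ≤ 1 := by
      rw [norm_prod]
      exact Finset.prod_le_one (fun _ _ => norm_nonneg _) fun j hj => hb j (by simp [hj])
    have h2 : a i * ∏ i ∈ s, a i - b i * ∏ i ∈ s, b i =
        a i * (∏ i ∈ s, a i - ∏ i ∈ s, b i) + (a i - b i) * ∏ i ∈ s, b i := by ring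
    rw [h2]
    refine (norm_add_le _ _).trans ?_
    rw [norm_mul, norm_mul]
    have h3 := ih (fun j hj => ha j (by simp [hj])) (fun j hj => hb j (by simp [hj]))
    have h4 := ha i (by simp)
    nlinarith [norm_nonneg (a i - b i), norm_nonneg (∏ i ∈ s, a i - ∏ i ∈ s, b i), norm_nonneg (a i)]

/-- The left half plane is convex and the derivative of `exp` has norm at most 1 there. -/
lemma norm_exp_sub_exp_le_of_re_nonpos {z w : ℂ} (hz : z.re ≤ 0) (hw : w.re ≤ 0) :
    ‖Complex.exp z - Complex.exp w‖ ≤ ‖z - w‖ := by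
  have hconv : Convex ℝ {u : ℂ | u.re ≤ 0} := convex_halfSpace_re_le 0
  have := hconv.norm_image_sub_le_of_norm_deriv_le (𝕜 := ℂ) (f := Complex.exp) (C := 1) (x := w) (y := z)
    (fun u _ => Complex.differentiableAt_exp) (fun u hu => by
      rw [Complex.deriv_exp, Complex.norm_exp]
      exact Real.exp_le_one_iff.2 hu) hw hz
  simpa using this

lemma norm_exp_mul_I_sub_one_re (x : ℝ) : (Complex.exp (x * Complex.I) - 1).re ≤ 0 := by
  rw [Complex.sub_re, Complex.one_re, Complex.exp_ofReal_mul_I_re]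
  linarith [Real.cos_le_one x]

lemma norm_exp_mul_I_sub_one_le (x : ℝ) : ‖Complex.exp (x * Complex.I) - 1‖ ≤ 2 := by
  refine (norm_sub_le _ _).trans ?_
  rw [Complex.norm_exp_ofReal_mul_I, norm_one]; norm_num

lemma norm_one_add_mul_le_one {m : ℝ} (h0 : 0 ≤ m) (h1 : m ≤ 1) {z : ℂ} (hz : ‖z‖ ≤ 1) :
    ‖1 + (m : ℂ) * (z - 1)‖ ≤ 1 := by
  have : 1 + (m : ℂ) * (z - 1) = ((1 - m : ℝ) : ℂ) + (m : ℂ) * z := by push_cast; ring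
  rw [this]
  refine (norm_add_le _ _).trans ?_
  rw [norm_mul, Complex.norm_real, Complex.norm_real, Real.norm_of_nonneg h0,
    Real.norm_of_nonneg (by linarith)]
  nlinarith

/-! ### Second moments, and the conditional characters of the messages. -/

section LLN

variable {n : ℕ} {v : ℕ → ℝ → ℝ} {code : Option (Fin 2) → ℝ}
variable {p q : ℝ} {M : Matrix (Fin 2) (Fin 2) ℝ}

/-- The contribution of the vertices with label `k` to the empirical mean of `g` over the messages
sent after `t` rounds. -/
noncomputable def empMean (v : ℕ → ℝ → ℝ) (code : Option (Fin 2) → ℝ) (t : ℕ) (k : Fin 2)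
    (g : ℝ → ℂ) (S : Finset (Fin n)) (ω : Outcome n) : ℂ :=
  (1 / n : ℂ) * ∑ j ∈ Sᶜ, if ω.1 j = k then g (msgAt v code t S j ω) else 0

/-- Chebyshev's argument: in the second moment of the mean, the diagonal contributes at most C²/n
and the off-diagonal terms at most δ. -/
lemma Valid.expect_norm_mean_le (h : Valid p q M) (s : Finset (Fin n)) (f : Fin n → Outcome n → ℂ)
    {C δ : ℝ} (hC : 0 ≤ C) (hf : ∀ j ω, ‖f j ω‖ ≤ C) (hδ : 0 ≤ δ)
    (hcov : ∀ j ∈ s, ∀ l ∈ s, j ≠ l →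
      ‖expect p q M (fun ω => f j ω * (starRingEnd ℂ) (f l ω))‖ ≤ δ) :
    expect p q M (fun ω : Outcome n => ‖(1 / n : ℂ) * ∑ j ∈ s, f j ω‖) ≤ √(C ^ 2 / n + δ) := by
  apply Real.le_sqrt_of_sq_le
  refine (h.sq_expect_le _).trans ?_
  have hsq : ∀ ω : Outcome n, ((‖(1 / n : ℂ) * ∑ j ∈ s, f j ω‖ ^ 2 : ℝ) : ℂ) =
      (1 / n : ℂ) ^ 2 * ∑ j ∈ s, ∑ l ∈ s, f j ω * (starRingEnd ℂ) (f l ω) := by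
    intro ω
    rw [norm_mul, mul_pow]
    push_cast
    rw [← Complex.mul_conj' (∑ j ∈ s, f j ω), map_sum, Finset.sum_mul_sum]
    congr 2
    simp
  have h1 : ((expect p q M (fun ω : Outcome n => ‖(1 / n : ℂ) * ∑ j ∈ s, f j ω‖ ^ 2) : ℝ) : ℂ) =
      (1 / n : ℂ) ^ 2 * ∑ j ∈ s, ∑ l ∈ s,
        expect p q M (fun ω => f j ω * (starRingEnd ℂ) (f l ω)) := by
    rw [ofReal_expect]
    simp only [hsq]
    rw [expect_const_mul, expect_sum]
    simp only [expect_sum]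
  have hnn : 0 ≤ expect p q M (fun ω : Outcome n => ‖(1 / n : ℂ) * ∑ j ∈ s, f j ω‖ ^ 2) :=
    h.expect_nonneg fun ω => sq_nonneg _
  rw [← Real.norm_of_nonneg hnn, ← Complex.norm_real, h1, norm_mul]
  have hpair : ∀ j ∈ s, ∀ l ∈ s, ‖expect p q M (fun ω => f j ω * (starRingEnd ℂ) (f l ω))‖ ≤
      (if j = l then C ^ 2 else 0) + δ := by
    intro j hj l hl
    split_ifs with hjl
    · refine ((h.norm_expect_le _).trans (h.expect_mono (g := fun _ => C ^ 2) fun ω => ?_)).trans ?_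
      · rw [norm_mul, RCLike.norm_conj, sq]
        exact mul_le_mul (hf _ _) (hf _ _) (norm_nonneg _) hC
      · rw [expect_const]; linarith
    · rw [zero_add]; exact hcov j hj l hl hjl
  have h2 : ‖∑ j ∈ s, ∑ l ∈ s, expect p q M (fun ω => f j ω * (starRingEnd ℂ) (f l ω))‖ ≤
      n * C ^ 2 + n ^ 2 * δ := by
    have hcard : (s.card : ℝ) ≤ n := by exact_mod_cast (Finset.card_le_univ _).trans (by simp)
    calc _ ≤ ∑ j ∈ s, ∑ l ∈ s, ((if j = l then C ^ 2 else 0) + δ) :=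
          (norm_sum_le _ _).trans (Finset.sum_le_sum fun j hj => (norm_sum_le _ _).trans
            (Finset.sum_le_sum fun l hl => hpair j hj l hl))
      _ = s.card * C ^ 2 + s.card ^ 2 * δ := by
          have : ∀ j ∈ s, ∑ l ∈ s, ((if j = l then C ^ 2 else 0) + δ) = C ^ 2 + s.card * δ := by
            intro j hj
            rw [Finset.sum_add_distrib, Finset.sum_ite_eq, if_pos hj]; simp
          rw [Finset.sum_congr rfl this]
          simp; ring
      _ ≤ _ := by gcongr
  have h3 : ‖(1 / n : ℂ) ^ 2‖ = (1 / (n : ℝ)) ^ 2 := by simp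
  rw [h3]
  rcases Nat.eq_zero_or_pos n with hn | hn
  · have : (n : ℝ) = 0 := by exact_mod_cast hn
    rw [this]; simpa using hδ
  have hn' : (0 : ℝ) < n := by exact_mod_cast hn
  calc _ ≤ (1 / (n : ℝ)) ^ 2 * (n * C ^ 2 + n ^ 2 * δ) := by gcongr
    _ = _ := by field_simp

/-- The characteristic function of the message `msg (t+1) _ j`, given the labels and the edges that
avoid `j`. -/
noncomputable def condChar (v : ℕ → ℝ → ℝ) (code : Option (Fin 2) → ℝ)
    (M : Matrix (Fin 2) (Fin 2) ℝ) (t : ℕ) (θ : ℝ) (S : Finset (Fin n)) (j : Fin n)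
    (ω : Outcome n) : ℂ :=
  ∏ i ∈ Sᶜ, (1 + M (ω.1 j) (ω.1 i) *
    (Complex.exp ((θ * v t (msgAt v code t S i ω) : ℝ) * Complex.I) - 1))

lemma Valid.norm_condChar_le (h : Valid p q M) (t : ℕ) (θ : ℝ) (S : Finset (Fin n)) (j : Fin n)
    (ω : Outcome n) : ‖condChar v code M t θ S j ω‖ ≤ 1 := by
  rw [condChar, norm_prod]
  refine Finset.prod_le_one (fun _ _ => norm_nonneg _) fun i _ =>
    norm_one_add_mul_le_one (h.nonneg _ _) (h.le_one _ _) ?_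
  rw [Complex.norm_exp_ofReal_mul_I]

open Classical in
lemma exp_msgAt_succ (t : ℕ) (θ : ℝ) (S : Finset (Fin n)) (j : Fin n) (ω : Outcome n) :
    Complex.exp ((θ * msgAt v code (t + 1) S j ω : ℝ) * Complex.I) =
      ∏ i ∈ (insert j S)ᶜ, if ω.2.1.Adj j i then
        Complex.exp ((θ * v t (msgAt v code t (insert j S) i ω) : ℝ) * Complex.I) else 1 := by
  rw [msgAt_succ, Finset.mul_sum, Complex.ofReal_sum, Finset.sum_mul, Complex.exp_sum]
  refine Finset.prod_congr rfl fun i _ => ?_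
  split_ifs <;> simp

/-- The messages sent by two vertices that do not use each other are independent given the rest of
the graph. -/
lemma expect_two_messages (hM : ∀ k l, M k l = M l k) (t : ℕ) (k : Fin 2) (θ θ' : ℝ) (χ χ' : ℂ)
    (S : Finset (Fin n)) {j l : Fin n} (hjl : j ≠ l) :
    expect p q M (fun ω : Outcome n =>
      (if ω.1 j = k then
        Complex.exp ((θ * msgAt v code (t + 1) (insert l S) j ω : ℝ) * Complex.I) - χ else 0) *
      (if ω.1 l = k then
        Complex.exp ((θ' * msgAt v code (t + 1) (insert j S) l ω : ℝ) * Complex.I) - χ' else 0)) =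
    expect p q M (fun ω : Outcome n =>
      (if ω.1 j = k then condChar v code M t θ (insert j (insert l S)) j ω - χ else 0) *
      (if ω.1 l = k then condChar v code M t θ' (insert j (insert l S)) l ω - χ' else 0)) := by
  classical
  set S' := insert j (insert l S) with hS'
  have hS'2 : insert l (insert j S) = S' := Finset.insert_comm _ _ _
  have hjS' : j ∈ S' := by simp [hS']
  have hlS' : l ∈ S' := by simp [hS']
  -- The edges between a vertex of S' and the complement of S' are independent of the messages
  -- computed outside S'. This is applied to j, then to l; the factor of the other vertex never
  -- involves the edges being integrated out.
  have star : ∀ (a : Fin n) (ϑ : ℝ) (c : ℂ) (f : Outcome n → ℂ), a ∈ S' →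
      (∀ i ∈ S'ᶜ, EdgeFree a i f) →
      expect p q M (fun ω : Outcome n => ((∏ i ∈ S'ᶜ, if ω.2.1.Adj a i then
        Complex.exp ((ϑ * v t (msgAt v code t S' i ω) : ℝ) * Complex.I) else 1) - c) * f ω) =
      expect p q M (fun ω : Outcome n => (condChar v code M t ϑ S' a ω - c) * f ω) := by
    intro a ϑ c f ha hf
    have := expect_star (p := p) (q := q) (M := M) hM S'ᶜ (j := a) (by simp [ha])
      (fun i ω => Complex.exp ((ϑ * v t (msgAt v code t S' i ω) : ℝ) * Complex.I)) f
      (by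
        intro i hi b _ x g g' E hg
        have := msgAt_edgeFree (v := v) (code := code) (t := t) (Finset.mem_compl.1 hi)
          (Or.inl ha) (l := b) x g g' E hg
        simp only [this]) hf
    simp only [sub_mul]
    rw [expect_sub, this, expect_sub]
    rfl
  have hcond : ∀ a b : Fin n, ∀ ϑ : ℝ, ∀ i ∈ S'ᶜ, b ∈ S' →
      EdgeFree b i (condChar v code M t ϑ S' a) := by
    intro a b ϑ i _ hb x g g' E hg
    simp only [condChar]
    refine Finset.prod_congr rfl fun i' hi' => ?_
    have := msgAt_edgeFree (v := v) (code := code) (t := t) (Finset.mem_compl.1 hi')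
      (Or.inl hb) (l := i) x g g' E hg
    simp only [this]
  have s1 := star j θ χ (fun ω => if ω.1 j = k then (if ω.1 l = k then
    (∏ i ∈ S'ᶜ, if ω.2.1.Adj l i then
        Complex.exp ((θ' * v t (msgAt v code t S' i ω) : ℝ) * Complex.I) else 1) - χ' else 0) else 0)
    hjS' (by
      intro i hi x g g' E hg
      have hi' := Finset.mem_compl.1 hi
      have hij : i ≠ l := fun h => hi' (h ▸ hlS')
      have : (∏ a ∈ S'ᶜ, if g.Adj l a then
          Complex.exp ((θ' * v t (msgAt v code t S' a (x, g, E)) : ℝ) * Complex.I) else 1) =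
          ∏ a ∈ S'ᶜ, if g'.Adj l a then
          Complex.exp ((θ' * v t (msgAt v code t S' a (x, g', E)) : ℝ) * Complex.I) else 1 := by
        refine Finset.prod_congr rfl fun a ha => ?_
        have h1 := msgAt_edgeFree (v := v) (code := code) (t := t) (Finset.mem_compl.1 ha)
          (Or.inl hjS') (l := i) x g g' E hg
        have h2 : g.Adj l a ↔ g'.Adj l a := hg l a (by
          rintro (⟨h, -⟩ | ⟨h, -⟩)
          · exact hjl h.symm
          · exact hij h.symm)
        simp only [h1, h2]
      simp only [this])
  have s2 := star l θ' χ' (fun ω => if ω.1 l = k then (if ω.1 j = k then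
    condChar v code M t θ S' j ω - χ else 0) else 0) hlS' (by
      intro i hi x g g' E hg
      have := hcond j l θ i hi hlS' x g g' E hg
      simp only [this])
  calc _ = expect p q M (fun ω : Outcome n => ((∏ i ∈ S'ᶜ, if ω.2.1.Adj j i then
        Complex.exp ((θ * v t (msgAt v code t S' i ω) : ℝ) * Complex.I) else 1) - χ) *
        (if ω.1 j = k then (if ω.1 l = k then
        (∏ i ∈ S'ᶜ, if ω.2.1.Adj l i then
        Complex.exp ((θ' * v t (msgAt v code t S' i ω) : ℝ) * Complex.I) else 1) - χ'
          else 0) else 0)) := by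
        congr 1
        funext ω
        rw [exp_msgAt_succ, exp_msgAt_succ, hS'2, ← hS']
        split_ifs <;> simp
    _ = _ := s1
    _ = expect p q M (fun ω : Outcome n => ((∏ i ∈ S'ᶜ, if ω.2.1.Adj l i then
        Complex.exp ((θ' * v t (msgAt v code t S' i ω) : ℝ) * Complex.I) else 1) - χ') *
        (if ω.1 l = k then (if ω.1 j = k then
    condChar v code M t θ S' j ω - χ else 0) else 0)) := by
        congr 1
        funext ω
        split_ifs <;> ring
    _ = _ := s2
    _ = _ := by
        congr 1
        funext ω
        split_ifs <;> ring

/-- Law of large numbers for the messages sent after `t` rounds, as the number of vertices grows: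
`ℓ` is the limit of the mean of `g` over the messages sent by the vertices with label `k`. -/
def LLN (p q d : ℝ) (K : Matrix (Fin 2) (Fin 2) ℝ) (v : ℕ → ℝ → ℝ) (code : Option (Fin 2) → ℝ)
    (t : ℕ) (k : Fin 2) (g : ℝ → ℂ) (ℓ : ℂ) : Prop :=
  -- Uniformity over all removed sets of bounded size is what lets the induction run: each round
  -- removes two more vertices.
  ∀ c : ℕ, ∀ η > 0, ∀ᶠ n : ℕ in atTop, ∀ S : Finset (Fin n), S.card ≤ c →
    expect p q ((d / n) • K) (fun ω => ‖empMean v code t k g S ω - labelProb p k * ℓ‖) ≤ η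

/-- The conditional character is a product of factors 1 + a_i with ‖a_i‖ ≤ 2D/n and nonpositive real
part. Replacing 1 + a_i by exp(a_i) costs at most ‖a_i‖² each, in total 4D²/n. The sum of the a_i is
a linear combination of empirical means, and `exp` is 1-Lipschitz on the left half plane. -/
lemma norm_condChar_sub_le {d D : ℝ} {K : Matrix (Fin 2) (Fin 2) ℝ} (hM : Valid p q ((d / n) • K))
    (hd : 0 ≤ d) (hK : ∀ k l, 0 ≤ K k l) (hD : ∀ k l, d * K k l ≤ D) (hn0 : 0 < n)
    (t : ℕ) (θ : ℝ) (S : Finset (Fin n)) (j : Fin n) (ω : Outcome n) (ℓ : Fin 2 → ℂ)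
    (hℓ : ∀ k, (ℓ k).re ≤ 0) :
    ‖condChar v code ((d / n) • K) t θ S j ω -
        Complex.exp (∑ k, d * K (ω.1 j) k * (labelProb p k * ℓ k))‖ ≤
      4 * D ^ 2 / n + D * ∑ k, ‖empMean v code t k
        (fun x => Complex.exp ((θ * v t x : ℝ) * Complex.I) - 1) S ω - labelProb p k * ℓ k‖ := by
  have hn' : (0 : ℝ) < n := by exact_mod_cast hn0
  have hD0 : 0 ≤ D := (mul_nonneg hd (hK 0 0)).trans (hD 0 0)
  set g : ℝ → ℂ := fun x => Complex.exp ((θ * v t x : ℝ) * Complex.I) - 1 with hg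
  set a : Fin n → ℂ := fun i => ((d / n) • K) (ω.1 j) (ω.1 i) * g (msgAt v code t S i ω) with ha
  have hMa : ∀ k l, ((d / n) • K) k l = d * K k l / n := by
    intro k l; simp [Matrix.smul_apply]; ring
  have hMle : ∀ k l, ((d / n) • K) k l ≤ D / n := by
    intro k l; rw [hMa]; gcongr; exact hD k l
  have hare : ∀ i, (a i).re ≤ 0 := by
    intro i
    simp only [ha, Complex.re_ofReal_mul]
    exact mul_nonpos_of_nonneg_of_nonpos (hM.nonneg _ _) (norm_exp_mul_I_sub_one_re _)
  have hanorm : ∀ i, ‖a i‖ ≤ 2 * D / n := by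
    intro i
    simp only [ha, norm_mul, Complex.norm_real, Real.norm_of_nonneg (hM.nonneg _ _)]
    calc _ ≤ D / n * 2 := mul_le_mul (hMle _ _) (norm_exp_mul_I_sub_one_le _) (norm_nonneg _)
          (by positivity)
      _ = _ := by ring
  have hexp : ∀ i, ‖1 + a i - Complex.exp (a i)‖ ≤ 4 * D ^ 2 / n ^ 2 := by
    intro i
    have h2 : ‖a i‖ ^ 2 ≤ 4 * D ^ 2 / n ^ 2 := by
      calc ‖a i‖ ^ 2 ≤ (2 * D / n) ^ 2 := by gcongr; exact hanorm i
        _ = _ := by ring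
    refine le_trans ?_ h2
    -- second order Taylor bound in the half plane
    have hconv : Convex ℝ {u : ℂ | u.re ≤ 0} := convex_halfSpace_re_le 0
    have h0 : ∀ u ∈ segment ℝ 0 (a i), ‖Complex.exp u - 1‖ ≤ ‖a i‖ := by
      intro u hu
      have hure : u.re ≤ 0 := hconv.segment_subset (by simp) (hare i) hu
      have h3 : ‖u‖ ≤ ‖a i‖ := by
        have := segment_subset_closedBall_left (0 : ℂ) (a i) hu
        simpa using this
      have h4 := norm_exp_sub_exp_le_of_re_nonpos hure (w := 0) (by simp)
      rw [Complex.exp_zero, sub_zero] at h4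
      exact h4.trans h3
    have := (convex_segment (0 : ℂ) (a i)).norm_image_sub_le_of_norm_deriv_le (𝕜 := ℂ)
      (f := fun u => Complex.exp u - u) (C := ‖a i‖) (x := 0) (y := a i)
      (fun u _ => by fun_prop) (fun u hu => by
        have : deriv (fun u => Complex.exp u - u) u = Complex.exp u - 1 := by
          rw [deriv_fun_sub (by fun_prop) (by fun_prop)]; simp
        rw [this]; exact h0 u hu) (left_mem_segment _ _ _) (right_mem_segment _ _ _)
    have e : 1 + a i - Complex.exp (a i) =
        - ((Complex.exp (a i) - a i) - (Complex.exp 0 - 0)) := by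
      rw [Complex.exp_zero]; ring
    rw [e, norm_neg, sq]
    simpa using this
  have hsum : ∑ i ∈ Sᶜ, a i = ∑ k, d * K (ω.1 j) k * empMean v code t k g S ω := by
    simp only [empMean, Finset.mul_sum]
    rw [Finset.sum_comm]
    refine Finset.sum_congr rfl fun i _ => ?_
    rw [Finset.sum_eq_single (ω.1 i)]
    · simp only [ha, hMa, if_true]; push_cast; ring
    · intro k _ hk; rw [if_neg (Ne.symm hk)]; ring
    · simp
  have hcc : condChar v code ((d / n) • K) t θ S j ω = ∏ i ∈ Sᶜ, (1 + a i) := rfl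
  have hsumre : (∑ k, d * K (ω.1 j) k * (labelProb p k * ℓ k)).re ≤ 0 := by
    rw [Complex.re_sum]
    refine Finset.sum_nonpos fun k _ => ?_
    have : (d : ℂ) * K (ω.1 j) k * (labelProb p k * ℓ k) =
        ((d * K (ω.1 j) k * labelProb p k : ℝ) : ℂ) * ℓ k := by push_cast; ring
    rw [this, Complex.re_ofReal_mul]
    exact mul_nonpos_of_nonneg_of_nonpos
      (mul_nonneg (mul_nonneg hd (hK _ _)) (hM.labelProb_pos _).le) (hℓ k)
  have hsumre' : (∑ i ∈ Sᶜ, a i).re ≤ 0 := by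
    rw [Complex.re_sum]
    exact Finset.sum_nonpos fun i _ => hare i
  have h1 : ‖condChar v code ((d / n) • K) t θ S j ω - Complex.exp (∑ i ∈ Sᶜ, a i)‖ ≤
      4 * D ^ 2 / n := by
    rw [hcc, Complex.exp_sum]
    refine (norm_prod_sub_prod_le_sum _ _ _ ?_ ?_).trans ?_
    · intro i _
      refine norm_one_add_mul_le_one (hM.nonneg _ _) (hM.le_one _ _) ?_
      rw [Complex.norm_exp_ofReal_mul_I]
    · intro i _
      rw [Complex.norm_exp]; exact Real.exp_le_one_iff.2 (hare i)
    · refine (Finset.sum_le_card_nsmul _ _ _ fun i _ => hexp i).trans ?_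
      have hcard : ((Sᶜ.card : ℕ) : ℝ) ≤ n := by
        exact_mod_cast (Finset.card_le_univ _).trans (by simp)
      rw [nsmul_eq_mul]
      calc _ ≤ (n : ℝ) * (4 * D ^ 2 / n ^ 2) := by gcongr
        _ = _ := by field_simp
  have h2 : ‖Complex.exp (∑ i ∈ Sᶜ, a i) -
      Complex.exp (∑ k, d * K (ω.1 j) k * (labelProb p k * ℓ k))‖ ≤
      D * ∑ k, ‖empMean v code t k g S ω - labelProb p k * ℓ k‖ := by
    refine (norm_exp_sub_exp_le_of_re_nonpos hsumre' hsumre).trans ?_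
    rw [hsum, ← Finset.sum_sub_distrib, Finset.mul_sum]
    refine (norm_sum_le _ _).trans (Finset.sum_le_sum fun k _ => ?_)
    rw [← mul_sub, norm_mul]
    gcongr
    rw [← Complex.ofReal_mul, Complex.norm_real, Real.norm_of_nonneg (mul_nonneg hd (hK _ _))]
    exact hD _ _
  calc _ ≤ _ := norm_sub_le_norm_sub_add_norm_sub _ (Complex.exp (∑ i ∈ Sᶜ, a i)) _
    _ ≤ _ := add_le_add h1 h2

end LLN

/-! ### The law of large numbers for characters, by induction on the rounds. -/

section LLN

variable {n : ℕ} {v : ℕ → ℝ → ℝ} {code : Option (Fin 2) → ℝ}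
variable {p q : ℝ} {M : Matrix (Fin 2) (Fin 2) ℝ}

/-- Distinct vertices are independent, so the centred variables have zero covariance. The second
error term accounts for the vertices of S missing from the sum. -/
lemma Valid.expect_vertex_mean_le (h : Valid p q M) (hn : 0 < n) (φ : Fin 2 → Prop → ℂ) {C : ℝ}
    (hC : ∀ k b, ‖φ k b‖ ≤ C) (S : Finset (Fin n)) :
    expect p q M (fun ω : Outcome n => ‖(1 / n : ℂ) * ∑ j ∈ Sᶜ, φ (ω.1 j) (j ∈ ω.2.2) -
      ∑ k, (labelProb p k : ℂ) * (q * φ k True + (1 - q) * φ k False)‖) ≤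
      √((2 * C) ^ 2 / n) + S.card * C / n := by
  set m := ∑ k, (labelProb p k : ℂ) * (q * φ k True + (1 - q) * φ k False) with hm
  have hC0 : 0 ≤ C := (norm_nonneg _).trans (hC 0 True)
  have hn' : (0 : ℝ) < n := by exact_mod_cast hn
  have hmC : ‖m‖ ≤ C := by
    have hk : ∀ k, ‖(labelProb p k : ℂ) * (q * φ k True + (1 - q) * φ k False)‖ ≤
        labelProb p k * C := by
      intro k
      rw [norm_mul, Complex.norm_real, Real.norm_of_nonneg (h.labelProb_pos k).le]
      refine mul_le_mul_of_nonneg_left ?_ (h.labelProb_pos k).le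
      have e : (1 - q : ℂ) = ((1 - q : ℝ) : ℂ) := by push_cast; rfl
      refine (norm_add_le _ _).trans ?_
      rw [e, norm_mul, norm_mul, Complex.norm_real, Complex.norm_real,
        Real.norm_of_nonneg h.q_nonneg, Real.norm_of_nonneg (by linarith [h.q_le])]
      nlinarith [hC k True, hC k False, h.q_nonneg, h.q_le]
    refine (norm_sum_le _ _).trans ((Finset.sum_le_sum fun k _ => hk k).trans ?_)
    rw [← Finset.sum_mul, labelProb_sum, one_mul]
  set f : Fin n → Outcome n → ℂ := fun j ω => φ (ω.1 j) (j ∈ ω.2.2) - m with hf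
  have hf2 : ∀ j ω, ‖f j ω‖ ≤ 2 * C := fun j ω => by
    refine (norm_sub_le _ _).trans ?_
    linarith [hC (ω.1 j) (j ∈ ω.2.2)]
  have hzero : ∑ k, (labelProb p k : ℂ) * (q * (φ k True - m) + (1 - q) * (φ k False - m)) = 0 := by
    have hl : ∑ k, (labelProb p k : ℂ) = 1 := by exact_mod_cast labelProb_sum p
    have : ∀ k, (labelProb p k : ℂ) * (q * (φ k True - m) + (1 - q) * (φ k False - m)) =
        (labelProb p k : ℂ) * (q * φ k True + (1 - q) * φ k False) - labelProb p k * m := by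
      intro k; ring
    simp only [this, Finset.sum_sub_distrib, ← Finset.sum_mul, hl]
    rw [← hm]; ring
  have h1 := h.expect_norm_mean_le Sᶜ f (C := 2 * C) (δ := 0) (by positivity) hf2 le_rfl (by
    intro j _ l _ hjl
    have := expect_two_vertices (p := p) (q := q) (M := M) hjl (fun k b => φ k b - m)
      (fun k b => (starRingEnd ℂ) (φ k b - m))
    simp only [hf]
    rw [this, hzero]; simp)
  rw [add_zero] at h1
  refine le_trans (h.expect_mono (g := fun ω => ‖(1 / n : ℂ) * ∑ j ∈ Sᶜ, f j ω‖ +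
    S.card * C / n) fun ω => ?_) ?_
  · have hcard : (Sᶜ.card : ℂ) = n - S.card := by
      have := Finset.card_compl_add_card S
      rw [Fintype.card_fin] at this
      have : (Sᶜ.card : ℂ) + S.card = n := by exact_mod_cast this
      rw [← this]; ring
    have hnC : (n : ℂ) ≠ 0 := by exact_mod_cast hn.ne'
    have e : (1 / n : ℂ) * ∑ j ∈ Sᶜ, φ (ω.1 j) (j ∈ ω.2.2) - m =
        (1 / n : ℂ) * ∑ j ∈ Sᶜ, f j ω - (S.card / n : ℂ) * m := by
      simp only [hf, Finset.sum_sub_distrib, Finset.sum_const, nsmul_eq_mul, hcard]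
      field_simp
      ring
    rw [e]
    refine (norm_sub_le _ _).trans (add_le_add le_rfl ?_)
    rw [norm_mul, norm_div, Complex.norm_natCast, Complex.norm_natCast, mul_div_right_comm]
    gcongr
  · rw [expect_add, expect_const]
    linarith

lemma tendsto_sqrt_const_div (C : ℝ) : Tendsto (fun n : ℕ => √(C / n)) atTop (𝓝 0) := by
  have := (Real.continuous_sqrt.tendsto 0).comp (tendsto_const_div_atTop_nhds_zero_nat C)
  rwa [Real.sqrt_zero] at this

variable {d : ℝ} {K : Matrix (Fin 2) (Fin 2) ℝ}

lemma eventually_valid (hp0 : 0 < p) (hp1 : p < 1) (hq0 : 0 ≤ q) (hq1 : q ≤ 1) (hd : 0 ≤ d)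
    (hKs : ∀ k l, K k l = K l k) (hK : ∀ k l, 0 ≤ K k l) :
    ∀ᶠ n : ℕ in atTop, Valid p q ((d / n) • K) := by
  have h1 : ∀ k l, ∀ᶠ n : ℕ in atTop, d * K k l / n ≤ 1 := fun k l =>
    ((tendsto_const_div_atTop_nhds_zero_nat (d * K k l)).eventually_lt_const zero_lt_one).mono
      fun n hn => hn.le
  have h2 : ∀ᶠ n : ℕ in atTop, ∀ k l, d * K k l / n ≤ 1 := by
    rw [eventually_all]; intro k; rw [eventually_all]; exact h1 k
  filter_upwards [h2] with n hn
  refine ⟨hp0, hp1, hq0, hq1, fun k l => ?_, fun k l => ?_, fun k l => ?_⟩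
  · simp only [Matrix.smul_apply, hKs k l]
  · simp only [Matrix.smul_apply, smul_eq_mul]
    have := hK k l
    positivity
  · simp only [Matrix.smul_apply, smul_eq_mul]
    refine le_trans (le_of_eq ?_) (hn k l)
    ring

lemma lln_zero (hv : ∀ᶠ n : ℕ in atTop, Valid p q ((d / n) • K)) (k : Fin 2) (g : ℝ → ℂ) :
    LLN p q d K v code 0 k g (q * g (code (some k)) + (1 - q) * g (code none)) := by
  intro c η hη
  set φ : Fin 2 → Prop → ℂ := fun k' b => by
    classical exact if k' = k then g (code (if b then some k' else none)) else 0 with hφ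
  obtain ⟨C, hC⟩ : ∃ C, ∀ k b, ‖φ k b‖ ≤ C := by
    refine ⟨‖g (code (some k))‖ + ‖g (code none)‖, fun k' b => ?_⟩
    simp only [hφ]
    have h1 := norm_nonneg (g (code (some k)))
    have h2 := norm_nonneg (g (code none))
    split_ifs with h3 h4
    · rw [h3]; linarith
    · linarith
    · rw [norm_zero]; linarith
  have hC0 : 0 ≤ C := (norm_nonneg _).trans (hC 0 True)
  have ht : Tendsto (fun n : ℕ => √((2 * C) ^ 2 / n) + c * C / n) atTop (𝓝 0) := by
    simpa using (tendsto_sqrt_const_div ((2 * C) ^ 2)).add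
      (tendsto_const_div_atTop_nhds_zero_nat (c * C))
  filter_upwards [hv, ht.eventually_lt_const hη, eventually_gt_atTop 0] with n hM hn hn0 S hS
  have h1 := hM.expect_vertex_mean_le hn0 φ hC S
  have e1 : ∑ k', (labelProb p k' : ℂ) * (q * φ k' True + (1 - q) * φ k' False) =
      labelProb p k * (q * g (code (some k)) + (1 - q) * g (code none)) := by
    rw [Finset.sum_eq_single k]
    · simp [hφ]
    · intro b _ hb; simp [hφ, hb]
    · simp
  rw [e1] at h1
  have e2 : (fun ω : Outcome n => ‖empMean v code 0 k g S ω -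
      labelProb p k * (q * g (code (some k)) + (1 - q) * g (code none))‖) =
      fun ω : Outcome n => ‖(1 / n : ℂ) * ∑ j ∈ Sᶜ, φ (ω.1 j) (j ∈ ω.2.2) -
        labelProb p k * (q * g (code (some k)) + (1 - q) * g (code none))‖ := by
    funext ω
    congr 2
    rw [empMean]
    congr 1
    refine Finset.sum_congr rfl fun j _ => ?_
    simp only [hφ, msgAt, msg, reveal]
    by_cases h1 : j ∈ ω.2.2 <;> by_cases h2 : ω.1 j = k <;> simp [h1, h2]
  rw [e2]
  refine h1.trans (le_trans ?_ hn.le)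
  have : (S.card : ℝ) ≤ c := by exact_mod_cast hS
  gcongr

lemma label_mean_le (hv : Valid p q M) (hn : 0 < n) (k : Fin 2) (S : Finset (Fin n)) :
    expect p q M (fun ω : Outcome n =>
      ‖(1 / n : ℂ) * ∑ j ∈ Sᶜ, (if ω.1 j = k then (1 : ℂ) else 0) - labelProb p k‖) ≤
      √(4 / n) + S.card / n := by
  have h1 := hv.expect_vertex_mean_le hn (fun k' _ => if k' = k then 1 else 0) (C := 1)
    (fun k' _ => by split_ifs <;> simp) S
  have e1 : ∑ k', (labelProb p k' : ℂ) * (q * (if k' = k then 1 else 0) +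
      (1 - q) * (if k' = k then 1 else 0)) = labelProb p k := by
    rw [Finset.sum_eq_single k]
    · simp
    · intro b _ hb; simp [hb]
    · simp
  rw [e1] at h1
  have e2 : ((2 : ℝ) * 1) ^ 2 = 4 := by norm_num
  rwa [e2, mul_one] at h1

/-- By the second moment bound it suffices to control covariances of centred characters at two
vertices j and l. Computing each message without the other vertex costs O(1/n). Integrating out the
edges at j and l then replaces the characters by conditional characters, which are close to χ by
`norm_condChar_sub_le` and the law of large numbers of the previous round. -/
lemma lln_char_succ (hv : ∀ᶠ n : ℕ in atTop, Valid p q ((d / n) • K)) (hd : 0 ≤ d)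
    (hK : ∀ k l, 0 ≤ K k l) (t : ℕ) (k : Fin 2) (θ : ℝ) (ℓ : Fin 2 → ℂ) (hℓ : ∀ k, (ℓ k).re ≤ 0)
    (h : ∀ k', LLN p q d K v code t k'
      (fun x => Complex.exp ((θ * v t x : ℝ) * Complex.I) - 1) (ℓ k')) :
    LLN p q d K v code (t + 1) k (fun x => Complex.exp ((θ * x : ℝ) * Complex.I))
      (Complex.exp (∑ k', d * K k k' * (labelProb p k' * ℓ k'))) := by
  classical
  intro c η hη
  obtain ⟨D, hD0, hD⟩ : ∃ D, 0 ≤ D ∧ ∀ k l, d * K k l ≤ D :=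
    ⟨∑ k, ∑ l, d * K k l, Finset.sum_nonneg fun k _ => Finset.sum_nonneg fun l _ =>
      mul_nonneg hd (hK k l), fun k l =>
      (Finset.single_le_sum (f := fun l => d * K k l) (fun l _ => mul_nonneg hd (hK k l))
        (Finset.mem_univ l)).trans
      (Finset.single_le_sum (f := fun k => ∑ l, d * K k l) (fun k _ => Finset.sum_nonneg fun l _ =>
        mul_nonneg hd (hK k l)) (Finset.mem_univ k))⟩
  set χ := Complex.exp (∑ k', d * K k k' * (labelProb p k' * ℓ k')) with hχ
  set C' := ∑ s ∈ Finset.range (t + 1), D ^ s with hC'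
  have hC'0 : 0 ≤ C' := Finset.sum_nonneg fun s _ => by positivity
  -- Chosen so that √(4Dη') ≤ η/2; every other error vanishes as n grows.
  set η' := η ^ 2 / (16 * (D + 1)) with hη'
  have hη'0 : 0 < η' := by positivity
  have hlim : Tendsto (fun n : ℕ => √(4 / n + (16 * D * C' + 8 * D ^ 2) / n + 4 * D * η') +
      (√(4 / n) + c / n)) atTop (𝓝 (√(0 + 0 + 4 * D * η') + (0 + 0))) :=
    ((Real.continuous_sqrt.tendsto _).comp
      (((tendsto_const_div_atTop_nhds_zero_nat _).add
        (tendsto_const_div_atTop_nhds_zero_nat _)).add tendsto_const_nhds)).add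
      ((tendsto_sqrt_const_div 4).add (tendsto_const_div_atTop_nhds_zero_nat _))
  have hlt : √(0 + 0 + 4 * D * η') + (0 + 0) < η := by
    rw [add_zero, add_zero, zero_add, Real.sqrt_lt' hη, hη']
    have : 4 * D * (η ^ 2 / (16 * (D + 1))) = (D / (D + 1)) * (η ^ 2 / 4) := by
      field_simp; ring
    rw [this]
    have : D / (D + 1) ≤ 1 := by rw [div_le_one (by positivity)]; linarith
    nlinarith [sq_nonneg η, pow_pos hη 2]
  -- The bound c + 2 leaves room for the two vertices j and l that are removed below.
  have hall : ∀ᶠ n : ℕ in atTop, ∀ k', ∀ S : Finset (Fin n), S.card ≤ c + 2 →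
    expect p q ((d / n) • K) (fun ω => ‖empMean v code t k'
      (fun x => Complex.exp ((θ * v t x : ℝ) * Complex.I) - 1) S ω - labelProb p k' * ℓ k'‖) ≤ η' := by
    rw [eventually_all]
    exact fun k' => h k' (c + 2) η' hη'0
  filter_upwards [hv, hlim.eventually_lt_const hlt, eventually_gt_atTop 0, hall]
    with n hM hn hn0 hLL S hS
  have hn' : (0 : ℝ) < n := by exact_mod_cast hn0
  have hB : ∀ k l, ((d / n) • K) k l ≤ D / n := by
    intro k l
    have : ((d / n) • K) k l = d * K k l / n := by simp [Matrix.smul_apply]; ring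
    rw [this]; gcongr; exact hD k l
  have hχ1 : ‖χ‖ ≤ 1 := by
    rw [hχ, Complex.norm_exp]
    refine Real.exp_le_one_iff.2 ?_
    rw [Complex.re_sum]
    refine Finset.sum_nonpos fun k' _ => ?_
    have : (d : ℂ) * K k k' * (labelProb p k' * ℓ k') =
        ((d * K k k' * labelProb p k' : ℝ) : ℂ) * ℓ k' := by push_cast; ring
    rw [this, Complex.re_ofReal_mul]
    exact mul_nonpos_of_nonneg_of_nonpos
      (mul_nonneg (mul_nonneg hd (hK _ _)) (hM.labelProb_pos _).le) (hℓ k')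
  -- the centred variables
  set f : Finset (Fin n) → Fin n → Outcome n → ℂ := fun S j ω => if ω.1 j = k then
    Complex.exp ((θ * msgAt v code (t + 1) S j ω : ℝ) * Complex.I) - χ else 0 with hf
  have hf2 : ∀ S j ω, ‖f S j ω‖ ≤ 2 := by
    intro S j ω
    simp only [hf]
    split_ifs
    · refine (norm_sub_le _ _).trans ?_
      rw [Complex.norm_exp_ofReal_mul_I]; linarith
    · simp
  have hconj : ∀ S j ω, (starRingEnd ℂ) (f S j ω) = if ω.1 j = k then
      Complex.exp (((-θ) * msgAt v code (t + 1) S j ω : ℝ) * Complex.I) - (starRingEnd ℂ) χ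
        else 0 := by
    intro S j ω
    simp only [hf]
    split_ifs
    · rw [map_sub, ← Complex.exp_conj, map_mul, Complex.conj_ofReal, Complex.conj_I]
      congr 2; push_cast; ring
    · simp
  have hcov : ∀ j ∈ Sᶜ, ∀ l ∈ Sᶜ, j ≠ l →
      ‖expect p q ((d / n) • K) (fun ω => f S j ω * (starRingEnd ℂ) (f S l ω))‖ ≤
      (16 * D * C' + 8 * D ^ 2) / n + 4 * D * η' := by
    intro j hj l hl hjl
    rw [Finset.mem_compl] at hj hl
    have hne := hM.expect_msgAt_ne_le (v := v) (code := code) hB (D := D)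
      (by rw [mul_div_cancel₀ _ hn'.ne']) (t + 1)
    set Nj : Outcome n → ℝ := fun ω => if msgAt v code (t + 1) S j ω ≠
      msgAt v code (t + 1) (insert l S) j ω then (1 : ℝ) else 0 with hNj
    set Nl : Outcome n → ℝ := fun ω => if msgAt v code (t + 1) S l ω ≠
      msgAt v code (t + 1) (insert j S) l ω then (1 : ℝ) else 0 with hNl
    have hj1 : expect p q ((d / n) • K) Nj ≤ D / n * C' := hne S j l hj hl hjl
    have hl1 : expect p q ((d / n) • K) Nl ≤ D / n * C' := hne S l j hl hj hjl.symm
    -- The integrands differ only when one of the two messages changes, and then by at most 4 + 4;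
    -- each such event has probability at most DC'/n.
    have hrep : ‖expect p q ((d / n) • K) (fun ω => f S j ω * (starRingEnd ℂ) (f S l ω)) -
        expect p q ((d / n) • K) (fun ω => f (insert l S) j ω *
          (starRingEnd ℂ) (f (insert j S) l ω))‖ ≤ 16 * (D / n * C') := by
      rw [← expect_sub]
      refine (hM.norm_expect_le _).trans ?_
      refine (hM.expect_mono (g := fun ω => 8 * (Nj ω + Nl ω)) fun ω => ?_).trans ?_
      · have hbd : ∀ S S' : Finset (Fin n), ‖f S j ω * (starRingEnd ℂ) (f S' l ω)‖ ≤ 4 := by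
          intro S S'
          rw [norm_mul, RCLike.norm_conj]
          nlinarith [hf2 S j ω, hf2 S' l ω, norm_nonneg (f S j ω), norm_nonneg (f S' l ω)]
        have h8 : ‖f S j ω * (starRingEnd ℂ) (f S l ω) - f (insert l S) j ω *
          (starRingEnd ℂ) (f (insert j S) l ω)‖ ≤ 8 := by
          refine (norm_sub_le _ _).trans ?_
          linarith [hbd S S, hbd (insert l S) (insert j S)]
        simp only [hNj, hNl]
        split_ifs with h1 h2 h2
        · linarith
        · linarith
        · linarith
        · rw [not_not] at h1 h2
          have e1 : f S j ω = f (insert l S) j ω := by simp only [hf, h1]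
          have e2 : f S l ω = f (insert j S) l ω := by simp only [hf, h2]
          rw [e1, e2]; simp
      · rw [expect_const_mul, expect_add]; linarith
    -- Only the factor at j has to be small; the factor at l is bounded by 2.
    have hind : ‖expect p q ((d / n) • K) (fun ω => f (insert l S) j ω *
          (starRingEnd ℂ) (f (insert j S) l ω))‖ ≤ 2 * (4 * D ^ 2 / n + D * (2 * η')) := by
      have e1 : (fun ω => f (insert l S) j ω * (starRingEnd ℂ) (f (insert j S) l ω)) =
          fun ω : Outcome n => (if ω.1 j = k then
          Complex.exp ((θ * msgAt v code (t + 1) (insert l S) j ω : ℝ) * Complex.I) - χ else 0) *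
          (if ω.1 l = k then Complex.exp (((-θ) * msgAt v code (t + 1) (insert j S) l ω : ℝ) *
            Complex.I) - (starRingEnd ℂ) χ else 0) := by
        funext ω; rw [hconj]
      rw [e1, expect_two_messages hM.symm t k θ (-θ) χ _ S hjl]
      set S' := insert j (insert l S) with hS'
      have hS'c : S'.card ≤ c + 2 := by
        refine (Finset.card_insert_le _ _).trans ?_
        have := Finset.card_insert_le l S
        omega
      refine (hM.norm_expect_le _).trans ?_
      refine (hM.expect_mono (g := fun ω => 2 * (4 * D ^ 2 / n + D * ∑ k', ‖empMean v code t k'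
        (fun x => Complex.exp ((θ * v t x : ℝ) * Complex.I) - 1) S' ω - labelProb p k' * ℓ k'‖))
        fun ω => ?_).trans ?_
      · have hR : 0 ≤ 4 * D ^ 2 / n + D * ∑ k', ‖empMean v code t k'
          (fun x => Complex.exp ((θ * v t x : ℝ) * Complex.I) - 1) S' ω - labelProb p k' * ℓ k'‖ := by
          positivity
        rw [norm_mul]
        split_ifs with h1 h2
        · have h3 := norm_condChar_sub_le (v := v) (code := code) hM hd hK hD hn0 t θ S' j ω ℓ hℓ
          rw [h1, ← hχ] at h3
          have h4 : ‖condChar v code ((d / n) • K) t (-θ) S' l ω - (starRingEnd ℂ) χ‖ ≤ 2 := by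
            refine (norm_sub_le _ _).trans ?_
            rw [RCLike.norm_conj]
            linarith [hM.norm_condChar_le (v := v) (code := code) t (-θ) S' l ω]
          nlinarith [norm_nonneg (condChar v code ((d / n) • K) t (-θ) S' l ω - (starRingEnd ℂ) χ),
            norm_nonneg (condChar v code ((d / n) • K) t θ S' j ω - χ)]
        · rw [norm_zero, mul_zero]; linarith
        · rw [norm_zero, zero_mul]; linarith
        · rw [norm_zero, zero_mul]; linarith
      · rw [expect_const_mul, expect_add, expect_const, expect_const_mul, expect_sum]
        have : ∑ k', expect p q ((d / n) • K) (fun ω => ‖empMean v code t k'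
          (fun x => Complex.exp ((θ * v t x : ℝ) * Complex.I) - 1) S' ω - labelProb p k' * ℓ k'‖) ≤
          2 * η' := by
          rw [Fin.sum_univ_two]
          linarith [hLL 0 S' hS'c, hLL 1 S' hS'c]
        gcongr
    have := norm_le_norm_add_norm_sub' (expect p q ((d / n) • K) (fun ω => f S j ω * (starRingEnd ℂ) (f S l ω)))
      (expect p q ((d / n) • K) (fun ω => f (insert l S) j ω *
          (starRingEnd ℂ) (f (insert j S) l ω)))
    refine this.trans ((add_le_add hind hrep).trans (le_of_eq ?_))
    ring
  have hmain := hM.expect_norm_mean_le Sᶜ (f S) (C := 2)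
    (δ := (16 * D * C' + 8 * D ^ 2) / n + 4 * D * η') (by norm_num) (hf2 S) (by positivity) hcov
  have hlab := label_mean_le hM hn0 k S
  refine (hM.expect_mono (g := fun ω => ‖(1 / n : ℂ) * ∑ j ∈ Sᶜ, f S j ω‖ +
      ‖(1 / n : ℂ) * ∑ j ∈ Sᶜ, (if ω.1 j = k then (1 : ℂ) else 0) - labelProb p k‖)
      fun ω => ?_).trans ?_
  -- The variables are centred at χ only on the vertices with label k, so the fluctuation of the
  -- proportion of these vertices, multiplied by χ, must be added.
  · have e : empMean v code (t + 1) k (fun x => Complex.exp ((θ * x : ℝ) * Complex.I)) S ω -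
        labelProb p k * χ = (1 / n : ℂ) * ∑ j ∈ Sᶜ, f S j ω +
        ((1 / n : ℂ) * ∑ j ∈ Sᶜ, (if ω.1 j = k then (1 : ℂ) else 0) - labelProb p k) * χ := by
      have : ∀ j, f S j ω = (if ω.1 j = k then
          Complex.exp ((θ * msgAt v code (t + 1) S j ω : ℝ) * Complex.I) else 0) -
          (if ω.1 j = k then (1 : ℂ) else 0) * χ := by
        intro j; simp only [hf]; split_ifs <;> simp
      simp only [this, Finset.sum_sub_distrib, ← Finset.sum_mul]
      rw [empMean]; ring
    rw [e]
    refine (norm_add_le _ _).trans (add_le_add le_rfl ?_)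
    rw [norm_mul]
    exact mul_le_of_le_one_right (norm_nonneg _) hχ1
  · rw [expect_add]
    refine (add_le_add hmain hlab).trans (le_trans ?_ hn.le)
    have : (S.card : ℝ) ≤ c := by exact_mod_cast hS
    have e4 : (2 : ℝ) ^ 2 / n + ((16 * D * C' + 8 * D ^ 2) / n + 4 * D * η') =
      4 / n + (16 * D * C' + 8 * D ^ 2) / n + 4 * D * η' := by ring
    rw [e4]
    gcongr

end LLN

/-! ### Compound Poisson laws -/

section CompoundPoisson

/-- The convolution powers of a measure. -/
noncomputable def iterConv (J : Measure ℝ) : ℕ → Measure ℝ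
  | 0 => Measure.dirac 0
  | n + 1 => J ∗ iterConv J n

instance isFiniteMeasure_ofReal_smul (c : ℝ) (μ : Measure ℝ) [IsFiniteMeasure μ] :
    IsFiniteMeasure (ENNReal.ofReal c • μ) := μ.smul_finite ENNReal.ofReal_ne_top

/-- The law of the sum of the points of a Poisson point process of intensity `J`. -/
noncomputable def compoundPoisson (J : Measure ℝ) : Measure ℝ :=
  Measure.sum fun n => ENNReal.ofReal (Real.exp (-J.real Set.univ) / n.factorial) • iterConv J n

variable (J : Measure ℝ) [IsFiniteMeasure J]

instance iterConv.instIsFiniteMeasure (n : ℕ) : IsFiniteMeasure (iterConv J n) := by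
  induction n with
  | zero => unfold iterConv; infer_instance
  | succ n ih => unfold iterConv; infer_instance

lemma charFun_iterConv (n : ℕ) (θ : ℝ) : charFun (iterConv J n) θ = charFun J θ ^ n := by
  induction n with
  | zero => simp [iterConv, charFun_dirac]
  | succ n ih => rw [iterConv, charFun_conv, ih, pow_succ']

lemma iterConv_real_univ (n : ℕ) : (iterConv J n).real Set.univ = J.real Set.univ ^ n := by
  have h := charFun_iterConv J n 0
  rw [charFun_zero, charFun_zero] at h
  exact_mod_cast h

instance compoundPoisson.instIsProbabilityMeasure : IsProbabilityMeasure (compoundPoisson J) := by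
  constructor
  have hr : ∀ n : ℕ, 0 ≤ Real.exp (-J.real Set.univ) / n.factorial * J.real Set.univ ^ n :=
    fun n => by positivity
  have hs : HasSum (fun n : ℕ => Real.exp (-J.real Set.univ) / n.factorial * J.real Set.univ ^ n)
      1 := by
    have h := (NormedSpace.expSeries_div_hasSum_exp (J.real Set.univ)).mul_left
      (Real.exp (-J.real Set.univ))
    rw [← Real.exp_eq_exp_ℝ, ← Real.exp_add, neg_add_cancel, Real.exp_zero] at h
    refine h.congr_fun ?_ |> fun h => h
    intro n; ring
  rw [compoundPoisson, Measure.sum_apply _ MeasurableSet.univ]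
  have h1 : ∀ n : ℕ, (ENNReal.ofReal (Real.exp (-J.real Set.univ) / n.factorial) •
      iterConv J n) Set.univ =
      ENNReal.ofReal (Real.exp (-J.real Set.univ) / n.factorial * J.real Set.univ ^ n) := by
    intro n
    rw [Measure.smul_apply, smul_eq_mul, ENNReal.ofReal_mul (by positivity),
      ← iterConv_real_univ, ofReal_measureReal]
  simp only [h1]
  rw [← ENNReal.ofReal_tsum_of_nonneg hr hs.summable, hs.tsum_eq, ENNReal.ofReal_one]

/-- The characters of the convolution powers are the powers of that of J, so the Poisson mixture is
an exponential series. -/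
lemma charFun_compoundPoisson (θ : ℝ) :
    charFun (compoundPoisson J) θ =
      Complex.exp (∫ x, (Complex.exp ((θ * x : ℝ) * Complex.I) - 1) ∂J) := by
  have hint : Integrable (fun x : ℝ => Complex.exp (θ * x * Complex.I)) (compoundPoisson J) := by
    refine Integrable.of_bound (C := 1) (by fun_prop) (ae_of_all _ fun x => ?_)
    rw [← Complex.ofReal_mul, Complex.norm_exp_ofReal_mul_I]
  have hJ : Integrable (fun x : ℝ => Complex.exp (θ * x * Complex.I)) J := by
    refine Integrable.of_bound (C := 1) (by fun_prop) (ae_of_all _ fun x => ?_)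
    rw [← Complex.ofReal_mul, Complex.norm_exp_ofReal_mul_I]
  have h1 := hasSum_integral_measure hint
  have h2 : ∀ n : ℕ, ∫ x, Complex.exp (θ * x * Complex.I)
      ∂(ENNReal.ofReal (Real.exp (-J.real Set.univ) / n.factorial) • iterConv J n) =
      Complex.exp (-J.real Set.univ) * (charFun J θ ^ n / n.factorial) := by
    intro n
    rw [integral_smul_measure, ← charFun_apply_real, charFun_iterConv, ENNReal.toReal_ofReal
      (by positivity), Complex.real_smul]
    push_cast
    ring
  simp only [h2] at h1
  have h3 := (NormedSpace.expSeries_div_hasSum_exp (charFun J θ)).mul_left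
    (Complex.exp (-J.real Set.univ))
  have h4 := h1.unique h3
  rw [charFun_apply_real, compoundPoisson, h4, ← Complex.exp_eq_exp_ℂ, ← Complex.exp_add]
  congr 1
  simp only [Complex.ofReal_mul]
  rw [integral_sub hJ (integrable_const _), integral_const, charFun_apply_real]
  simp
  ring

end CompoundPoisson

/-! ### Approximation by trigonometric polynomials -/

/-- The space of trigonometric polynomials on the real line. -/
noncomputable def trigPoly : Submodule ℂ (ℝ → ℂ) :=
  Submodule.span ℂ (Set.range fun θ : ℝ => fun x : ℝ => Complex.exp ((θ * x : ℝ) * Complex.I))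

/-- Multiply g by a cutoff equal to 1 on [-R, R] and to 0 outside [-2R, 2R], extend it with period
4R, and use the density of Fourier polynomials on the circle. Periodicity makes the bound C + η hold
on the whole line. -/
lemma exists_trigPoly_near {g : ℝ → ℂ} (hg : Continuous g) {C : ℝ} (hC : ∀ x, ‖g x‖ ≤ C) {R η : ℝ}
    (hR : 0 < R) (hη : 0 < η) :
    ∃ T ∈ trigPoly, (∀ x, ‖T x‖ ≤ C + η) ∧ ∀ x, |x| ≤ R → ‖g x - T x‖ ≤ η := by
  have hC0 : 0 ≤ C := (norm_nonneg _).trans (hC 0)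
  have : Fact (0 < 4 * R) := ⟨by positivity⟩
  set cut : ℝ → ℝ := fun x => max 0 (min 1 (2 - |x| / R)) with hcut
  have hcut0 : ∀ x, 0 ≤ cut x := fun x => le_max_left _ _
  have hcut1 : ∀ x, cut x ≤ 1 := fun x => max_le zero_le_one (min_le_left _ _)
  have hcutc : Continuous cut := by fun_prop
  set h : ℝ → ℂ := fun x => cut x * g x with hh
  have hhc : Continuous h := by fun_prop
  have hend : h (-(2 * R)) = h (-(2 * R) + 4 * R) := by
    have e1 : cut (-(2 * R)) = 0 := by
      simp only [hcut, abs_neg, abs_of_pos (by positivity : 0 < 2 * R)]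
      rw [mul_div_cancel_right₀ _ hR.ne']; simp
    have e2 : cut (-(2 * R) + 4 * R) = 0 := by
      have : -(2 * R) + 4 * R = 2 * R := by ring
      simp only [hcut, this, abs_of_pos (by positivity : 0 < 2 * R)]
      rw [mul_div_cancel_right₀ _ hR.ne']; simp
    simp [hh, e1, e2]
  let H : C(AddCircle (4 * R), ℂ) := ⟨AddCircle.liftIco (4 * R) (-(2 * R)) h,
    AddCircle.liftIco_continuous hend hhc.continuousOn⟩
  have hHC : ∀ z, ‖H z‖ ≤ C := by
    intro z
    obtain ⟨x, hx, rfl⟩ : ∃ x ∈ Set.Ico (-(2 * R)) (-(2 * R) + 4 * R), (x : AddCircle (4 * R)) = z := by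
      have := (AddCircle.coe_image_Ico_eq (4 * R) (-(2 * R)))
      have hz : z ∈ (Set.univ : Set (AddCircle (4 * R))) := trivial
      rw [← this] at hz
      exact hz
    show ‖AddCircle.liftIco (4 * R) (-(2 * R)) h x‖ ≤ C
    rw [AddCircle.liftIco_coe_apply hx, hh, norm_mul, Complex.norm_real,
      Real.norm_of_nonneg (hcut0 x)]
    nlinarith [hcut1 x, hC x, norm_nonneg (g x), hcut0 x]
  have hmem : H ∈ (Submodule.span ℂ (Set.range (@fourier (4 * R)))).topologicalClosure := by
    rw [span_fourier_closure_eq_top]; trivial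
  obtain ⟨T0, hT0, hdist⟩ := Metric.mem_closure_iff.1 hmem η hη
  have hdist' : ∀ z, ‖H z - T0 z‖ ≤ η := fun z => by
    rw [← dist_eq_norm]
    exact (ContinuousMap.dist_apply_le_dist z).trans hdist.le
  refine ⟨fun x => T0 (x : AddCircle (4 * R)), ?_, fun x => ?_, fun x hx => ?_⟩
  · have : ∀ T0 ∈ Submodule.span ℂ (Set.range (@fourier (4 * R))),
        (fun x : ℝ => T0 (x : AddCircle (4 * R))) ∈ trigPoly := by
      intro T0 hT0
      induction hT0 using Submodule.span_induction with
      | mem x hx =>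
        obtain ⟨m, rfl⟩ := hx
        refine Submodule.subset_span ⟨2 * Real.pi * m / (4 * R), ?_⟩
        funext x
        rw [fourier_coe_apply]
        beta_reduce
        congr 1
        push_cast
        ring
      | zero => exact trigPoly.zero_mem
      | add x y _ _ hx hy => exact trigPoly.add_mem hx hy
      | smul a x _ hx => exact trigPoly.smul_mem a hx
    exact this T0 hT0
  · have h1 := hdist' (x : AddCircle (4 * R))
    have h2 := hHC (x : AddCircle (4 * R))
    have := norm_sub_norm_le (T0 (x : AddCircle (4 * R))) (H x)
    rw [norm_sub_rev] at this
    linarith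
  · have h1 := hdist' (x : AddCircle (4 * R))
    have hx' := abs_le.1 hx
    have e : H (x : AddCircle (4 * R)) = g x := by
      show AddCircle.liftIco (4 * R) (-(2 * R)) h x = g x
      rw [AddCircle.liftIco_coe_apply ⟨by linarith, by linarith⟩]
      have : cut x = 1 := by
        have : |x| / R ≤ 1 := by rw [div_le_one hR]; exact hx
        simp only [hcut]
        rw [min_eq_left (by linarith), max_eq_right zero_le_one]
      simp [hh, this]
    rwa [e] at h1

/-! ### The law of large numbers for bounded continuous functions -/

section LLN

variable {v : ℕ → ℝ → ℝ} {code : Option (Fin 2) → ℝ}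
variable {p q d : ℝ} {K : Matrix (Fin 2) (Fin 2) ℝ}

lemma empMean_add {n : ℕ} (t : ℕ) (k : Fin 2) (g h : ℝ → ℂ) (S : Finset (Fin n)) (ω : Outcome n) :
    empMean v code t k (g + h) S ω = empMean v code t k g S ω + empMean v code t k h S ω := by
  simp only [empMean, ← mul_add, ← Finset.sum_add_distrib]
  congr 1
  refine Finset.sum_congr rfl fun j _ => ?_
  split_ifs <;> simp

lemma empMean_smul {n : ℕ} (t : ℕ) (k : Fin 2) (a : ℂ) (g : ℝ → ℂ) (S : Finset (Fin n))
    (ω : Outcome n) : empMean v code t k (a • g) S ω = a * empMean v code t k g S ω := by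
  have : ∑ j ∈ Sᶜ, (if ω.1 j = k then (a • g) (msgAt v code t S j ω) else 0) =
      a * ∑ j ∈ Sᶜ, if ω.1 j = k then g (msgAt v code t S j ω) else 0 := by
    rw [Finset.mul_sum]
    refine Finset.sum_congr rfl fun j _ => ?_
    split_ifs <;> simp
  rw [empMean, empMean, this]
  ring

lemma LLN.add (hv : ∀ᶠ n : ℕ in atTop, Valid p q ((d / n) • K)) {t : ℕ} {k : Fin 2} {g h : ℝ → ℂ}
    {ℓ ℓ' : ℂ} (hg : LLN p q d K v code t k g ℓ) (hh : LLN p q d K v code t k h ℓ') :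
    LLN p q d K v code t k (g + h) (ℓ + ℓ') := by
  intro c η hη
  filter_upwards [hv, hg c (η / 2) (by positivity), hh c (η / 2) (by positivity)]
    with n hM h1 h2 S hS
  refine (hM.expect_mono (g := fun ω => ‖empMean v code t k g S ω - labelProb p k * ℓ‖ +
    ‖empMean v code t k h S ω - labelProb p k * ℓ'‖) fun ω => ?_).trans ?_
  · rw [empMean_add]
    refine le_trans (le_of_eq ?_) (norm_add_le _ _)
    congr 1; ring
  · rw [expect_add]
    linarith [h1 S hS, h2 S hS]

lemma LLN.smul (hv : ∀ᶠ n : ℕ in atTop, Valid p q ((d / n) • K)) {t : ℕ} {k : Fin 2} {g : ℝ → ℂ}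
    {ℓ : ℂ} (a : ℂ) (hg : LLN p q d K v code t k g ℓ) :
    LLN p q d K v code t k (a • g) (a * ℓ) := by
  intro c η hη
  filter_upwards [hv, hg c (η / (‖a‖ + 1)) (by positivity)] with n hM h1 S hS
  have e : (fun ω : Outcome n => ‖empMean v code t k (a • g) S ω - labelProb p k * (a * ℓ)‖) =
      fun ω => ‖a‖ * ‖empMean v code t k g S ω - labelProb p k * ℓ‖ := by
    funext ω
    rw [empMean_smul, ← norm_mul]
    congr 1; ring
  rw [e, expect_const_mul]
  have h2 := h1 S hS
  rw [le_div_iff₀ (by positivity)] at h2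
  have h3 : 0 ≤ expect p q ((d / n) • K) (fun ω => ‖empMean v code t k g S ω - labelProb p k * ℓ‖) :=
    hM.expect_nonneg fun _ => norm_nonneg _
  nlinarith

lemma lln_trigPoly (hv : ∀ᶠ n : ℕ in atTop, Valid p q ((d / n) • K)) {t : ℕ} {k : Fin 2}
    (ν : Measure ℝ) [IsProbabilityMeasure ν]
    (h : ∀ θ : ℝ, LLN p q d K v code t k (fun x => Complex.exp ((θ * x : ℝ) * Complex.I))
      (charFun ν θ)) {T : ℝ → ℂ} (hT : T ∈ trigPoly) :
    LLN p q d K v code t k T (∫ x, T x ∂ν) ∧ Integrable T ν ∧ Continuous T := by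
  induction hT using Submodule.span_induction with
  | mem x hx =>
    obtain ⟨θ, rfl⟩ := hx
    refine ⟨?_, ?_, by fun_prop⟩
    · have := h θ
      rw [charFun_apply_real] at this
      simpa only [Complex.ofReal_mul] using this
    · refine Integrable.of_bound (C := 1) (by fun_prop) (ae_of_all _ fun x => ?_)
      rw [Complex.norm_exp_ofReal_mul_I]
  | zero =>
    refine ⟨?_, integrable_zero _ _ _, continuous_zero⟩
    have := LLN.smul hv 0 (h 0)
    simpa using this
  | add x y _ _ hx hy =>
    refine ⟨?_, hx.2.1.add hy.2.1, hx.2.2.add hy.2.2⟩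
    have := LLN.add hv hx.1 hy.1
    rwa [← integral_add hx.2.1 hy.2.1] at this
  | smul a x _ hx =>
    refine ⟨?_, hx.2.1.smul a, hx.2.2.const_smul a⟩
    have := LLN.smul hv a hx.1
    rwa [← integral_const_mul] at this

lemma norm_empMean_le {n : ℕ} (t : ℕ) (k : Fin 2) (g : ℝ → ℂ) (S : Finset (Fin n)) (ω : Outcome n)
    (b : ℝ → ℝ) (hb : ∀ x, ‖g x‖ ≤ b x) :
    ‖empMean v code t k g S ω‖ ≤ (1 / n) * ∑ j ∈ Sᶜ, b (msgAt v code t S j ω) := by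
  rw [empMean, norm_mul]
  have : ‖(1 / n : ℂ)‖ = 1 / n := by simp
  rw [this]
  refine mul_le_mul_of_nonneg_left ((norm_sum_le _ _).trans (Finset.sum_le_sum fun j _ => ?_))
    (by positivity)
  split_ifs
  · exact hb _
  · rw [norm_zero]; exact (norm_nonneg _).trans (hb _)

/-- The law of large numbers follows from its validity for the characters, and tightness. -/
lemma lln_of_char (hv : ∀ᶠ n : ℕ in atTop, Valid p q ((d / n) • K)) {t : ℕ} {k : Fin 2}
    (ν : Measure ℝ) [IsProbabilityMeasure ν]
    (h : ∀ θ : ℝ, LLN p q d K v code t k (fun x => Complex.exp ((θ * x : ℝ) * Complex.I))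
      (charFun ν θ))
    (B : ℝ) (hB : ∀ᶠ n : ℕ in atTop, ∀ (S : Finset (Fin n)) j,
      expect p q ((d / n) • K) (fun ω => |msgAt v code t S j ω|) ≤ B)
    {g : ℝ → ℂ} (hg : Continuous g) {C : ℝ} (hC : ∀ x, ‖g x‖ ≤ C) :
    LLN p q d K v code t k g (∫ x, g x ∂ν) := by
  have hC0 : 0 ≤ C := (norm_nonneg _).trans (hC 0)
  -- The N-th polynomial is 1/(N+1)-close to g on [-(N+1), N+1] and bounded by C + 1 everywhere, so
  -- its integrals converge by dominated convergence.
  have hT := fun N : ℕ => exists_trigPoly_near hg hC (R := N + 1) (η := 1 / ((N : ℝ) + 1))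
    (by positivity) (by positivity)
  choose T hTm hTC hTg using hT
  have hN1 : ∀ N : ℕ, 1 / ((N : ℝ) + 1) ≤ 1 := fun N => by
    rw [div_le_one (by positivity)]; linarith [(Nat.cast_nonneg N : (0 : ℝ) ≤ N)]
  have hint : Tendsto (fun N => ∫ x, T N x ∂ν) atTop (𝓝 (∫ x, g x ∂ν)) := by
    refine tendsto_integral_of_dominated_convergence (fun _ => C + 1)
      (fun N => (lln_trigPoly hv ν h (hTm N)).2.1.aestronglyMeasurable) (integrable_const _)
      (fun N => ae_of_all _ fun x => (hTC N x).trans (by linarith [hN1 N]))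
      (ae_of_all _ fun x => ?_)
    rw [tendsto_iff_norm_sub_tendsto_zero]
    refine squeeze_zero' (Eventually.of_forall fun _ => norm_nonneg _) ?_
      tendsto_one_div_add_atTop_nhds_zero_nat
    filter_upwards [eventually_ge_atTop ⌈|x|⌉₊] with N hN
    rw [norm_sub_rev]
    refine hTg N x ?_
    have := Nat.ceil_le.1 hN
    linarith
  intro c η hη
  have hl1 : Tendsto (fun N : ℕ => (1 + (2 * C + 1) * B) * (1 / ((N : ℝ) + 1)) +
      ‖∫ x, T N x ∂ν - ∫ x, g x ∂ν‖) atTop (𝓝 ((1 + (2 * C + 1) * B) * 0 + 0)) :=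
    (tendsto_one_div_add_atTop_nhds_zero_nat.const_mul _).add
      (tendsto_iff_norm_sub_tendsto_zero.1 hint)
  rw [mul_zero, add_zero] at hl1
  obtain ⟨N, hN⟩ := (hl1.eventually_lt_const (half_pos hη)).exists
  filter_upwards [hv, hB, (lln_trigPoly hv ν h (hTm N)).1 c (η / 2) (half_pos hη),
    eventually_gt_atTop 0] with n hM hBn hTn hn0 S hS
  have hn' : (0 : ℝ) < n := by exact_mod_cast hn0
  set δ := 1 / ((N : ℝ) + 1) with hδ
  have hδ0 : 0 < δ := by positivity
  -- Markov's inequality in pointwise form: for |x| > N + 1 the difference is at most 2C + 1, and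
  -- there δ|x| ≥ 1. First moments of the messages then control the error.
  have hb : ∀ x, ‖(g - T N) x‖ ≤ δ + (2 * C + 1) * δ * |x| := by
    intro x
    rw [Pi.sub_apply]
    rcases le_or_gt |x| (N + 1) with hx | hx
    · refine (hTg N x hx).trans ?_
      have : 0 ≤ (2 * C + 1) * δ * |x| := by positivity
      linarith
    · have h1 : 1 ≤ δ * |x| := by
        rw [hδ, one_div, inv_mul_eq_div, le_div_iff₀ (by positivity)]; linarith
      have h2 := norm_sub_le (g x) (T N x)
      have h3 := hTC N x
      have h4 := hC x
      have h5 := hN1 N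
      nlinarith
  refine (hM.expect_mono (g := fun ω => ‖empMean v code t k (T N) S ω -
    labelProb p k * ∫ x, T N x ∂ν‖ + ((1 / n) * ∑ j ∈ Sᶜ,
      (δ + (2 * C + 1) * δ * |msgAt v code t S j ω|) + ‖∫ x, T N x ∂ν - ∫ x, g x ∂ν‖))
    fun ω => ?_).trans ?_
  · have e1 : empMean v code t k g S ω = empMean v code t k (T N) S ω +
        empMean v code t k (g - T N) S ω := by
      rw [← empMean_add]; congr 1; ring
    have e2 : empMean v code t k g S ω - labelProb p k * ∫ x, g x ∂ν =
        (empMean v code t k (T N) S ω - labelProb p k * ∫ x, T N x ∂ν) +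
        (empMean v code t k (g - T N) S ω +
          labelProb p k * (∫ x, T N x ∂ν - ∫ x, g x ∂ν)) := by
      rw [e1]; ring
    rw [e2]
    refine (norm_add_le _ _).trans (add_le_add le_rfl ((norm_add_le _ _).trans
      (add_le_add (norm_empMean_le t k _ S ω _ hb) ?_)))
    rw [norm_mul, Complex.norm_real, Real.norm_of_nonneg (hM.labelProb_pos k).le]
    refine mul_le_of_le_one_left (norm_nonneg _) ?_
    rw [← labelProb_sum p]
    exact Finset.single_le_sum (fun k _ => (hM.labelProb_pos k).le) (Finset.mem_univ k)
  · rw [expect_add, expect_add, expect_const, expect_const_mul, expect_sum]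
    have h1 : ∀ j ∈ Sᶜ, expect p q ((d / n) • K)
        (fun ω => δ + (2 * C + 1) * δ * |msgAt v code t S j ω|) ≤ δ + (2 * C + 1) * δ * B := by
      intro j _
      rw [expect_add, expect_const, expect_const_mul]
      have := hBn S j
      gcongr
    have hB0 : 0 ≤ B := (hM.expect_nonneg fun _ => abs_nonneg _).trans (hBn S ⟨0, hn0⟩)
    have h2 := Finset.sum_le_card_nsmul _ _ _ h1
    have hcard : ((Sᶜ.card : ℕ) : ℝ) ≤ n := by
      exact_mod_cast (Finset.card_le_univ _).trans (by simp)
    rw [nsmul_eq_mul] at h2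
    have h3 : (1 / (n : ℝ)) * ∑ j ∈ Sᶜ, expect p q ((d / n) • K)
        (fun ω => δ + (2 * C + 1) * δ * |msgAt v code t S j ω|) ≤ δ + (2 * C + 1) * δ * B := by
      rw [one_div, inv_mul_eq_div, div_le_iff₀ hn']
      refine h2.trans ?_
      rw [mul_comm]
      gcongr
    have h4 := hTn S hS
    have h5 : (1 + (2 * C + 1) * B) * δ = δ + (2 * C + 1) * δ * B := by ring
    linarith

end LLN

/-! ### The limiting laws of the messages -/

section TreeLaw

/-- The laws of the messages on the limiting tree: `treeLaw … t k` is the law of the message sent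
after `t` rounds by a vertex with label `k`. A message `x` contributes `s * (u t x - m)`, where `m`
is the mean of `u t`. -/
noncomputable def treeLaw (p q d : ℝ) (K : Matrix (Fin 2) (Fin 2) ℝ) (s : ℝ) (u : ℕ → ℝ → ℝ)
    (code : Option (Fin 2) → ℝ) : ℕ → Fin 2 → Measure ℝ
  | 0, k => ENNReal.ofReal q • Measure.dirac (code (some k)) +
      ENNReal.ofReal (1 - q) • Measure.dirac (code none)
  -- In the limit a vertex of label k has independent Poisson numbers of neighbours of each label
  -- k', of mean d K(k, k') P(k').
  | t + 1, k => compoundPoisson (∑ k', ENNReal.ofReal (d * K k k' * labelProb p k') •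
      (treeLaw p q d K s u code t k').map fun x =>
        s * (u t x - ∑ l, labelProb p l * ∫ z, u t z ∂(treeLaw p q d K s u code t l)))

/-- The contribution of a message, centred. -/
noncomputable def jump (p q d : ℝ) (K : Matrix (Fin 2) (Fin 2) ℝ) (s : ℝ) (u : ℕ → ℝ → ℝ)
    (code : Option (Fin 2) → ℝ) (t : ℕ) (x : ℝ) : ℝ :=
  s * (u t x - ∑ l, labelProb p l * ∫ z, u t z ∂(treeLaw p q d K s u code t l))

variable {p q d s : ℝ} {K : Matrix (Fin 2) (Fin 2) ℝ} {u : ℕ → ℝ → ℝ} {code : Option (Fin 2) → ℝ}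

lemma isProbabilityMeasure_treeLaw (hq0 : 0 ≤ q) (hq1 : q ≤ 1) (t : ℕ) (k : Fin 2) :
    IsProbabilityMeasure (treeLaw p q d K s u code t k) := by
  induction t generalizing k with
  | zero =>
    constructor
    simp only [treeLaw, Measure.add_apply, Measure.smul_apply, measure_univ, smul_eq_mul, mul_one]
    rw [← ENNReal.ofReal_add hq0 (by linarith)]; simp
  | succ t ih =>
    unfold treeLaw
    have := ih
    infer_instance

/-- This is the exponential limit in `lln_char_succ`, with the limits of the previous round
expressed as integrals against the laws of that round. -/
lemma charFun_treeLaw_succ (hq0 : 0 ≤ q) (hq1 : q ≤ 1) (hp0 : 0 ≤ p) (hp1 : p ≤ 1) (hd : 0 ≤ d)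
    (hK : ∀ k l, 0 ≤ K k l) (hu : ∀ t, Continuous (u t)) (t : ℕ) (k : Fin 2) (θ : ℝ) :
    charFun (treeLaw p q d K s u code (t + 1) k) θ =
      Complex.exp (∑ k', d * K k k' * (labelProb p k' *
        ∫ x, (Complex.exp ((θ * jump p q d K s u code t x : ℝ) * Complex.I) - 1)
          ∂(treeLaw p q d K s u code t k'))) := by
  have := fun k => isProbabilityMeasure_treeLaw (p := p) (q := q) (d := d) (K := K) (s := s)
    (u := u) (code := code) hq0 hq1 t k
  have hj : Continuous (jump p q d K s u code t) := by
    unfold jump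
    have := hu t
    fun_prop
  have e : treeLaw p q d K s u code (t + 1) k = compoundPoisson
      (∑ k', ENNReal.ofReal (d * K k k' * labelProb p k') •
        (treeLaw p q d K s u code t k').map (jump p q d K s u code t)) := rfl
  rw [e, charFun_compoundPoisson]
  congr 1
  have hint : ∀ ν : Measure ℝ, IsFiniteMeasure ν →
      Integrable (fun x : ℝ => Complex.exp ((θ * x : ℝ) * Complex.I) - 1) ν := by
    intro ν _
    refine Integrable.of_bound (C := 2) (by fun_prop) (ae_of_all _ fun x =>
      norm_exp_mul_I_sub_one_le _)
  rw [integral_finsetSum_measure (fun k' _ => hint _ inferInstance)]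
  refine Finset.sum_congr rfl fun k' _ => ?_
  have hl : 0 ≤ labelProb p k' := by unfold labelProb; split_ifs <;> linarith
  rw [integral_smul_measure, ENNReal.toReal_ofReal (mul_nonneg (mul_nonneg hd (hK _ _)) hl),
    integral_map hj.aemeasurable (by fun_prop), Complex.real_smul]
  push_cast
  ring

/-- The law of large numbers for the messages. -/
theorem lln (hp0 : 0 < p) (hp1 : p < 1) (hq0 : 0 ≤ q) (hq1 : q ≤ 1) (hd : 0 ≤ d)
    (hKs : ∀ k l, K k l = K l k) (hK : ∀ k l, 0 ≤ K k l) (hu : ∀ t, Continuous (u t))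
    {U : ℝ} (hU : ∀ t x, |u t x| ≤ U) (t : ℕ) (k : Fin 2) {g : ℝ → ℂ} (hg : Continuous g)
    {C : ℝ} (hC : ∀ x, ‖g x‖ ≤ C) :
    LLN p q d K (jump p q d K s u code) code t k g
      (∫ x, g x ∂(treeLaw p q d K s u code t k)) := by
  have hv := eventually_valid hp0 hp1 hq0 hq1 hd hKs hK
  have := fun t k => isProbabilityMeasure_treeLaw (p := p) (q := q) (d := d) (K := K) (s := s)
    (u := u) (code := code) hq0 hq1 t k
  induction t generalizing k g C with
  | zero =>
    have := lln_zero (v := jump p q d K s u code) (code := code) hv k g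
    convert this using 1
    rw [treeLaw, integral_add_measure, integral_smul_measure, integral_smul_measure,
      integral_dirac, integral_dirac, ENNReal.toReal_ofReal hq0, ENNReal.toReal_ofReal
      (by linarith)]
    · simp
    · exact (Integrable.of_bound hg.aestronglyMeasurable C (ae_of_all _ hC)).smul_measure
        ENNReal.ofReal_ne_top
    · exact (Integrable.of_bound hg.aestronglyMeasurable C (ae_of_all _ hC)).smul_measure
        ENNReal.ofReal_ne_top
  | succ t ih =>
    have hj : Continuous (jump p q d K s u code t) := by
      unfold jump
      have := hu t
      fun_prop
    have hjb : ∀ x, |jump p q d K s u code t x| ≤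
        |s| * (U + |∑ l, labelProb p l * ∫ z, u t z ∂(treeLaw p q d K s u code t l)|) := by
      intro x
      rw [jump, abs_mul]
      gcongr
      exact (abs_sub _ _).trans (add_le_add (hU t x) le_rfl)
    obtain ⟨D, hD⟩ : ∃ D, ∀ k l, d * K k l ≤ D :=
      ⟨∑ k, ∑ l, d * K k l, fun k l =>
        (Finset.single_le_sum (f := fun l => d * K k l) (fun l _ => mul_nonneg hd (hK k l))
          (Finset.mem_univ l)).trans
        (Finset.single_le_sum (f := fun k => ∑ l, d * K k l) (fun k _ => Finset.sum_nonneg fun l _ =>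
          mul_nonneg hd (hK k l)) (Finset.mem_univ k))⟩
    -- The tightness constant is the degree bound times the supremum of the jump, hence independent
    -- of n and of the removed set.
    refine lln_of_char hv _ (fun θ => ?_) (D * (|s| * (U + |∑ l, labelProb p l *
      ∫ z, u t z ∂(treeLaw p q d K s u code t l)|))) ?_ hg hC
    · rw [charFun_treeLaw_succ hq0 hq1 hp0.le hp1.le hd hK hu]
      refine lln_char_succ hv hd hK t k θ _ (fun k' => ?_) fun k' => ?_
      · have hint : Integrable (fun x => Complex.exp ((θ * jump p q d K s u code t x : ℝ) *
            Complex.I) - 1) (treeLaw p q d K s u code t k') :=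
          Integrable.of_bound (C := 2) (by fun_prop) (ae_of_all _ fun x =>
            norm_exp_mul_I_sub_one_le _)
        have := integral_re hint
        simp only [RCLike.re_eq_complex_re] at this
        rw [← this]
        exact integral_nonpos fun x => norm_exp_mul_I_sub_one_re _
      · exact ih k' (by fun_prop) (C := 2) fun x => norm_exp_mul_I_sub_one_le _
    · filter_upwards [hv, eventually_gt_atTop 0] with n hM hn0 S j
      have hn' : (0 : ℝ) < n := by exact_mod_cast hn0
      refine hM.expect_abs_msgAt_le (B := D / n) (fun k l => ?_) ?_ t hjb S j
      · have : ((d / n) • K) k l = d * K k l / n := by simp [Matrix.smul_apply]; ring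
        rw [this]; gcongr; exact hD k l
      · rw [mul_div_cancel₀ _ hn'.ne']

end TreeLaw

/-! ### Gaussian integrals -/

section Gaussian

/-- The standard variable is reflected (m - √μ z) so that the likelihood ratio of label 1 against
label 0 takes the form exp(√μ z - μ/2) that appears in `G`. -/
lemma integral_gaussianReal_eq {f : ℝ → ℝ} (hf : Continuous f) (m : ℝ) {μ : ℝ} (hμ : 0 ≤ μ) :
    ∫ x, f x ∂(gaussianReal m μ.toNNReal) = ∫ z, f (m - √μ * z) ∂(gaussianReal 0 1) := by
  have h1 : (gaussianReal 0 1).map (fun z => m + (-√μ) * z) = gaussianReal m μ.toNNReal := by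
    have : (fun z : ℝ => m + (-√μ) * z) = (fun x => m + x) ∘ (fun z => (-√μ) * z) := rfl
    rw [this, ← Measure.map_map (by fun_prop) (by fun_prop), gaussianReal_map_const_mul,
      gaussianReal_map_const_add]
    congr 1
    · ring
    · ext
      simp [Real.sq_sqrt hμ, hμ]
  rw [← h1, integral_map (by fun_prop) hf.aestronglyMeasurable]
  refine integral_congr_ae (ae_of_all _ fun z => ?_)
  simp only
  congr 1; ring

/-- The Cameron–Martin formula for the standard Gaussian law. -/
lemma integral_gaussianReal_add {f : ℝ → ℝ} (hf : Continuous f) (h : ℝ) :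
    ∫ z, f (z + h) ∂(gaussianReal 0 1) =
      ∫ z, Real.exp (h * z - h ^ 2 / 2) * f z ∂(gaussianReal 0 1) := by
  have h1 : ∫ z, f (z + h) ∂(gaussianReal 0 1) = ∫ z, f z ∂(gaussianReal h 1) := by
    have : (gaussianReal 0 1).map (fun z => z + h) = gaussianReal h 1 := by
      rw [gaussianReal_map_add_const, zero_add]
    rw [← this, integral_map (by fun_prop) hf.aestronglyMeasurable]
  rw [h1, integral_gaussianReal_eq_integral_smul one_ne_zero,
    integral_gaussianReal_eq_integral_smul one_ne_zero]
  refine integral_congr_ae (ae_of_all _ fun z => ?_)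
  simp only [gaussianPDFReal, smul_eq_mul]
  rw [← mul_assoc, mul_assoc _ (Real.exp _) (Real.exp _), ← Real.exp_add]
  congr 3
  simp
  ring

lemma integrable_exp_gaussianReal (c h : ℝ) :
    Integrable (fun z => Real.exp (h * z + c)) (gaussianReal 0 1) := by
  simp only [Real.exp_add]
  exact (integrable_exp_mul_gaussianReal h).mul_const _

lemma integral_exp_gaussianReal (c h : ℝ) :
    ∫ z, Real.exp (h * z + c) ∂(gaussianReal 0 1) = Real.exp (h ^ 2 / 2 + c) := by
  have h1 := mgf_gaussianReal (p := gaussianReal 0 1) (X := id) (μ := 0) (v := 1) (by simp) h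
  simp only [mgf, id] at h1
  simp only [Real.exp_add, integral_mul_const, h1]
  simp

end Gaussian

/-! ### Posterior means of the limiting Gaussian messages -/

section Posterior

/-- The limiting Gaussian law, of signal-to-noise ratio `μ`, of the messages sent by the vertices
with label `k`. -/
noncomputable def gaussLaw (p μ : ℝ) (k : Fin 2) : Measure ℝ :=
  gaussianReal (if k = 0 then μ * (1 - p) else -(μ * p)) μ.toNNReal

instance (p μ : ℝ) (k : Fin 2) : IsProbabilityMeasure (gaussLaw p μ k) := by
  unfold gaussLaw; infer_instance

/-- The centred posterior probability of the label `0` given a Gaussian message. -/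
noncomputable def postMean (p μ x : ℝ) : ℝ :=
  -- Bayes' formula: μ(1-2p)/2 is the midpoint of the two means, and exp(-(x - midpoint)) is the
  -- density ratio of label 1 to label 0, as the gap between the means equals the variance.
  p / (p + (1 - p) * Real.exp (-(x - μ * (1 - 2 * p) / 2))) - p

variable {p : ℝ}

lemma den_pos (hp0 : 0 < p) (hp1 : p < 1) (y : ℝ) : 0 < p + (1 - p) * Real.exp y := by
  have := Real.exp_pos y
  have : 0 < 1 - p := by linarith
  positivity

lemma continuous_postMean (hp0 : 0 < p) (hp1 : p < 1) (μ : ℝ) : Continuous (postMean p μ) := by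
  unfold postMean
  refine (continuous_const.div (by fun_prop) fun x => ?_).sub continuous_const
  exact (den_pos hp0 hp1 _).ne'

lemma abs_frac_sub_le (hp0 : 0 < p) (hp1 : p < 1) (y : ℝ) :
    |p / (p + (1 - p) * Real.exp y) - p| ≤ 1 := by
  have hd := den_pos hp0 hp1 y
  have h1 : 0 < p / (p + (1 - p) * Real.exp y) := by positivity
  have h2 : p / (p + (1 - p) * Real.exp y) ≤ 1 := by
    rw [div_le_one hd]
    have := Real.exp_pos y
    have : 0 < 1 - p := by linarith
    have : 0 < (1 - p) * Real.exp y := by positivity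
    linarith
  rw [abs_le]; constructor <;> linarith

lemma abs_postMean_le (hp0 : 0 < p) (hp1 : p < 1) (μ x : ℝ) : |postMean p μ x| ≤ 1 :=
  abs_frac_sub_le hp0 hp1 _

/-- The likelihood ratio in terms of a standard Gaussian variable. -/
noncomputable def lr (μ z : ℝ) : ℝ := Real.exp (√μ * z - μ / 2)

lemma lr_pos (μ z : ℝ) : 0 < lr μ z := Real.exp_pos _

lemma continuous_lr (μ : ℝ) : Continuous (lr μ) := by unfold lr; fun_prop

lemma integrable_lr (μ : ℝ) : Integrable (lr μ) (gaussianReal 0 1) := by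
  have := integrable_exp_gaussianReal (-(μ / 2)) (√μ)
  exact this.congr (ae_of_all _ fun z => by simp only [lr, sub_eq_add_neg])

lemma integral_lr {μ : ℝ} (hμ : 0 ≤ μ) : ∫ z, lr μ z ∂(gaussianReal 0 1) = 1 := by
  have := integral_exp_gaussianReal (-(μ / 2)) (√μ)
  rw [Real.sq_sqrt hμ] at this
  simp only [lr, sub_eq_add_neg, this]
  simp

/-- The posterior mean in terms of the likelihood ratio. -/
noncomputable def lrMean (p μ z : ℝ) : ℝ := p / (p + (1 - p) * lr μ z) - p

lemma abs_lrMean_le (hp0 : 0 < p) (hp1 : p < 1) (μ z : ℝ) : |lrMean p μ z| ≤ 1 :=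
  abs_frac_sub_le hp0 hp1 _

lemma continuous_lrMean (hp0 : 0 < p) (hp1 : p < 1) (μ : ℝ) : Continuous (lrMean p μ) := by
  unfold lrMean
  have := continuous_lr μ
  refine (continuous_const.div (by fun_prop) fun x => ?_).sub continuous_const
  exact (den_pos hp0 hp1 _).ne'

lemma integral_gaussLaw_zero (hp0 : 0 < p) (hp1 : p < 1) {μ : ℝ} (hμ : 0 ≤ μ) {f : ℝ → ℝ}
    (hf : Continuous f) : ∫ x, f (postMean p μ x) ∂(gaussLaw p μ 0) =
      ∫ z, f (lrMean p μ z) ∂(gaussianReal 0 1) := by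
  have hc := continuous_postMean hp0 hp1 μ
  rw [gaussLaw, if_pos rfl, integral_gaussianReal_eq (f := fun x => f (postMean p μ x))
    (by fun_prop) _ hμ]
  refine integral_congr_ae (ae_of_all _ fun z => ?_)
  simp only [postMean, lrMean, lr]
  congr 5
  ring_nf

/-- The two Gaussian laws differ by a shift, so Cameron–Martin expresses the law for label 1 through
the variable used for label 0, with density `lr`. -/
lemma integral_gaussLaw_one (hp0 : 0 < p) (hp1 : p < 1) {μ : ℝ} (hμ : 0 ≤ μ) {f : ℝ → ℝ}
    (hf : Continuous f) : ∫ x, f (postMean p μ x) ∂(gaussLaw p μ 1) =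
      ∫ z, lr μ z * f (lrMean p μ z) ∂(gaussianReal 0 1) := by
  have hc := continuous_postMean hp0 hp1 μ
  have hc' := continuous_lrMean hp0 hp1 μ
  rw [gaussLaw, if_neg (by decide), integral_gaussianReal_eq (f := fun x => f (postMean p μ x))
    (by fun_prop) _ hμ]
  have := integral_gaussianReal_add (f := fun z => f (lrMean p μ z)) (by fun_prop) (√μ)
  rw [Real.sq_sqrt hμ] at this
  rw [show (fun z => lr μ z * f (lrMean p μ z)) =
    fun z => Real.exp (√μ * z - μ / 2) * f (lrMean p μ z) from rfl, ← this]
  refine integral_congr_ae (ae_of_all _ fun z => ?_)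
  simp only [postMean, lrMean, lr]
  congr 6
  have := Real.mul_self_sqrt hμ
  linear_combination -this

/-- The moments of the posterior mean under the Gaussian laws. -/
lemma postMean_moments (hp0 : 0 < p) (hp1 : p < 1) {μ : ℝ} (hμ : 0 ≤ μ) (lam : ℝ) :
    lam * ∫ x, postMean p μ x ∂(gaussLaw p μ 0) = p * (1 - p) ^ 2 * G lam p μ ∧
    p * ∫ x, postMean p μ x ∂(gaussLaw p μ 0) + (1 - p) * ∫ x, postMean p μ x ∂(gaussLaw p μ 1) = 0 ∧
    p * ∫ x, postMean p μ x ^ 2 ∂(gaussLaw p μ 0) +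
      (1 - p) * ∫ x, postMean p μ x ^ 2 ∂(gaussLaw p μ 1) =
      p * ∫ x, postMean p μ x ∂(gaussLaw p μ 0) := by
  have hc := continuous_lrMean hp0 hp1 μ
  have hcl := continuous_lr μ
  have hb := abs_lrMean_le hp0 hp1 μ
  have i0 : Integrable (lrMean p μ) (gaussianReal 0 1) :=
    Integrable.of_bound hc.aestronglyMeasurable 1 (ae_of_all _ hb)
  have i2 : Integrable (fun z => lrMean p μ z ^ 2) (gaussianReal 0 1) := by
    refine Integrable.of_bound (by fun_prop) 1 (ae_of_all _ fun z => ?_)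
    rw [Real.norm_eq_abs, abs_of_nonneg (sq_nonneg _), ← sq_abs]
    exact pow_le_one₀ (abs_nonneg _) (hb z)
  have il := integrable_lr μ
  have j1 : Integrable (fun z => lr μ z * lrMean p μ z) (gaussianReal 0 1) := by
    refine il.mono (by fun_prop) (ae_of_all _ fun z => ?_)
    rw [norm_mul]
    exact mul_le_of_le_one_right (norm_nonneg _) (hb z)
  have j2 : Integrable (fun z => lr μ z * lrMean p μ z ^ 2) (gaussianReal 0 1) := by
    refine il.mono (by fun_prop) (ae_of_all _ fun z => ?_)
    rw [norm_mul, norm_pow]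
    exact mul_le_of_le_one_right (norm_nonneg _) (pow_le_one₀ (norm_nonneg _) (hb z))
  have e01 := integral_gaussLaw_zero hp0 hp1 hμ (f := fun x => x) continuous_id
  have e02 := integral_gaussLaw_zero hp0 hp1 hμ (f := fun x => x ^ 2) (by fun_prop)
  have e11 := integral_gaussLaw_one hp0 hp1 hμ (f := fun x => x) continuous_id
  have e12 := integral_gaussLaw_one hp0 hp1 hμ (f := fun x => x ^ 2) (by fun_prop)
  rw [e01, e02, e11, e12]
  -- p + (1-p) lr is the density of the mixture of the two laws relative to label 0. Integrated
  -- once, this identity says that the posterior has mean p; multiplied by `lrMean`, it gives the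
  -- second moment as p times the mean under label 0.
  have hmul : ∀ z, (p + (1 - p) * lr μ z) * lrMean p μ z = p - p * (p + (1 - p) * lr μ z) := by
    intro z
    have := (den_pos hp0 hp1 (√μ * z - μ / 2)).ne'
    rw [lrMean, mul_sub, mul_div_cancel₀]
    · ring
    · exact this
  have hsum1 : p * ∫ z, lrMean p μ z ∂(gaussianReal 0 1) +
      (1 - p) * ∫ z, lr μ z * lrMean p μ z ∂(gaussianReal 0 1) = 0 := by
    rw [← integral_const_mul, ← integral_const_mul, ← integral_add (i0.const_mul _)
      (j1.const_mul _)]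
    have : ∀ z, p * lrMean p μ z + (1 - p) * (lr μ z * lrMean p μ z) =
        (p - p * p) - p * (1 - p) * lr μ z := by
      intro z
      have := hmul z
      linear_combination this
    simp only [this]
    rw [integral_sub (integrable_const _) (il.const_mul _), integral_const_mul, integral_lr hμ]
    simp
    ring
  refine ⟨?_, hsum1, ?_⟩
  · have hne : (1 - p) ≠ 0 := by linarith
    have : ∫ z, lrMean p μ z ∂(gaussianReal 0 1) =
        p * ∫ z, (1 / (p + (1 - p) * Real.exp (√μ * z - μ / 2)) - 1) ∂(gaussianReal 0 1) := by
      rw [← integral_const_mul]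
      refine integral_congr_ae (ae_of_all _ fun z => ?_)
      simp only [lrMean, lr]
      ring
    rw [this, G]
    set J := ∫ z, (1 / (p + (1 - p) * Real.exp (√μ * z - μ / 2)) - 1) ∂(gaussianReal 0 1)
    field_simp
  · rw [← integral_const_mul, ← integral_const_mul, ← integral_add (i2.const_mul _)
      (j2.const_mul _)]
    have : ∀ z, p * lrMean p μ z ^ 2 + (1 - p) * (lr μ z * lrMean p μ z ^ 2) =
        p * lrMean p μ z - p * (p * lrMean p μ z + (1 - p) * (lr μ z * lrMean p μ z)) := by
      intro z
      have := hmul z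
      linear_combination lrMean p μ z * this
    simp only [this]
    have hint : Integrable (fun z => p * lrMean p μ z + (1 - p) * (lr μ z * lrMean p μ z))
        (gaussianReal 0 1) := (i0.const_mul _).add (j1.const_mul _)
    rw [integral_sub (i0.const_mul _) (hint.const_mul _),
      integral_const_mul, integral_const_mul, integral_add (i0.const_mul _) (j1.const_mul _),
      integral_const_mul, integral_const_mul, hsum1]
    ring

/-- Up to a positive factor and λ, `G` is the mean of the centred posterior under label 0, which by
`postMean_moments` is a second moment divided by p. -/
lemma G_nonneg (hp0 : 0 < p) (hp1 : p < 1) {lam : ℝ} (hlam : 0 ≤ lam) {μ : ℝ} (hμ : 0 ≤ μ) :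
    0 ≤ G lam p μ := by
  obtain ⟨h1, -, h3⟩ := postMean_moments hp0 hp1 hμ lam
  have h4 : 0 ≤ p * ∫ x, postMean p μ x ^ 2 ∂(gaussLaw p μ 0) +
      (1 - p) * ∫ x, postMean p μ x ^ 2 ∂(gaussLaw p μ 1) :=
    add_nonneg (mul_nonneg hp0.le (integral_nonneg fun _ => sq_nonneg _))
      (mul_nonneg (by linarith) (integral_nonneg fun _ => sq_nonneg _))
  rw [h3] at h4
  have h5 : 0 ≤ ∫ x, postMean p μ x ∂(gaussLaw p μ 0) := nonneg_of_mul_nonneg_right h4 hp0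
  have h6 : 0 ≤ p * (1 - p) ^ 2 * G lam p μ := by rw [← h1]; positivity
  have h7 : 0 < 1 - p := by linarith
  exact nonneg_of_mul_nonneg_right h6 (by positivity)

end Posterior

/-! ### The limit of large degrees -/

section CLT

/-- Weak convergence of a family of laws as the degree grows. -/
def WeakLim (ν : ℝ → Measure ℝ) (γ : Measure ℝ) : Prop :=
  ∀ f : ℝ → ℝ, Continuous f → (∃ C, ∀ x, |f x| ≤ C) →
    Tendsto (fun d => ∫ x, f x ∂(ν d)) atTop (𝓝 (∫ x, f x ∂γ))

/-- Convergence along the real parameter d can be tested on sequences, where Lévy's continuity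
theorem applies. -/
lemma weakLim_of_charFun {ν : ℝ → Measure ℝ} [∀ d, IsProbabilityMeasure (ν d)] {γ : Measure ℝ}
    [IsProbabilityMeasure γ]
    (h : ∀ θ : ℝ, Tendsto (fun d => charFun (ν d) θ) atTop (𝓝 (charFun γ θ))) : WeakLim ν γ := by
  rintro f hf ⟨C, hC⟩
  refine tendsto_of_seq_tendsto fun x hx => ?_
  have h1 := ProbabilityMeasure.tendsto_of_tendsto_charFun (μ₀ := ⟨γ, inferInstance⟩)
    (μ := fun n => ⟨ν (x n), inferInstance⟩) fun θ => (h θ).comp hx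
  exact (ProbabilityMeasure.tendsto_iff_forall_integral_tendsto.1 h1) (BoundedContinuousFunction.ofNormedAddCommGroup f hf C hC)

lemma norm_exp_mul_I_taylor_le {y : ℝ} (hy : |y| ≤ 1) :
    ‖Complex.exp (y * Complex.I) - 1 - (y * Complex.I - y ^ 2 / 2)‖ ≤ |y| ^ 3 := by
  have hn : ‖(y : ℂ) * Complex.I‖ = |y| := by simp
  have h := Complex.exp_bound (x := y * Complex.I) (by rw [hn]; exact hy) (n := 3) (by norm_num)
  rw [hn] at h
  have e : ∑ m ∈ Finset.range 3, ((y : ℂ) * Complex.I) ^ m / (m.factorial : ℂ) =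
      1 + (y * Complex.I - y ^ 2 / 2) := by
    simp only [Finset.sum_range_succ, Finset.sum_range_zero, mul_pow, Complex.I_sq]
    norm_num [Nat.factorial]
    ring
  rw [e, ← sub_sub] at h
  refine h.trans (mul_le_of_le_one_right (by positivity) (by norm_num [Nat.factorial]))

/-- The interaction between the labels, to the first order. -/
noncomputable def kap (p : ℝ) : Matrix (Fin 2) (Fin 2) ℝ :=
  !![(1 - p) / p, -1; -1, p / (1 - p)]

/-- The balance condition: both communities have the same mean degree, so the degree of a vertex
says nothing about its label. -/
lemma sum_labelProb_mul_kap {p : ℝ} (hp0 : 0 < p) (hp1 : p < 1) (k : Fin 2) :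
    ∑ k', labelProb p k' * kap p k k' = 0 := by
  have : 1 - p ≠ 0 := by linarith
  fin_cases k <;> simp [labelProb, kap] <;> field_simp <;> ring

variable {p lam q : ℝ} {ε : ℝ → ℝ} {K : ℝ → Matrix (Fin 2) (Fin 2) ℝ}

/-- Central limit theorem for the messages: one round of message passing. -/
lemma tendsto_charFun_step (hp0 : 0 < p) (hp1 : p < 1)
    (hε : ∀ᶠ d in atTop, d * ε d ^ 2 = lam) (hε0 : Tendsto ε atTop (𝓝 0))
    (hK : ∀ᶠ d in atTop, ∀ k l, K d k l = 1 + ε d * kap p k l)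
    (ν : ℝ → Fin 2 → Measure ℝ) [∀ d k, IsProbabilityMeasure (ν d k)] (γ : Fin 2 → Measure ℝ)
    [∀ k, IsProbabilityMeasure (γ k)] (hν : ∀ k, WeakLim (fun d => ν d k) (γ k))
    {u : ℝ → ℝ} (hu : Continuous u) (hU : ∀ x, |u x| ≤ 1) (m : ℝ → ℝ)
    (hm : ∀ d, m d = ∑ l, labelProb p l * ∫ z, u z ∂(ν d l)) (k : Fin 2) (θ : ℝ)
    {A B : ℝ}
    (hA : A = lam / (p * (1 - p)) * ∑ l, labelProb p l * kap p k l * ∫ z, u z ∂(γ l))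
    (hB : B = lam / (p * (1 - p)) ^ 2 * ∑ l, labelProb p l * ∫ z, u z ^ 2 ∂(γ l))
    (hm0 : ∑ l, labelProb p l * ∫ z, u z ∂(γ l) = 0) :
    Tendsto (fun d => Complex.exp (∑ l, d * K d k l * (labelProb p l *
      ∫ x, (Complex.exp ((θ * (ε d / (p * (1 - p)) * (u x - m d)) : ℝ) * Complex.I) - 1)
        ∂(ν d l)))) atTop (𝓝 (Complex.exp (θ * A * Complex.I - B * θ ^ 2 / 2))) := by
  refine (Complex.continuous_exp.tendsto _).comp ?_
  have hpp : 0 < p * (1 - p) := mul_pos hp0 (by linarith)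
  set s : ℝ → ℝ := fun d => ε d / (p * (1 - p)) with hs
  have hs0 : Tendsto s atTop (𝓝 0) := by simpa using hε0.div_const (p * (1 - p))
  have hl0 : ∀ l, 0 ≤ labelProb p l := fun l => by unfold labelProb; split_ifs <;> linarith
  have hI : ∀ l, Tendsto (fun d => ∫ z, u z ∂(ν d l)) atTop (𝓝 (∫ z, u z ∂(γ l))) :=
    fun l => hν l u hu ⟨1, hU⟩
  have hQ : ∀ l, Tendsto (fun d => ∫ z, u z ^ 2 ∂(ν d l)) atTop (𝓝 (∫ z, u z ^ 2 ∂(γ l))) :=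
    fun l => hν l (fun z => u z ^ 2) (by fun_prop) ⟨1, fun x => by
      rw [abs_pow]; exact pow_le_one₀ (abs_nonneg _) (hU x)⟩
  have hmlim : Tendsto m atTop (𝓝 0) := by
    have h1 : Tendsto (fun d => ∑ l, labelProb p l * ∫ z, u z ∂(ν d l)) atTop
        (𝓝 (∑ l, labelProb p l * ∫ z, u z ∂(γ l))) :=
      tendsto_finsetSum _ fun l _ => (hI l).const_mul _
    rw [hm0] at h1
    exact h1.congr fun d => (hm d).symm
  have hIb : ∀ d l, |∫ z, u z ∂(ν d l)| ≤ 1 := by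
    intro d l
    have := norm_integral_le_of_norm_le_const (μ := ν d l) (f := u) (C := 1) (ae_of_all _ hU)
    simpa using this
  have hmb : ∀ d, |m d| ≤ 1 := by
    intro d
    rw [hm]
    refine (Finset.abs_sum_le_sum_abs _ _).trans ?_
    rw [← labelProb_sum p]
    refine Finset.sum_le_sum fun l _ => ?_
    rw [abs_mul, abs_of_nonneg (hl0 l)]
    exact mul_le_of_le_one_right (hl0 l) (hIb d l)
  have hui : ∀ d l, Integrable u (ν d l) := fun d l =>
    Integrable.of_bound hu.aestronglyMeasurable 1 (ae_of_all _ hU)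
  have hu2i : ∀ d l, Integrable (fun z => u z ^ 2) (ν d l) := fun d l =>
    Integrable.of_bound (by fun_prop) 1 (ae_of_all _ fun x => by
      rw [norm_pow]; exact pow_le_one₀ (norm_nonneg _) (hU x))
  -- the main terms
  set L : ℝ → ℝ := fun d => ∑ l, d * K d k l * (labelProb p l *
    (s d * (∫ z, u z ∂(ν d l) - m d))) with hL
  set W : ℝ → ℝ := fun d => ∑ l, d * K d k l * (labelProb p l *
    (s d ^ 2 * (∫ z, u z ^ 2 ∂(ν d l) - 2 * m d * ∫ z, u z ∂(ν d l) + m d ^ 2))) with hW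
  have hKlim : ∀ l, Tendsto (fun d => K d k l) atTop (𝓝 1) := by
    intro l
    have : Tendsto (fun d => 1 + ε d * kap p k l) atTop (𝓝 (1 + 0 * kap p k l)) :=
      (hε0.mul_const _).const_add _
    rw [zero_mul, add_zero] at this
    refine this.congr' ?_
    filter_upwards [hK] with d hd using (hd k l).symm
  -- The contribution of order dε cancels because m is the mean of u over both labels. The
  -- interaction `kap` brings a second factor ε, and dε² = λ; its own mean is zero, so m drops out
  -- again.
  have hLlim : Tendsto L atTop (𝓝 A) := by
    have h1 : Tendsto (fun d => lam / (p * (1 - p)) * ∑ l, labelProb p l * kap p k l *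
        ∫ z, u z ∂(ν d l)) atTop (𝓝 A) := by
      rw [hA]
      exact (tendsto_finsetSum _ fun l _ => (hI l).const_mul _).const_mul _
    refine h1.congr' ?_
    filter_upwards [hε, hK] with d hd hKd
    have hz := sum_labelProb_mul_kap hp0 hp1 k
    have h1s := labelProb_sum p
    have hmd := hm d
    simp only [hL, hs, hKd]
    simp only [Fin.sum_univ_two] at hz h1s hmd ⊢
    have h0 : 1 - p ≠ 0 := by linarith
    rw [← hd]
    field_simp
    linear_combination (-ε d ^ 2 * d * m d) * (-hz) + (-d * ε d) * (-hmd) + (d * ε d * m d) * h1s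
  -- Here d s² = λ/(p(1-p))² already, so `K` may be replaced by its limit 1 and m by its limit 0.
  have hWlim : Tendsto W atTop (𝓝 B) := by
    have h1 : Tendsto (fun d => lam / (p * (1 - p)) ^ 2 * ∑ l, labelProb p l * (K d k l *
        (∫ z, u z ^ 2 ∂(ν d l) - 2 * m d * ∫ z, u z ∂(ν d l) + m d ^ 2))) atTop (𝓝 (
        lam / (p * (1 - p)) ^ 2 * ∑ l, labelProb p l * (1 *
        (∫ z, u z ^ 2 ∂(γ l) - 2 * 0 * ∫ z, u z ∂(γ l) + 0 ^ 2)))) :=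
      (tendsto_finsetSum _ fun l _ => ((hKlim l).mul (((hQ l).sub ((hmlim.const_mul 2).mul
        (hI l))).add (hmlim.pow 2))).const_mul _).const_mul _
    have e : lam / (p * (1 - p)) ^ 2 * ∑ l, labelProb p l * (1 *
        (∫ z, u z ^ 2 ∂(γ l) - 2 * 0 * ∫ z, u z ∂(γ l) + 0 ^ 2)) = B := by
      rw [hB]
      congr 1
      refine Finset.sum_congr rfl fun l _ => ?_
      ring
    rw [e] at h1
    refine h1.congr' ?_
    filter_upwards [hε] with d hd
    simp only [hW, hs, ← hd, Finset.mul_sum]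
    refine Finset.sum_congr rfl fun l _ => ?_
    field_simp
  -- the remainder
  have hrem : ∀ᶠ d : ℝ in atTop, ‖(∑ l, (d : ℂ) * K d k l * (labelProb p l *
      ∫ x, (Complex.exp ((θ * (s d * (u x - m d)) : ℝ) * Complex.I) - 1) ∂(ν d l))) -
      (θ * L d * Complex.I - W d * θ ^ 2 / 2)‖ ≤
      (∑ l, |K d k l|) * (8 * |θ| ^ 3 * (|lam| / (p * (1 - p)) ^ 2)) * |s d| := by
    have hsmall : ∀ᶠ d in atTop, |θ| * (|s d| * 2) ≤ 1 := by
      have : Tendsto (fun d => |θ| * (|s d| * 2)) atTop (𝓝 (|θ| * (|(0 : ℝ)| * 2))) :=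
        (hs0.abs.mul_const 2).const_mul _
      rw [abs_zero, zero_mul, mul_zero] at this
      exact (this.eventually_lt_const zero_lt_one).mono fun d hd => hd.le
    filter_upwards [hsmall, hε, eventually_gt_atTop 0] with d hd hεd hd0
    have hy : ∀ x, |θ * (s d * (u x - m d))| ≤ |θ| * (|s d| * 2) := by
      intro x
      rw [abs_mul, abs_mul]
      gcongr
      exact (abs_sub _ _).trans (by linarith [hU x, hmb d])
    have hterm : ∀ l, ‖∫ x, (Complex.exp ((θ * (s d * (u x - m d)) : ℝ) * Complex.I) - 1) ∂(ν d l) -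
        (θ * (s d * (∫ z, u z ∂(ν d l) - m d) : ℝ) * Complex.I -
        (s d ^ 2 * (∫ z, u z ^ 2 ∂(ν d l) - 2 * m d * ∫ z, u z ∂(ν d l) + m d ^ 2) : ℝ)
          * θ ^ 2 / 2)‖ ≤ (|θ| * (|s d| * 2)) ^ 3 := by
      intro l
      have i1 : Integrable (fun x => Complex.exp ((θ * (s d * (u x - m d)) : ℝ) * Complex.I) - 1)
          (ν d l) := Integrable.of_bound (by fun_prop) 2 (ae_of_all _ fun x =>
            norm_exp_mul_I_sub_one_le _)
      have i2 : Integrable (fun x => (θ * (s d * (u x - m d)) : ℝ)) (ν d l) :=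
        (((hui d l).sub (integrable_const _)).const_mul _).const_mul _
      have i3 : Integrable (fun x => ((θ * (s d * (u x - m d))) ^ 2 : ℝ)) (ν d l) := by
        have : (fun x => ((θ * (s d * (u x - m d))) ^ 2 : ℝ)) = fun x =>
            (θ * s d) ^ 2 * (u x ^ 2 - 2 * m d * u x + m d ^ 2) := by funext x; ring
        rw [this]
        exact (((hu2i d l).sub ((hui d l).const_mul _)).add (integrable_const _)).const_mul _
      have e1 : ∫ x, (θ * (s d * (u x - m d))) ∂(ν d l) =
          θ * (s d * (∫ z, u z ∂(ν d l) - m d)) := by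
        rw [integral_const_mul, integral_const_mul, integral_sub (hui d l) (integrable_const _)]
        simp
      have e2 : ∫ x, (θ * (s d * (u x - m d))) ^ 2 ∂(ν d l) =
          θ ^ 2 * (s d ^ 2 * (∫ z, u z ^ 2 ∂(ν d l) - 2 * m d * ∫ z, u z ∂(ν d l) + m d ^ 2)) := by
        have : (fun x => ((θ * (s d * (u x - m d))) ^ 2 : ℝ)) = fun x =>
            (θ ^ 2 * s d ^ 2) * (u x ^ 2 - 2 * m d * u x + m d ^ 2) := by funext x; ring
        have hsub : Integrable (fun z => u z ^ 2 - 2 * m d * u z) (ν d l) :=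
          (hu2i d l).sub ((hui d l).const_mul _)
        rw [this, integral_const_mul, integral_add hsub (integrable_const _), integral_sub (hu2i d l) ((hui d l).const_mul _),
          integral_const_mul]
        simp
        ring
      have e3 : (θ * (s d * (∫ z, u z ∂(ν d l) - m d) : ℝ) * Complex.I -
        (s d ^ 2 * (∫ z, u z ^ 2 ∂(ν d l) - 2 * m d * ∫ z, u z ∂(ν d l) + m d ^ 2) : ℝ)
          * θ ^ 2 / 2 : ℂ) = ∫ x, (((θ * (s d * (u x - m d)) : ℝ) : ℂ) * Complex.I -
            ((θ * (s d * (u x - m d)) : ℝ) : ℂ) ^ 2 / 2) ∂(ν d l) := by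
        have i3' : Integrable (fun x => (((θ * (s d * (u x - m d)) : ℝ) : ℂ)) ^ 2 / 2) (ν d l) := by
          have := (i3.ofReal (𝕜 := ℂ)).div_const 2
          refine this.congr (ae_of_all _ fun x => ?_)
          simp
        have i2' : Integrable (fun x => ((θ * (s d * (u x - m d)) : ℝ) : ℂ) * Complex.I)
            (ν d l) := (i2.ofReal (𝕜 := ℂ)).mul_const _
        rw [integral_sub i2' i3', integral_mul_const, integral_div]
        have e4 : ∫ x, ((θ * (s d * (u x - m d)) : ℝ) : ℂ) ^ 2 ∂(ν d l) =
            ((∫ x, (θ * (s d * (u x - m d))) ^ 2 ∂(ν d l) : ℝ) : ℂ) := by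
          rw [← integral_complex_ofReal]
          simp only [Complex.ofReal_pow]
        have e5 : ∫ x, ((θ * (s d * (u x - m d)) : ℝ) : ℂ) ∂(ν d l) =
            ((∫ x, (θ * (s d * (u x - m d))) ∂(ν d l) : ℝ) : ℂ) := integral_complex_ofReal
        rw [e4, e5, e1, e2]
        push_cast
        ring
      have i4 : Integrable (fun x => (((θ * (s d * (u x - m d)) : ℝ) : ℂ) * Complex.I -
            ((θ * (s d * (u x - m d)) : ℝ) : ℂ) ^ 2 / 2)) (ν d l) := by
        have i3' : Integrable (fun x => (((θ * (s d * (u x - m d)) : ℝ) : ℂ)) ^ 2 / 2) (ν d l) := by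
          have := (i3.ofReal (𝕜 := ℂ)).div_const 2
          refine this.congr (ae_of_all _ fun x => ?_)
          simp
        exact ((i2.ofReal (𝕜 := ℂ)).mul_const _).sub i3'
      rw [e3, ← integral_sub i1 i4]
      have := norm_integral_le_of_norm_le_const (μ := ν d l) (f := fun x =>
        (Complex.exp ((θ * (s d * (u x - m d)) : ℝ) * Complex.I) - 1 -
          (((θ * (s d * (u x - m d)) : ℝ) : ℂ) * Complex.I -
            ((θ * (s d * (u x - m d)) : ℝ) : ℂ) ^ 2 / 2))) (C := (|θ| * (|s d| * 2)) ^ 3)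
        (ae_of_all _ fun x => (norm_exp_mul_I_taylor_le ((hy x).trans hd)).trans
          (pow_le_pow_left₀ (abs_nonneg _) (hy x) 3))
      simpa using this
    have esum : (∑ l, (d : ℂ) * K d k l * (labelProb p l *
      ∫ x, (Complex.exp ((θ * (s d * (u x - m d)) : ℝ) * Complex.I) - 1) ∂(ν d l))) -
      (θ * L d * Complex.I - W d * θ ^ 2 / 2) = ∑ l, (d : ℂ) * K d k l * (labelProb p l *
        (∫ x, (Complex.exp ((θ * (s d * (u x - m d)) : ℝ) * Complex.I) - 1) ∂(ν d l) -
        (θ * (s d * (∫ z, u z ∂(ν d l) - m d) : ℝ) * Complex.I -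
        (s d ^ 2 * (∫ z, u z ^ 2 ∂(ν d l) - 2 * m d * ∫ z, u z ∂(ν d l) + m d ^ 2) : ℝ)
          * θ ^ 2 / 2))) := by
      simp only [hL, hW, Fin.sum_univ_two]
      push_cast
      ring
    rw [esum]
    -- The cubic Taylor remainders sum to order d|s|³, which is a constant times |s| and so
    -- vanishes.
    have hdlam : |lam| / (p * (1 - p)) ^ 2 = d * |s d| ^ 2 := by
      rw [sq_abs, hs, ← hεd, abs_mul, abs_of_pos hd0, abs_of_nonneg (sq_nonneg _)]
      simp only
      rw [div_pow]; ring
    rw [hdlam, Finset.sum_mul, Finset.sum_mul]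
    refine (norm_sum_le _ _).trans (Finset.sum_le_sum fun l _ => ?_)
    rw [norm_mul, norm_mul, norm_mul, Complex.norm_real, Complex.norm_real, Complex.norm_real,
      Real.norm_of_nonneg hd0.le, Real.norm_of_nonneg (hl0 l), Real.norm_eq_abs]
    have hl1 : labelProb p l ≤ 1 := by unfold labelProb; split_ifs <;> linarith
    calc _ ≤ d * |K d k l| * (1 * (|θ| * (|s d| * 2)) ^ 3) := by
          gcongr
          exact hterm l
      _ = _ := by ring
  have hrem0 : Tendsto (fun d => (∑ l, |K d k l|) * (8 * |θ| ^ 3 *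
      (|lam| / (p * (1 - p)) ^ 2)) * |s d|) atTop (𝓝 0) := by
    have := ((tendsto_finsetSum Finset.univ fun l _ => (hKlim l).abs).mul_const
      (8 * |θ| ^ 3 * (|lam| / (p * (1 - p)) ^ 2))).mul hs0.abs
    simpa using this
  have hmain : Tendsto (fun d => (θ * L d * Complex.I - W d * θ ^ 2 / 2 : ℂ)) atTop
      (𝓝 (θ * A * Complex.I - B * θ ^ 2 / 2)) := by
    have h1 := (Complex.continuous_ofReal.tendsto _).comp hLlim
    have h2 := (Complex.continuous_ofReal.tendsto _).comp hWlim
    exact ((h1.const_mul _).mul_const _).sub ((h2.mul_const _).div_const _)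
  have := squeeze_zero_norm' hrem hrem0
  have h3 := this.add hmain
  rw [zero_add] at h3
  refine h3.congr fun d => ?_
  ring

end CLT

/-! ### Density evolution: the signal-to-noise ratio follows `G`. -/

section DensityEvolution

/-- The signal-to-noise ratios of the messages in the limit of large degrees. -/
noncomputable def snr (lam p q : ℝ) : ℕ → ℝ
  -- The value produced by the first round: the initial messages have mean I = q(1-p) under label 0,
  -- and μ solves λI = p(1-p)²μ.
  | 0 => lam * q / (p * (1 - p))
  | t + 1 => G lam p (snr lam p q t)

/-- The functions applied to the messages. -/
noncomputable def nonlin (lam p q : ℝ) : ℕ → ℝ → ℝ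
  -- The truncation only ensures boundedness: the initial messages 0, 1-p and -p all lie in [-1, 1].
  | 0, x => max (-1) (min 1 x)
  | t + 1, x => postMean p (snr lam p q t) x

/-- The initial messages: the centred indicator of the label `0`, when it is revealed. -/
noncomputable def initMsg (p : ℝ) : Option (Fin 2) → ℝ
  | none => 0
  | some k => if k = 0 then 1 - p else -p

variable {p lam q : ℝ}

lemma snr_nonneg (hp0 : 0 < p) (hp1 : p < 1) (hlam : 0 ≤ lam) (hq : 0 ≤ q) (t : ℕ) :
    0 ≤ snr lam p q t := by
  induction t with
  | zero =>
    have : 0 < p * (1 - p) := mul_pos hp0 (by linarith)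
    simp only [snr]; positivity
  | succ t ih => exact G_nonneg hp0 hp1 hlam ih

lemma continuous_nonlin (hp0 : 0 < p) (hp1 : p < 1) (t : ℕ) : Continuous (nonlin lam p q t) := by
  cases t with
  | zero => unfold nonlin; fun_prop
  | succ t => exact continuous_postMean hp0 hp1 _

lemma abs_nonlin_le (hp0 : 0 < p) (hp1 : p < 1) (t : ℕ) (x : ℝ) : |nonlin lam p q t x| ≤ 1 := by
  cases t with
  | zero =>
    simp only [nonlin]
    exact abs_le.2 ⟨le_max_left _ _, max_le (by norm_num) (min_le_left _ _)⟩
  | succ t => exact abs_postMean_le hp0 hp1 _ _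

variable {ε : ℝ → ℝ} {K : ℝ → Matrix (Fin 2) (Fin 2) ℝ}

lemma integral_treeLaw_zero (hq : 0 ≤ q) (hq1 : q ≤ 1) {d s : ℝ} {K : Matrix (Fin 2) (Fin 2) ℝ}
    {u : ℕ → ℝ → ℝ} {code : Option (Fin 2) → ℝ} (k : Fin 2) {f : ℝ → ℝ} (hf : Continuous f) {C : ℝ}
    (hC : ∀ x, |f x| ≤ C) : ∫ x, f x ∂(treeLaw p q d K s u code 0 k) =
      q * f (code (some k)) + (1 - q) * f (code none) := by
  rw [treeLaw, integral_add_measure, integral_smul_measure, integral_smul_measure,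
    integral_dirac, integral_dirac, ENNReal.toReal_ofReal hq, ENNReal.toReal_ofReal
    (by linarith)]
  · simp
  · exact (Integrable.of_bound hf.aestronglyMeasurable C (ae_of_all _ hC)).smul_measure
      ENNReal.ofReal_ne_top
  · exact (Integrable.of_bound hf.aestronglyMeasurable C (ae_of_all _ hC)).smul_measure
      ENNReal.ofReal_ne_top

/-- One round of message passing in the limit of large degrees. -/
lemma weakLim_treeLaw_succ (hp0 : 0 < p) (hp1 : p < 1) (hq : 0 ≤ q) (hq1 : q ≤ 1)
    (hε : ∀ᶠ d in atTop, d * ε d ^ 2 = lam) (hε0 : Tendsto ε atTop (𝓝 0))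
    (hK : ∀ᶠ d in atTop, ∀ k l, K d k l = 1 + ε d * kap p k l)
    {u : ℕ → ℝ → ℝ} (hu : ∀ t, Continuous (u t)) (hU : ∀ t x, |u t x| ≤ 1)
    {code : Option (Fin 2) → ℝ} (t : ℕ) (γ : Fin 2 → Measure ℝ) [∀ k, IsProbabilityMeasure (γ k)]
    (hγ : ∀ k, WeakLim (fun d => treeLaw p q d (K d) (ε d / (p * (1 - p))) u code t k) (γ k))
    {μ I : ℝ} (hμ : 0 ≤ μ) (hI : I = ∫ z, u t z ∂(γ 0))
    (h1 : p * I + (1 - p) * ∫ z, u t z ∂(γ 1) = 0)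
    (h2 : p * ∫ z, u t z ^ 2 ∂(γ 0) + (1 - p) * ∫ z, u t z ^ 2 ∂(γ 1) = p * I)
    (hμI : lam * I = p * (1 - p) ^ 2 * μ) (k : Fin 2) :
    WeakLim (fun d => treeLaw p q d (K d) (ε d / (p * (1 - p))) u code (t + 1) k)
      (gaussLaw p μ k) := by
  have := fun d t k => isProbabilityMeasure_treeLaw (p := p) (q := q) (d := d) (K := K d)
    (s := ε d / (p * (1 - p))) (u := u) (code := code) hq hq1 t k
  have hpne : p ≠ 0 := hp0.ne'
  have hp1ne : 1 - p ≠ 0 := by linarith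
  have hlp : ∀ f : Fin 2 → ℝ, ∑ l, labelProb p l * f l = p * f 0 + (1 - p) * f 1 := by
    intro f; simp [labelProb]
  have hKpos : ∀ᶠ d in atTop, ∀ k l, 0 ≤ K d k l := by
    have : ∀ k l, ∀ᶠ d in atTop, 0 ≤ 1 + ε d * kap p k l := by
      intro k l
      have h : Tendsto (fun d => 1 + ε d * kap p k l) atTop (𝓝 (1 + 0 * kap p k l)) :=
        (hε0.mul_const _).const_add _
      rw [zero_mul, add_zero] at h
      exact (h.eventually_const_lt zero_lt_one).mono fun d hd => hd.le
    have h2 : ∀ᶠ d in atTop, ∀ k l, 0 ≤ 1 + ε d * kap p k l := by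
      rw [eventually_all]; intro k; rw [eventually_all]; exact this k
    filter_upwards [h2, hK] with d hd hKd k l
    rw [hKd]; exact hd k l
  refine weakLim_of_charFun fun θ => ?_
  -- The hypothesis `h1` reduces the drift to λI/(p(1-p)) for label 0 and -p/(1-p) times this for
  -- label 1; `h2` reduces the variance to λpI/(p(1-p))². By `hμI` these are μ(1-p), -μp and μ.
  have hlim := tendsto_charFun_step hp0 hp1 hε hε0 hK
    (fun d k => treeLaw p q d (K d) (ε d / (p * (1 - p))) u code t k) γ hγ (hu t) (hU t)
    (fun d => ∑ l, labelProb p l * ∫ z, u t z ∂(treeLaw p q d (K d) (ε d / (p * (1 - p))) u code t l))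
    (fun _ => rfl) k θ (A := if k = 0 then μ * (1 - p) else -(μ * p)) (B := μ) ?_ ?_ ?_
  · have e : charFun (gaussLaw p μ k) θ = Complex.exp (θ * ((if k = 0 then μ * (1 - p) else
        -(μ * p) : ℝ) : ℂ) * Complex.I - μ * θ ^ 2 / 2) := by
      rw [gaussLaw, charFun_gaussianReal, Real.coe_toNNReal _ hμ]
    rw [e]
    refine hlim.congr' ?_
    filter_upwards [hKpos, eventually_ge_atTop 0] with d hKd hd
    rw [charFun_treeLaw_succ hq hq1 hp0.le hp1.le hd hKd hu]
    rfl
  · have hs : ∑ l, labelProb p l * kap p k l * ∫ z, u t z ∂(γ l) =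
        if k = 0 then I else -(p / (1 - p) * I) := by
      have h1' : ∫ z, u t z ∂(γ 1) = -(p * I) / (1 - p) := by
        field_simp; linarith
      rw [Fin.sum_univ_two, ← hI, h1']
      fin_cases k
      · simp [labelProb, kap]; field_simp; ring
      · simp [labelProb, kap]; field_simp; ring
    rw [hs]
    have hI' : lam / (p * (1 - p)) * I = (1 - p) * μ := by
      field_simp; linarith
    split_ifs
    · linarith
    · have : lam / (p * (1 - p)) * -(p / (1 - p) * I) =
          -(p / (1 - p)) * (lam / (p * (1 - p)) * I) := by ring
      rw [this, hI']
      field_simp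
  · rw [hlp, h2]
    field_simp
    nlinarith
  · rw [hlp, ← hI, h1]

/-- Density evolution: the limiting laws of the messages. -/
theorem weakLim_treeLaw (hp0 : 0 < p) (hp1 : p < 1) (hq : 0 ≤ q) (hq1 : q ≤ 1) (hlam : 0 ≤ lam)
    (hε : ∀ᶠ d in atTop, d * ε d ^ 2 = lam) (hε0 : Tendsto ε atTop (𝓝 0))
    (hK : ∀ᶠ d in atTop, ∀ k l, K d k l = 1 + ε d * kap p k l) (t : ℕ) (k : Fin 2) :
    WeakLim (fun d => treeLaw p q d (K d) (ε d / (p * (1 - p))) (nonlin lam p q) (initMsg p)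
      (t + 1) k) (gaussLaw p (snr lam p q t) k) := by
  have hpne : p ≠ 0 := hp0.ne'
  have hp1ne : 1 - p ≠ 0 := by linarith
  have hcont := continuous_nonlin (lam := lam) (q := q) hp0 hp1
  have hbd := abs_nonlin_le (lam := lam) (q := q) hp0 hp1
  induction t generalizing k with
  | zero =>
    -- The laws before the first round depend neither on d nor on `K` nor on s, so these parameters
    -- are set to 0 and the weak limit is that of a constant family.
    have := fun k => isProbabilityMeasure_treeLaw (p := p) (q := q) (d := 0) (K := 0)
      (s := 0) (u := nonlin lam p q) (code := initMsg p) hq hq1 0 k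
    have hi := fun k => integral_treeLaw_zero (p := p) (d := 0) (K := 0) (s := 0)
      (u := nonlin lam p q) (code := initMsg p) hq hq1 k (hcont 0) (hbd 0)
    have hi2 := fun k => integral_treeLaw_zero (p := p) (d := 0) (K := 0) (s := 0)
      (u := nonlin lam p q) (code := initMsg p) hq hq1 k (f := fun x => nonlin lam p q 0 x ^ 2)
      ((hcont 0).pow 2) (C := 1) (fun x => by
        rw [abs_pow]; exact pow_le_one₀ (abs_nonneg _) (hbd 0 x))
    have c0 : nonlin lam p q 0 (initMsg p (some 0)) = 1 - p := by
      simp only [nonlin, initMsg, if_true]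
      rw [min_eq_right (by linarith), max_eq_right (by linarith)]
    have c1 : nonlin lam p q 0 (initMsg p (some 1)) = -p := by
      simp only [nonlin, initMsg]
      rw [if_neg (by decide), min_eq_right (by linarith), max_eq_right (by linarith)]
    have cn : nonlin lam p q 0 (initMsg p none) = 0 := by
      simp [nonlin, initMsg]
    refine weakLim_treeLaw_succ hp0 hp1 hq hq1 hε hε0 hK hcont hbd 0
      (fun k => treeLaw p q 0 0 0 (nonlin lam p q) (initMsg p) 0 k) (fun k f _ _ => ?_)
      (snr_nonneg hp0 hp1 hlam hq 0) rfl ?_ ?_ ?_ k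
    · exact tendsto_const_nhds
    · rw [hi, hi, c0, c1, cn]; ring
    · rw [hi, hi2, hi2, c0, c1, cn]; ring
    · rw [hi, c0, cn, snr]; field_simp; ring
  | succ t ih =>
    obtain ⟨h1, h2, h3⟩ := postMean_moments hp0 hp1 (snr_nonneg (lam := lam) hp0 hp1 hlam hq t) lam
    exact weakLim_treeLaw_succ hp0 hp1 hq hq1 hε hε0 hK hcont hbd (t + 1)
      (fun k => gaussLaw p (snr lam p q t) k) ih (snr_nonneg hp0 hp1 hlam hq (t + 1)) rfl h2 h3 h1 k

end DensityEvolution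

/-! ### The scalar recursion -/

section Scalar

variable {p lam : ℝ}

/-- The integrand of `G`, as a function of the likelihood ratio. -/
noncomputable def gFun (p y : ℝ) : ℝ := 1 / (p + (1 - p) * y) - 1

lemma G_eq (lam p μ : ℝ) :
    G lam p μ = lam / (1 - p) ^ 2 * ∫ z, gFun p (lr μ z) ∂(gaussianReal 0 1) := rfl

lemma gFun_bounds (hp0 : 0 < p) (hp1 : p < 1) {y : ℝ} (hy : 0 < y) :
    -1 ≤ gFun p y ∧ gFun p y ≤ 1 / p - 1 := by
  have h1 : 0 < (1 - p) * y := mul_pos (by linarith) hy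
  constructor
  · have : 0 < 1 / (p + (1 - p) * y) := by positivity
    unfold gFun; linarith
  · unfold gFun
    have : 1 / (p + (1 - p) * y) ≤ 1 / p := by gcongr; linarith
    linarith

lemma abs_gFun_le (hp0 : 0 < p) (hp1 : p < 1) {y : ℝ} (hy : 0 < y) : |gFun p y| ≤ 1 / p + 1 := by
  obtain ⟨h1, h2⟩ := gFun_bounds hp0 hp1 hy
  have : 0 < 1 / p := by positivity
  rw [abs_le]; constructor <;> linarith

lemma continuous_gFun_lr (hp0 : 0 < p) (hp1 : p < 1) {X : Type*} [TopologicalSpace X] {f : X → ℝ}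
    (hf : Continuous f) : Continuous fun x => gFun p (Real.exp (f x)) := by
  unfold gFun
  refine (continuous_const.div (by fun_prop) fun x => ?_).sub continuous_const
  exact (den_pos hp0 hp1 _).ne'

lemma continuous_G (hp0 : 0 < p) (hp1 : p < 1) (lam : ℝ) : Continuous (G lam p) := by
  have : Continuous fun μ => ∫ z, gFun p (lr μ z) ∂(gaussianReal 0 1) := by
    refine continuous_of_dominated (bound := fun _ => 1 / p + 1) (fun μ => ?_) (fun μ => ?_)
      (integrable_const _) (ae_of_all _ fun z => ?_)
    · exact (continuous_gFun_lr hp0 hp1 (by fun_prop)).aestronglyMeasurable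
    · exact ae_of_all _ fun z => abs_gFun_le hp0 hp1 (lr_pos μ z)
    · exact continuous_gFun_lr hp0 hp1 (by fun_prop)
  exact continuous_const.mul this

lemma integrable_gFun_lr (hp0 : 0 < p) (hp1 : p < 1) (μ : ℝ) :
    Integrable (fun z => gFun p (lr μ z)) (gaussianReal 0 1) :=
  Integrable.of_bound (continuous_gFun_lr hp0 hp1 (by fun_prop)).aestronglyMeasurable (1 / p + 1)
    (ae_of_all _ fun z => abs_gFun_le hp0 hp1 (lr_pos μ z))

lemma G_le (hp0 : 0 < p) (hp1 : p < 1) (hlam : 0 ≤ lam) (μ : ℝ) :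
    G lam p μ ≤ lam / (1 - p) ^ 2 * (1 / p - 1) := by
  rw [G_eq]
  refine mul_le_mul_of_nonneg_left ?_ (by positivity)
  have := integral_mono (integrable_gFun_lr hp0 hp1 μ) (integrable_const (1 / p - 1))
    fun z => (gFun_bounds hp0 hp1 (lr_pos μ z)).2
  simpa using this

lemma G_zero (lam p : ℝ) : G lam p 0 = 0 := by
  simp [G]

lemma G_smul (c lam p μ : ℝ) : G (c * lam) p μ = c * G lam p μ := by
  unfold G; ring

/-- Convexity of `gFun` in tangent-line form; the gap is a square over a positive quantity. -/
lemma gFun_tangent (hp0 : 0 < p) (hp1 : p < 1) {x y : ℝ} (hx : 0 < x) (hy : 0 < y) :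
    gFun p x - (1 - p) / (p + (1 - p) * x) ^ 2 * (y - x) ≤ gFun p y := by
  have h0 : 0 < 1 - p := by linarith
  have h1 : 0 < p + (1 - p) * x := by positivity
  have h2 : 0 < p + (1 - p) * y := by positivity
  unfold gFun
  have : 1 / (p + (1 - p) * y) - 1 - (1 / (p + (1 - p) * x) - 1 -
      (1 - p) / (p + (1 - p) * x) ^ 2 * (y - x)) =
      ((1 - p) * (y - x)) ^ 2 / ((p + (1 - p) * y) * (p + (1 - p) * x) ^ 2) := by
    field_simp; ring
  have h3 : 0 ≤ ((1 - p) * (y - x)) ^ 2 / ((p + (1 - p) * y) * (p + (1 - p) * x) ^ 2) := by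
    positivity
  linarith

lemma integral_gFun_lr_eq (hp0 : 0 < p) (hp1 : p < 1) {μ : ℝ} (hμ : 0 ≤ μ) :
    ∫ z, gFun p (lr μ z) ∂(gaussianReal 0 1) =
      ∫ x, gFun p (Real.exp (-x - μ / 2)) ∂(gaussianReal 0 μ.toNNReal) := by
  rw [integral_gaussianReal_eq (continuous_gFun_lr hp0 hp1 (by fun_prop)) _ hμ]
  refine integral_congr_ae (ae_of_all _ fun z => ?_)
  simp only [lr]
  congr 3; ring

/-- The likelihood ratio at μ' is the one at μ times an independent lognormal factor of mean 1,
coming from the extra Gaussian of variance μ' - μ. Conditional Jensen for the convex `gFun`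
concludes. -/
lemma G_mono (hp0 : 0 < p) (hp1 : p < 1) (hlam : 0 ≤ lam) {μ μ' : ℝ} (hμ : 0 ≤ μ) (hμμ' : μ ≤ μ') :
    G lam p μ ≤ G lam p μ' := by
  rw [G_eq, G_eq]
  refine mul_le_mul_of_nonneg_left ?_ (by positivity)
  have hδ : 0 ≤ μ' - μ := by linarith
  rw [integral_gFun_lr_eq hp0 hp1 hμ, integral_gFun_lr_eq hp0 hp1 (hμ.trans hμμ')]
  have hc : Continuous fun x => gFun p (Real.exp (-x - μ' / 2)) :=
    continuous_gFun_lr hp0 hp1 (by fun_prop)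
  have hconv : gaussianReal 0 μ.toNNReal ∗ gaussianReal 0 (μ' - μ).toNNReal =
      gaussianReal 0 μ'.toNNReal := by
    rw [gaussianReal_conv_gaussianReal, ← Real.toNNReal_add hμ hδ]
    congr 2 <;> ring
  have hb : ∀ x : ℝ, ‖gFun p (Real.exp x)‖ ≤ 1 / p + 1 :=
    fun x => abs_gFun_le hp0 hp1 (Real.exp_pos _)
  rw [← hconv, integral_conv (Integrable.of_bound hc.aestronglyMeasurable (1 / p + 1)
    (ae_of_all _ fun x => hb _))]
  have hinner : Continuous fun x => ∫ y, gFun p (Real.exp (-(x + y) - μ' / 2))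
      ∂(gaussianReal 0 (μ' - μ).toNNReal) := by
    refine continuous_of_dominated (bound := fun _ => 1 / p + 1) (fun x => ?_) (fun x => ?_)
      (integrable_const _) (ae_of_all _ fun y => ?_)
    · exact (continuous_gFun_lr hp0 hp1 (by fun_prop)).aestronglyMeasurable
    · exact ae_of_all _ fun y => hb _
    · exact continuous_gFun_lr hp0 hp1 (by fun_prop)
  have hinnerb : ∀ x, ‖∫ y, gFun p (Real.exp (-(x + y) - μ' / 2))
      ∂(gaussianReal 0 (μ' - μ).toNNReal)‖ ≤ 1 / p + 1 := by
    intro x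
    have := norm_integral_le_of_norm_le_const (μ := gaussianReal 0 (μ' - μ).toNNReal)
      (f := fun y => gFun p (Real.exp (-(x + y) - μ' / 2))) (C := 1 / p + 1)
      (ae_of_all _ fun y => hb _)
    simpa using this
  refine integral_mono (Integrable.of_bound (continuous_gFun_lr hp0 hp1
    (by fun_prop)).aestronglyMeasurable (1 / p + 1) (ae_of_all _ fun x => hb _))
    (Integrable.of_bound hinner.aestronglyMeasurable (1 / p + 1) (ae_of_all _ hinnerb)) fun x => ?_
  -- Jensen's inequality for the second factor of the likelihood ratio
  set L := Real.exp (-x - μ / 2) with hL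
  have hL0 : 0 < L := Real.exp_pos _
  have hLy : ∀ y, Real.exp (-(x + y) - μ' / 2) = L * Real.exp (-y - (μ' - μ) / 2) := by
    intro y; rw [hL, ← Real.exp_add]; congr 1; ring
  set γ := gaussianReal 0 (μ' - μ).toNNReal with hγ
  have hi : Integrable (fun y => Real.exp (-y - (μ' - μ) / 2)) γ := by
    have : (fun y : ℝ => Real.exp (-y - (μ' - μ) / 2)) =
        fun y => Real.exp ((-1) * y) * Real.exp (-((μ' - μ) / 2)) := by
      funext y; rw [← Real.exp_add]; congr 1; ring
    rw [this]
    exact (integrable_exp_mul_gaussianReal _).mul_const _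
  have hi1 : ∫ y, Real.exp (-y - (μ' - μ) / 2) ∂γ = 1 := by
    rw [hγ, integral_gaussianReal_eq (by fun_prop) _ hδ]
    have := integral_lr hδ
    rw [← this]
    refine integral_congr_ae (ae_of_all _ fun z => ?_)
    simp only [lr]; congr 1; ring
  set c := (1 - p) / (p + (1 - p) * L) ^ 2 with hc'
  have hi2 : Integrable (fun y => c * (L * Real.exp (-y - (μ' - μ) / 2) - L)) γ :=
    ((hi.const_mul _).sub (integrable_const _)).const_mul _
  have hle : ∫ y, (gFun p L - c * (L * Real.exp (-y - (μ' - μ) / 2) - L)) ∂γ ≤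
      ∫ y, gFun p (Real.exp (-(x + y) - μ' / 2)) ∂γ := by
    refine integral_mono ((integrable_const _).sub hi2) (Integrable.of_bound
      (continuous_gFun_lr hp0 hp1 (by fun_prop)).aestronglyMeasurable (1 / p + 1)
      (ae_of_all _ fun x => hb _)) fun y => ?_
    simp only [hLy]
    exact gFun_tangent hp0 hp1 hL0 (by positivity)
  refine le_trans (le_of_eq ?_) hle
  rw [integral_sub (integrable_const _) hi2, integral_const_mul,
    integral_sub (hi.const_mul _) (integrable_const _), integral_const_mul, hi1]
  simp

/-- Below the Kesten–Stigum threshold, `G` is below the diagonal near `0`. -/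
lemma eventually_G_lt (hp0 : 0 < p) (hp1 : p < 1) (hlam : 0 ≤ lam) (hlam1 : lam < 1) :
    ∀ᶠ μ in 𝓝[>] (0 : ℝ), G lam p μ < μ := by
  have h0 : 0 < 1 - p := by linarith
  -- With w = (1-p)(y-1), `gFun` equals -w + w² - w³ + w⁴/(1+w), and 1 + w ≥ p bounds the last term
  -- by w⁴/p. `H` is the resulting bound, computed from the central moments of the lognormal
  -- likelihood ratio; its derivative at 0 is λ since the third and fourth moments are o(μ).
  set C := (1 - p) ^ 2 / p with hC
  set H : ℝ → ℝ := fun μ => lam * ((Real.exp μ - 1) - (1 - p) * (Real.exp (3 * μ) -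
    3 * Real.exp μ + 2) + C * (Real.exp (6 * μ) - 4 * Real.exp (3 * μ) + 6 * Real.exp μ - 3)) with hH
  have hGH : ∀ μ, 0 ≤ μ → G lam p μ ≤ H μ := by
    intro μ hμ
    have hmom : ∀ k : ℕ, Integrable (fun z => lr μ z ^ k) (gaussianReal 0 1) ∧
        ∫ z, lr μ z ^ k ∂(gaussianReal 0 1) = Real.exp (μ * (k * (k - 1) / 2)) := by
      intro k
      have e : (fun z => lr μ z ^ k) = fun z => Real.exp ((k * √μ) * z + -(k * μ / 2)) := by
        funext z
        rw [lr, ← Real.exp_nat_mul]; congr 1; ring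
      rw [e]
      refine ⟨integrable_exp_gaussianReal _ _, ?_⟩
      rw [integral_exp_gaussianReal, mul_pow, Real.sq_sqrt hμ]
      congr 1; ring
    obtain ⟨j1, m1⟩ := hmom 1
    obtain ⟨j2, m2⟩ := hmom 2
    obtain ⟨j3, m3⟩ := hmom 3
    obtain ⟨j4, m4⟩ := hmom 4
    set a0 : ℝ := (1 - p) + (1 - p) ^ 2 * (1 + (1 - p) + C) with ha0
    set a1 : ℝ := -(1 - p) - (1 - p) ^ 2 * (2 + 3 * (1 - p) + 4 * C) with ha1
    set a2 : ℝ := (1 - p) ^ 2 * (1 + 3 * (1 - p) + 6 * C) with ha2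
    set a3 : ℝ := - ((1 - p) ^ 2 * ((1 - p) + 4 * C)) with ha3
    set a4 : ℝ := (1 - p) ^ 2 * C with ha4
    have hpt : ∀ z, gFun p (lr μ z) ≤ a0 + (a1 * lr μ z ^ 1 + (a2 * lr μ z ^ 2 +
        (a3 * lr μ z ^ 3 + a4 * lr μ z ^ 4))) := by
      intro z
      have hl := lr_pos μ z
      set y := lr μ z
      have hD : 0 < p + (1 - p) * y := by positivity
      have e : a0 + (a1 * y ^ 1 + (a2 * y ^ 2 + (a3 * y ^ 3 + a4 * y ^ 4))) - gFun p y =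
          ((1 - p) ^ 2 * (y - 1) ^ 2) ^ 2 * ((1 - p) * y / (p * (p + (1 - p) * y))) := by
        simp only [ha0, ha1, ha2, ha3, ha4, hC, gFun]
        field_simp
        ring
      have : 0 ≤ ((1 - p) ^ 2 * (y - 1) ^ 2) ^ 2 * ((1 - p) * y / (p * (p + (1 - p) * y))) := by
        positivity
      linarith
    have i34 := (j3.const_mul a3).add (j4.const_mul a4)
    have i34' : Integrable (fun z => a3 * lr μ z ^ 3 + a4 * lr μ z ^ 4) (gaussianReal 0 1) := i34
    have i234 : Integrable (fun z => a2 * lr μ z ^ 2 + (a3 * lr μ z ^ 3 + a4 * lr μ z ^ 4))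
      (gaussianReal 0 1) := (j2.const_mul a2).add i34'
    have i1234 : Integrable (fun z => a1 * lr μ z ^ 1 + (a2 * lr μ z ^ 2 +
        (a3 * lr μ z ^ 3 + a4 * lr μ z ^ 4))) (gaussianReal 0 1) := (j1.const_mul a1).add i234
    have hint := integral_mono (integrable_gFun_lr hp0 hp1 μ)
      ((integrable_const a0).add i1234) hpt
    have e : ∫ z, (a0 + (a1 * lr μ z ^ 1 + (a2 * lr μ z ^ 2 +
        (a3 * lr μ z ^ 3 + a4 * lr μ z ^ 4)))) ∂(gaussianReal 0 1) =
        a0 + (a1 * 1 + (a2 * Real.exp μ + (a3 * Real.exp (3 * μ) + a4 * Real.exp (6 * μ)))) := by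
      rw [integral_add (integrable_const _) i1234, integral_add (j1.const_mul a1) i234,
        integral_add (j2.const_mul a2) i34', integral_add (j3.const_mul a3) (j4.const_mul a4),
        integral_const_mul, integral_const_mul, integral_const_mul, integral_const_mul,
        m1, m2, m3, m4]
      have e3 : μ * (((3 : ℕ) : ℝ) * (((3 : ℕ) : ℝ) - 1) / 2) = 3 * μ := by push_cast; ring
      have e4 : μ * (((4 : ℕ) : ℝ) * (((4 : ℕ) : ℝ) - 1) / 2) = 6 * μ := by push_cast; ring
      have e2 : μ * (((2 : ℕ) : ℝ) * (((2 : ℕ) : ℝ) - 1) / 2) = μ := by push_cast; ring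
      have e1 : μ * (((1 : ℕ) : ℝ) * (((1 : ℕ) : ℝ) - 1) / 2) = 0 := by push_cast; ring
      rw [e1, e2, e3, e4]
      simp
    have hint' : ∫ z, gFun p (lr μ z) ∂(gaussianReal 0 1) ≤
        a0 + (a1 * 1 + (a2 * Real.exp μ + (a3 * Real.exp (3 * μ) + a4 * Real.exp (6 * μ)))) := by
      rw [← e]; exact hint
    rw [G_eq]
    refine (mul_le_mul_of_nonneg_left hint' (by positivity)).trans (le_of_eq ?_)
    simp only [hH, ha0, ha1, ha2, ha3, ha4]
    field_simp
    ring
  have hder : HasDerivAt (fun μ => H μ - μ) (lam - 1) 0 := by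
    have h1 : HasDerivAt (fun μ : ℝ => Real.exp μ) 1 0 := by
      simpa using Real.hasDerivAt_exp 0
    have h3 : HasDerivAt (fun μ : ℝ => Real.exp (3 * μ)) 3 0 := by
      simpa using ((hasDerivAt_id (0 : ℝ)).const_mul 3).exp
    have h6 : HasDerivAt (fun μ : ℝ => Real.exp (6 * μ)) 6 0 := by
      simpa using ((hasDerivAt_id (0 : ℝ)).const_mul 6).exp
    have := (((h1.sub_const 1).sub ((((h3.sub (h1.const_mul 3)).add_const 2)).const_mul (1 - p))).add
      ((((h6.sub (h3.const_mul 4)).add (h1.const_mul 6)).sub_const 3).const_mul C)).const_mul lam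
      |>.sub (hasDerivAt_id (0 : ℝ))
    refine (this.congr_deriv ?_).congr_of_eventuallyEq (Eventually.of_forall fun μ => ?_)
    · ring
    · simp only [hH, Pi.sub_apply, Pi.add_apply, id]
  have hH0 : H 0 = 0 := by
    simp only [hH, mul_zero, Real.exp_zero]; ring
  have hslope := hder.tendsto_slope
  have hneg := hslope.eventually_lt_const (show lam - 1 < 0 by linarith)
  have hle : 𝓝[>] (0 : ℝ) ≤ 𝓝[≠] 0 := nhdsWithin_mono _ fun x hx => ne_of_gt hx
  filter_upwards [hle hneg, self_mem_nhdsWithin] with μ hμ hμ0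
  have hμ0 : 0 < μ := hμ0
  have hμ : slope (fun μ => H μ - μ) 0 μ < 0 := hμ
  rw [slope_def_field, hH0, sub_zero, sub_zero, sub_zero, div_lt_iff₀ hμ0, zero_mul] at hμ
  linarith [hGH μ hμ0.le]

lemma neg_of_neg_of_ne_zero {f : ℝ → ℝ} (hf : Continuous f) {s : Set ℝ} (hs : s.OrdConnected)
    (hne : ∀ x ∈ s, f x ≠ 0) {x y : ℝ} (hx : x ∈ s) (hy : y ∈ s) (hfx : f x < 0) : f y < 0 := by
  by_contra hcon
  push Not at hcon
  obtain ⟨z, hz, hz0⟩ := intermediate_value_uIcc (a := x) (b := y) hf.continuousOn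
    (Set.mem_uIcc.2 (Or.inl ⟨hfx.le, hcon⟩) : (0 : ℝ) ∈ _)
  exact hne z (hs.uIcc_subset hx hy hz) hz0

lemma spinodal_nonneg (p : ℝ) : 0 ≤ spinodal p := Real.sSup_nonneg fun _ h => h.1

/-- If `λ` is above the spinodal curve, then `G` is above the diagonal between its two nonzero
fixed points. -/
lemma lt_G_of_mem_Ioo (hp0 : 0 < p) (hp1 : p < 1) (hlam : spinodal p < lam) (hlam1 : lam < 1)
    {α β : ℝ} (hβ : 0 < β) (hβα : β < α)
    (hfix : ∀ μ : ℝ, 0 ≤ μ → (G lam p μ = μ ↔ μ = 0 ∨ μ = β ∨ μ = α)) {μ : ℝ} (h1 : β < μ)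
    (h2 : μ < α) : μ < G lam p μ := by
  have hlam0 : 0 < lam := (spinodal_nonneg p).trans_lt hlam
  set f : ℝ → ℝ := fun μ => G lam p μ - μ with hf
  have hfc : Continuous f := (continuous_G hp0 hp1 lam).sub continuous_id
  have hne : ∀ x, 0 < x → x ≠ β → x ≠ α → f x ≠ 0 := by
    intro x hx hxβ hxα h
    rcases (hfix x hx.le).1 (sub_eq_zero.1 h) with h | h | h
    · exact hx.ne' h
    · exact hxβ h
    · exact hxα h
  -- If `G` fails to exceed the diagonal at one point of (β, α), then by continuity and the absence
  -- of other fixed points it stays below on that whole interval. It is also below near 0 (as λ < 1)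
  -- and at infinity (as `G` is bounded), hence `G` ≤ diagonal on [0, ∞).
  by_contra hcon
  push Not at hcon
  have hμneg : f μ < 0 := lt_of_le_of_ne (sub_nonpos.2 hcon) (hne μ (hβ.trans h1) h1.ne' h2.ne)
  obtain ⟨B, hB⟩ : ∃ B, ∀ x, G lam p x ≤ B := ⟨_, G_le hp0 hp1 hlam0.le⟩
  have hlow : ∀ x ∈ Set.Ioo 0 β, f x < 0 := by
    intro x hx
    obtain ⟨y, hy, hy1⟩ : ∃ y, G lam p y < y ∧ y ∈ Set.Ioo 0 β :=
      ((eventually_G_lt hp0 hp1 hlam0.le hlam1).and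
        (Ioo_mem_nhdsGT hβ)).exists
    exact neg_of_neg_of_ne_zero hfc Set.ordConnected_Ioo
      (fun z hz => hne z hz.1 hz.2.ne (hz.2.trans hβα).ne) hy1 hx (sub_neg.2 hy)
  have hmid : ∀ x ∈ Set.Ioo β α, f x < 0 := fun x hx =>
    neg_of_neg_of_ne_zero hfc Set.ordConnected_Ioo
      (fun z hz => hne z (hβ.trans hz.1) hz.1.ne' hz.2.ne) ⟨h1, h2⟩ hx hμneg
  have hhigh : ∀ x ∈ Set.Ioi α, f x < 0 := fun x hx =>
    neg_of_neg_of_ne_zero hfc Set.ordConnected_Ioi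
      (fun z hz => hne z ((hβ.trans hβα).trans hz) (hβα.trans hz).ne' (ne_of_gt hz))
      (show max (α + 1) (B + 1) ∈ Set.Ioi α from lt_of_lt_of_le (lt_add_one α) (le_max_left _ _)) hx
      (by
        have := hB (max (α + 1) (B + 1))
        have h3 := le_max_right (α + 1) (B + 1)
        simp only [hf]; linarith)
  have hle : ∀ x, 0 ≤ x → G lam p x ≤ x := by
    intro x hx
    rcases hx.eq_or_lt with rfl | hx
    · rw [G_zero]
    by_cases hxβ : x = β
    · exact ((hfix x hx.le).2 (Or.inr (Or.inl hxβ))).le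
    by_cases hxα : x = α
    · exact ((hfix x hx.le).2 (Or.inr (Or.inr hxα))).le
    refine (sub_neg.1 ?_).le
    rcases lt_or_gt_of_ne hxβ with h | h
    · exact hlow x ⟨hx, h⟩
    · rcases lt_or_gt_of_ne hxα with h' | h'
      · exact hmid x ⟨h, h'⟩
      · exact hhigh x h'
  -- Needed for the supremum to be meaningful. If λ' > λ, then `G` at λ' exceeds β at β, and, being
  -- bounded, it crosses the diagonal again at a positive point.
  have hbdd : BddAbove {lam' : ℝ | 0 ≤ lam' ∧ ∀ μ : ℝ, 0 ≤ μ → (G lam' p μ = μ ↔ μ = 0)} := by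
    refine ⟨lam, fun lam' hlam' => ?_⟩
    by_contra hgt
    push Not at hgt
    have hβ' : β < G lam' p β := by
      have e : lam' = (lam' / lam) * lam := by field_simp
      rw [e, G_smul, (hfix β hβ.le).2 (Or.inr (Or.inl rfl))]
      have : 1 < lam' / lam := (one_lt_div hlam0).2 hgt
      nlinarith
    obtain ⟨B', hB'⟩ : ∃ B', ∀ x, G lam' p x ≤ B' := ⟨_, G_le hp0 hp1 hlam'.1⟩
    have hfc' : Continuous fun μ => μ - G lam' p μ := continuous_id.sub (continuous_G hp0 hp1 lam')
    obtain ⟨z, hz, hz0⟩ := intermediate_value_Icc (le_max_left β B') hfc'.continuousOn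
      (show (0 : ℝ) ∈ Set.Icc _ _ from ⟨by linarith, by
        have := hB' (max β B'); have := le_max_right β B'; linarith⟩)
    have := (hlam'.2 z (hβ.le.trans hz.1)).1 (by simp only at hz0; linarith)
    have h3 := hz.1
    linarith
  -- At the midpoint between λ_sp and λ, `G` is multiplied by a factor below 1, so it is strictly
  -- below the diagonal away from 0. This value of λ belongs to the set and exceeds its supremum.
  have hmem : (spinodal p + lam) / 2 ∈
      {lam' : ℝ | 0 ≤ lam' ∧ ∀ μ : ℝ, 0 ≤ μ → (G lam' p μ = μ ↔ μ = 0)} := by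
    have hs := spinodal_nonneg p
    refine ⟨by linarith, fun x hx => ⟨fun h => ?_, fun h => by rw [h, G_zero]⟩⟩
    by_contra hx0
    have hx' : 0 < x := lt_of_le_of_ne hx (Ne.symm hx0)
    have e : (spinodal p + lam) / 2 = ((spinodal p + lam) / 2 / lam) * lam := by field_simp
    rw [e, G_smul] at h
    have hr : (spinodal p + lam) / 2 / lam < 1 := by rw [div_lt_one hlam0]; linarith
    have hr0 : 0 < (spinodal p + lam) / 2 / lam := by positivity
    have := hle x hx
    nlinarith
  have := le_csSup hbdd hmem
  change (spinodal p + lam) / 2 ≤ spinodal p at this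
  linarith

/-- The iterates of `G` dominate a sequence that converges to the largest fixed point. -/
lemma exists_tendsto_le_snr {q : ℝ} (hp0 : 0 < p) (hp1 : p < 1) (hlam : 0 ≤ lam) {α β : ℝ}
    (hβ : 0 < β) (hβα : β < α)
    (hfix : ∀ μ : ℝ, 0 ≤ μ → (G lam p μ = μ ↔ μ = 0 ∨ μ = β ∨ μ = α))
    (hG : ∀ μ, β < μ → μ < α → μ < G lam p μ) (hq : β < snr lam p q 0) :
    ∃ y : ℕ → ℝ, (∀ t, 0 < y t ∧ y t ≤ snr lam p q t ∧ y t ≤ α) ∧ Tendsto y atTop (𝓝 α) := by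
  have hα : G lam p α = α := (hfix α (hβ.trans hβα).le).2 (Or.inr (Or.inr rfl))
  -- The start is capped at α so that the iterates stay in (β, α] and increase; the uncapped `snr`
  -- dominates them by monotonicity of `G`.
  set y : ℕ → ℝ := fun t => (G lam p)^[t] (min (snr lam p q 0) α) with hy
  have hsucc : ∀ t, y (t + 1) = G lam p (y t) := fun t => Function.iterate_succ_apply' _ _ _
  have hle : ∀ μ, β < μ → μ ≤ α → μ ≤ G lam p μ := by
    intro μ h1 h2
    rcases h2.eq_or_lt with rfl | h2
    · exact hα.ge
    · exact (hG μ h1 h2).le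
  have hmem : ∀ t, β < y t ∧ y t ≤ α ∧ y t ≤ snr lam p q t := by
    intro t
    induction t with
    | zero => exact ⟨lt_min hq hβα, min_le_right _ _, min_le_left _ _⟩
    | succ t ih =>
      rw [hsucc]
      refine ⟨ih.1.trans_le (hle _ ih.1 ih.2.1), ?_, ?_⟩
      · rw [← hα]
        have := G_mono hp0 hp1 hlam (hβ.trans ih.1).le ih.2.1
        rwa [hα] at this ⊢
      · exact G_mono hp0 hp1 hlam (hβ.trans ih.1).le ih.2.2
  have hmono : Monotone y := monotone_nat_of_le_succ fun t => by
    rw [hsucc]; exact hle _ (hmem t).1 (hmem t).2.1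
  refine ⟨y, fun t => ⟨hβ.trans (hmem t).1, (hmem t).2.2, (hmem t).2.1⟩, ?_⟩
  have hbdd : BddAbove (Set.range y) := ⟨α, by rintro _ ⟨t, rfl⟩; exact (hmem t).2.1⟩
  have hlim := tendsto_atTop_ciSup hmono hbdd
  set l := ⨆ t, y t
  have hfixl : G lam p l = l := by
    have h1 : Tendsto (fun t => y (t + 1)) atTop (𝓝 (G lam p l)) := by
      simp only [hsucc]
      exact ((continuous_G hp0 hp1 lam).tendsto l).comp hlim
    exact tendsto_nhds_unique h1 (hlim.comp (tendsto_add_atTop_nat 1))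
  have hl0 : β < l := (hmem 0).1.trans_le (le_ciSup hbdd 0)
  rcases (hfix l (hβ.trans hl0).le).1 hfixl with h | h | h
  · linarith
  · linarith
  · rwa [h] at hlim

end Scalar

/-! ### The success probability -/

section Success

variable {n : ℕ} {p q : ℝ} {M : Matrix (Fin 2) (Fin 2) ℝ}

open Classical in
lemma prob_eq_expect (A : Set (Outcome n)) :
    prob p q M A = expect p q M (fun ω => if ω ∈ A then (1 : ℝ) else 0) := by
  simp only [prob, expect, smul_eq_mul, mul_ite, mul_one, mul_zero]

lemma Valid.prob_nonneg (h : Valid p q M) (A : Set (Outcome n)) : 0 ≤ prob p q M A := by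
  classical
  rw [prob_eq_expect]
  exact h.expect_nonneg fun ω => by split_ifs <;> norm_num

lemma Valid.prob_mono (h : Valid p q M) {A B : Set (Outcome n)} (hAB : A ⊆ B) :
    prob p q M A ≤ prob p q M B := by
  classical
  rw [prob_eq_expect, prob_eq_expect]
  refine h.expect_mono fun ω => ?_
  by_cases hA : ω ∈ A
  · simp [hA, hAB hA]
  · simp only [hA, if_false]; split_ifs <;> norm_num

lemma prob_label (i : Fin n) (k : Fin 2) :
    prob p q M {ω : Outcome n | ω.1 i = k} = labelProb p k := by
  classical
  have h := expect_vertex (p := p) (q := q) (M := M) i (fun l _ => if l = k then 1 else 0)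
  rw [prob_eq_expect]
  have h2 := ofReal_expect (p := p) (q := q) (M := M)
    (fun ω : Outcome n => if ω.1 i = k then (1 : ℝ) else 0)
  simp only [Complex.ofReal_one, Complex.ofReal_zero, apply_ite (fun x : ℝ => (x : ℂ))] at h2
  rw [h] at h2
  have e : ∀ x : ℂ, (q : ℂ) * x + (1 - q) * x = x := fun x => by ring
  simp only [e] at h2
  simp only [mul_ite, mul_one, mul_zero, Finset.sum_ite_eq', Finset.mem_univ, if_true] at h2
  convert Complex.ofReal_injective h2
  exact Iff.rfl

/-- The probability that `T` recovers the label `k` of the vertex `i`. -/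
noncomputable def hit (p q : ℝ) (M : Matrix (Fin 2) (Fin 2) ℝ) (T : Estimator n) (i : Fin n)
    (k : Fin 2) : ℝ := prob p q M {ω | T ω.2.1 (reveal ω.1 ω.2.2) i = k ∧ ω.1 i = k}

lemma Psucc_eq (T : Estimator n) :
    Psucc p q M T = (1 / (n : ℝ)) * ∑ i : Fin n, (∑ k, hit p q M T i k / labelProb p k - 1) := by
  unfold Psucc condProb hit
  simp only [prob_label, Fin.sum_univ_two, ← Set.ofPred_and]

lemma Valid.hit_div_mem (h : Valid p q M) (T : Estimator n) (i : Fin n) (k : Fin 2) :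
    0 ≤ hit p q M T i k / labelProb p k ∧ hit p q M T i k / labelProb p k ≤ 1 := by
  have hk := h.labelProb_pos k
  refine ⟨div_nonneg (h.prob_nonneg _) hk.le, (div_le_one hk).2 ?_⟩
  rw [← prob_label (q := q) (M := M) i k]
  exact h.prob_mono fun ω hω => hω.2

lemma Valid.abs_Psucc_le (h : Valid p q M) (T : Estimator n) : |Psucc p q M T| ≤ 1 := by
  rw [Psucc_eq, abs_mul, abs_of_nonneg (by positivity : (0 : ℝ) ≤ 1 / n)]
  have h1 : |∑ i : Fin n, (∑ k, hit p q M T i k / labelProb p k - 1)| ≤ n := by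
    refine (Finset.abs_sum_le_sum_abs _ _).trans ?_
    refine (Finset.sum_le_sum (g := fun _ => (1 : ℝ)) fun i _ => ?_).trans (by simp)
    rw [Fin.sum_univ_two, abs_le]
    have h0 := h.hit_div_mem T i 0
    have h1 := h.hit_div_mem T i 1
    constructor <;> linarith [h0.1, h0.2, h1.1, h1.2]
  rcases Nat.eq_zero_or_pos n with rfl | hn
  · simp
  · have hn : (0 : ℝ) < n := by exact_mod_cast hn
    rw [one_div, inv_mul_le_iff₀ hn, mul_one]; exact h1

/-- The probability of an observation together with the label `k` at the vertex `i`. -/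
noncomputable def joint (p q : ℝ) (M : Matrix (Fin 2) (Fin 2) ℝ) (g : SimpleGraph (Fin n))
    (y : Revealed n) (i : Fin n) (k : Fin 2) : ℝ :=
  prob p q M {ω | ω.1 i = k ∧ ω.2.1 = g ∧ reveal ω.1 ω.2.2 = y}

open Classical in
lemma hit_eq (T : Estimator n) (i : Fin n) (k : Fin 2) :
    hit p q M T i k = ∑ o : SimpleGraph (Fin n) × Revealed n,
      if T o.1 o.2 i = k then joint p q M o.1 o.2 i k else 0 := by
  unfold hit joint prob
  rw [← Finset.sum_fiberwise Finset.univ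
    (fun ω : Outcome n => ((ω.2.1, reveal ω.1 ω.2.2) : SimpleGraph (Fin n) × Revealed n))]
  refine Finset.sum_congr rfl fun o _ => ?_
  rw [Finset.sum_filter]
  split_ifs with ho
  · refine Finset.sum_congr rfl fun ω _ => ?_
    by_cases hω : (ω.2.1, reveal ω.1 ω.2.2) = o
    · obtain rfl := hω
      simp only [Set.mem_ofPred_eq, ho, true_and, and_true, if_true]
    · have : ¬ (ω.1 i = k ∧ ω.2.1 = o.1 ∧ reveal ω.1 ω.2.2 = o.2) := fun h =>
        hω (Prod.ext h.2.1 h.2.2)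
      simp only [Set.mem_ofPred_eq, hω, this, if_false]
  · refine Finset.sum_eq_zero fun ω _ => ?_
    by_cases hω : (ω.2.1, reveal ω.1 ω.2.2) = o
    · obtain rfl := hω
      simp only [Set.mem_ofPred_eq, ho, false_and, if_false, ite_self]
    · simp only [hω, if_false]

/-- For each observation only the label that T chooses contributes, so maximising over T decouples
over observations. -/
lemma sum_hit_eq (T : Estimator n) (i : Fin n) :
    ∑ k, hit p q M T i k / labelProb p k = ∑ o : SimpleGraph (Fin n) × Revealed n,
      joint p q M o.1 o.2 i (T o.1 o.2 i) / labelProb p (T o.1 o.2 i) := by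
  classical
  simp only [hit_eq, Finset.sum_div]
  rw [Finset.sum_comm]
  refine Finset.sum_congr rfl fun o _ => ?_
  simp only [ite_div, zero_div, Finset.sum_ite_eq, Finset.mem_univ, if_true]

/-- The optimal test maximises the likelihood of the observation at each vertex. -/
lemma Valid.joint_div_le (h : Valid p q M) (g : SimpleGraph (Fin n)) (y : Revealed n) (i : Fin n)
    (k : Fin 2) : joint p q M g y i k / labelProb p k ≤
      joint p q M g y i (Topt p q M g y i) / labelProb p (Topt p q M g y i) := by
  set Z := prob p q M {ω : Outcome n | ω.2.1 = g ∧ reveal ω.1 ω.2.2 = y} with hZ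
  have hpost : ∀ l, posterior p q M g y i l = joint p q M g y i l / Z := fun l => rfl
  have hnn : ∀ l, 0 ≤ joint p q M g y i l := fun l => h.prob_nonneg _
  have hle : ∀ l, joint p q M g y i l ≤ Z := fun l => h.prob_mono fun ω hω => hω.2
  have hp := h.p_pos
  have hp1 : 0 < 1 - p := by linarith [h.p_lt]
  -- An impossible observation has meaningless posteriors (division by 0), but then all joint
  -- probabilities vanish.
  rcases (h.prob_nonneg _ : 0 ≤ Z).eq_or_lt with hZ0 | hZ0
  · have : ∀ l, joint p q M g y i l = 0 := fun l => le_antisymm ((hle l).trans hZ0.symm.le) (hnn l)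
    simp [this]
  have hiff : p * posterior p q M g y i 1 ≤ (1 - p) * posterior p q M g y i 0 ↔
      joint p q M g y i 1 / (1 - p) ≤ joint p q M g y i 0 / p := by
    rw [hpost, hpost, ← mul_div_assoc, ← mul_div_assoc, div_le_div_iff_of_pos_right hZ0,
      div_le_div_iff₀ hp1 hp, mul_comm p, mul_comm (1 - p)]
  have h10 : labelProb p 1 = 1 - p := by simp [labelProb]
  have h00 : labelProb p 0 = p := by simp [labelProb]
  unfold Topt
  split_ifs with hc
  · rw [hiff] at hc
    fin_cases k
    · exact le_rfl
    · simpa only [Fin.mk_one, h10, h00] using hc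
  · rw [hiff] at hc
    fin_cases k
    · simpa only [Fin.zero_eta, h10, h00] using (not_le.1 hc).le
    · exact le_rfl

/-- The comparison holds vertex by vertex and observation by observation, by `Valid.joint_div_le`.
-/
lemma Valid.Psucc_le_Topt (h : Valid p q M) (T : Estimator n) :
    Psucc p q M T ≤ Psucc p q M (Topt (n := n) p q M) := by
  rw [Psucc_eq, Psucc_eq]
  refine mul_le_mul_of_nonneg_left (Finset.sum_le_sum fun i _ => sub_le_sub_right ?_ 1)
    (by positivity)
  rw [sum_hit_eq, sum_hit_eq]
  exact Finset.sum_le_sum fun o _ => h.joint_div_le o.1 o.2 i _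

end Success

/-! ### Passing to the limits inferior in n and d. -/

section Rates

variable {p q d : ℝ} {a b c : ℝ}

/-- The real `liminf` is monotone only under boundedness, which |P_succ| ≤ 1 supplies. -/
lemma rate_bounds (hv : ∀ᶠ n : ℕ in atTop, Valid p q (connectivity a b c d n))
    (T : (n : ℕ) → Estimator n) :
    IsBoundedUnder (· ≤ ·) atTop (fun n => Psucc p q (connectivity a b c d n) (T n)) ∧
      IsBoundedUnder (· ≥ ·) atTop (fun n => Psucc p q (connectivity a b c d n) (T n)) := by
  constructor
  · exact ⟨1, eventually_map.2 (hv.mono fun n hn => (abs_le.1 (hn.abs_Psucc_le _)).2)⟩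
  · exact ⟨-1, eventually_map.2 (hv.mono fun n hn => (abs_le.1 (hn.abs_Psucc_le _)).1)⟩

lemma abs_rate_le (hv : ∀ᶠ n : ℕ in atTop, Valid p q (connectivity a b c d n))
    (T : (n : ℕ) → Estimator n) : |rate p q a b c d T| ≤ 1 := by
  obtain ⟨h1, h2⟩ := rate_bounds hv T
  rw [abs_le]
  constructor
  · exact le_liminf_of_le h1.isCoboundedUnder_ge
      (hv.mono fun n hn => (abs_le.1 (hn.abs_Psucc_le _)).1)
  · exact liminf_le_of_le h2 fun x hx => by
      obtain ⟨n, h3, h4⟩ := (hx.and hv).exists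
      exact h3.trans (abs_le.1 (h4.abs_Psucc_le _)).2

lemma rate_le_optRate (hv : ∀ᶠ n : ℕ in atTop, Valid p q (connectivity a b c d n))
    (T : (n : ℕ) → Estimator n) : rate p q a b c d T ≤ optRate p q a b c d :=
  liminf_le_liminf (hv.mono fun _ hn => hn.Psucc_le_Topt _) (rate_bounds hv T).2
    (rate_bounds hv _).1.isCoboundedUnder_ge

variable {a b c : ℝ → ℝ}

/-- The optimal test is asymptotically at least as good as any other test. -/
lemma liminf_rate_le (hv : ∀ᶠ d in atTop, ∀ᶠ n : ℕ in atTop,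
      Valid p q (connectivity (a d) (b d) (c d) d n)) (T : ℝ → (n : ℕ) → Estimator n) :
    liminf (fun d : ℝ => rate p q (a d) (b d) (c d) d (T d)) atTop ≤
      liminf (fun d : ℝ => optRate p q (a d) (b d) (c d) d) atTop := by
  refine liminf_le_liminf (hv.mono fun d hd => rate_le_optRate hd _) ?_ ?_
  · exact ⟨-1, eventually_map.2 (hv.mono fun d hd => (abs_le.1 (abs_rate_le hd _)).1)⟩
  · exact IsBoundedUnder.isCoboundedUnder_ge
      ⟨1, eventually_map.2 (hv.mono fun d hd => (abs_le.1 (abs_rate_le hd _)).2)⟩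

end Rates

/-! ### Thresholding the messages -/

section Threshold

open Classical in
/-- The estimator that compares the message sent by each vertex after `t` rounds with `c`. -/
noncomputable def threshold {n : ℕ} (v : ℕ → ℝ → ℝ) (code : Option (Fin 2) → ℝ) (t : ℕ) (c : ℝ) :
    Estimator n := fun g y i => if c < msg v code g y t ∅ i then 0 else 1

lemma isLocal_threshold {n : ℕ} (v : ℕ → ℝ → ℝ) (code : Option (Fin 2) → ℝ) (t : ℕ) (c : ℝ) :
    IsLocal t (threshold (n := n) v code t c) := by
  intro i g g' y y' h₀ h₁ h₂
  unfold threshold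
  rw [msg_local h₀ h₁ h₂ t 0 (by simp) ∅ i (by simp) (by simp)]

variable {n : ℕ} {p q : ℝ} {M : Matrix (Fin 2) (Fin 2) ℝ} {v : ℕ → ℝ → ℝ}
  {code : Option (Fin 2) → ℝ} {t : ℕ}

/-- The average over the vertices of label `k` of a function of the messages. -/
noncomputable def labelMean (p q : ℝ) (M : Matrix (Fin 2) (Fin 2) ℝ) (n : ℕ) (v : ℕ → ℝ → ℝ)
    (code : Option (Fin 2) → ℝ) (t : ℕ) (k : Fin 2) (f : ℝ → ℝ) : ℝ :=
  (1 / (n : ℝ)) * ∑ i : Fin n,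
    expect p q M (fun ω : Outcome n => if ω.1 i = k then f (msgAt v code t ∅ i ω) else 0)

/-- With no vertex removed, the label mean is the expectation of the empirical mean, so convergence
in L¹ implies convergence of the expectations. -/
lemma LLN.tendsto_labelMean {d : ℝ} {K : Matrix (Fin 2) (Fin 2) ℝ} {k : Fin 2} {f : ℝ → ℝ} {ℓ : ℝ}
    (h : LLN p q d K v code t k (fun x => (f x : ℂ)) ℓ)
    (hv : ∀ᶠ n : ℕ in atTop, Valid p q ((d / n) • K)) :
    Tendsto (fun n : ℕ => labelMean p q ((d / n) • K) n v code t k f) atTop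
      (𝓝 (labelProb p k * ℓ)) := by
  rw [Metric.tendsto_nhds]
  intro η hη
  filter_upwards [h 0 (η / 2) (by positivity), hv] with n hn hvn
  have h1 := (hvn.norm_expect_le _).trans (hn ∅ (by simp))
  have h2 : expect p q ((d / n) • K) (fun ω : Outcome n =>
      empMean v code t k (fun x => (f x : ℂ)) ∅ ω - labelProb p k * ℓ) =
      ((labelMean p q ((d / n) • K) n v code t k f - labelProb p k * ℓ : ℝ) : ℂ) := by
    rw [labelMean, ← expect_sum, ← expect_const_mul,
      ← expect_const (n := n) (p := p) (q := q) (M := (d / n) • K) (labelProb p k * ℓ),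
      ← expect_sub, ofReal_expect]
    congr 1
    funext ω
    rw [empMean]
    push_cast
    simp only [Finset.compl_empty, apply_ite (fun x : ℝ => (x : ℂ)), Complex.ofReal_zero]
  rw [h2, Complex.norm_real] at h1
  rw [Real.dist_eq, ← Real.norm_eq_abs]
  linarith

lemma Valid.labelMean_mono (h : Valid p q M) {k : Fin 2} {f f' : ℝ → ℝ} (hf : ∀ x, f x ≤ f' x) :
    labelMean p q M n v code t k f ≤ labelMean p q M n v code t k f' := by
  unfold labelMean
  gcongr with i
  exact h.expect_mono fun ω => by split_ifs <;> simp [hf]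

-- Failing on label 1 means exceeding the threshold, so the success probability is the average
-- difference of the exceedance probabilities given labels 0 and 1.
open Classical in
lemma Psucc_threshold (c : ℝ) (hp1 : 1 - p ≠ 0) :
    Psucc p q M (threshold (n := n) v code t c) =
      labelMean p q M n v code t 0 (fun x => if c < x then 1 else 0) / p -
        labelMean p q M n v code t 1 (fun x => if c < x then 1 else 0) / (1 - p) := by
  have h0 : ∀ i, hit p q M (threshold (n := n) v code t c) i 0 = expect p q M (fun ω : Outcome n =>
      if ω.1 i = 0 then (if c < msgAt v code t ∅ i ω then (1 : ℝ) else 0) else 0) := by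
    intro i
    rw [hit, prob_eq_expect]
    congr 1
    funext ω
    simp only [threshold, Set.mem_ofPred_eq, msgAt]
    by_cases h1 : c < msg v code ω.2.1 (reveal ω.1 ω.2.2) t ∅ i <;> by_cases h2 : ω.1 i = 0 <;>
      simp [h1, h2]
  have h1 : ∀ i, hit p q M (threshold (n := n) v code t c) i 1 = (1 - p) -
      expect p q M (fun ω : Outcome n =>
      if ω.1 i = 1 then (if c < msgAt v code t ∅ i ω then (1 : ℝ) else 0) else 0) := by
    intro i
    have : (1 - p) = labelProb p 1 := by simp [labelProb]
    rw [this, ← prob_label (q := q) (M := M) i 1, hit, prob_eq_expect, prob_eq_expect, ← expect_sub]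
    congr 1
    funext ω
    simp only [threshold, Set.mem_ofPred_eq, msgAt]
    by_cases h1 : c < msg v code ω.2.1 (reveal ω.1 ω.2.2) t ∅ i <;> by_cases h2 : ω.1 i = 1 <;>
      simp [h1, h2]
  have h10 : labelProb p 1 = 1 - p := by simp [labelProb]
  have h00 : labelProb p 0 = p := by simp [labelProb]
  rw [Psucc_eq, labelMean, labelMean]
  simp only [Fin.sum_univ_two, h0, h1, h10, h00, sub_div, div_self hp1]
  rw [mul_div_assoc, mul_div_assoc, Finset.sum_div, Finset.sum_div, ← mul_sub,
    ← Finset.sum_sub_distrib]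
  congr 1
  refine Finset.sum_congr rfl fun i _ => ?_
  ring

end Threshold

/-! ### The limiting success probability of the thresholded messages -/

section Limit

/-- A continuous step from `0` to `1`, starting at `c`, of slope `m`. -/
noncomputable def ramp (m c x : ℝ) : ℝ := max 0 (min 1 (m * (x - c)))

@[fun_prop]
lemma continuous_ramp (m c : ℝ) : Continuous (ramp m c) := by unfold ramp; fun_prop

lemma ramp_nonneg (m c x : ℝ) : 0 ≤ ramp m c x := le_max_left _ _

lemma ramp_le_one (m c x : ℝ) : ramp m c x ≤ 1 := max_le zero_le_one (min_le_left _ _)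

lemma abs_ramp_le (m c x : ℝ) : |ramp m c x| ≤ 1 := by
  rw [abs_of_nonneg (ramp_nonneg m c x)]; exact ramp_le_one m c x

lemma ramp_of_le {m c x : ℝ} (hm : 0 ≤ m) (hx : x ≤ c) : ramp m c x = 0 :=
  max_eq_left ((min_le_right _ _).trans (mul_nonpos_of_nonneg_of_nonpos hm (by linarith)))

lemma ramp_eq_one {m c x : ℝ} (hx : 1 ≤ m * (x - c)) : ramp m c x = 1 := by
  rw [ramp, min_eq_left hx, max_eq_right zero_le_one]

/-- Integrals of steps that become steep converge to the measure of a half line. -/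
lemma tendsto_integral_ramp (γ : Measure ℝ) [IsProbabilityMeasure γ] [NullSingletonClass γ] (c : ℝ)
    {x : ℕ → ℝ} (hx : ∀ m : ℕ, x m = c ∨ x m = c - 1 / (m + 1)) :
    Tendsto (fun m : ℕ => ∫ z, ramp ((m : ℝ) + 1) (x m) z ∂γ) atTop (𝓝 (γ.real (Set.Ioi c))) := by
  have e : γ.real (Set.Ioi c) = ∫ z, (Set.Ioi c).indicator (fun _ => (1 : ℝ)) z ∂γ := by
    rw [integral_indicator measurableSet_Ioi]; simp
  have hxc : ∀ m, x m ≤ c := fun m => by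
    rcases hx m with h | h <;> rw [h]
    have : (0 : ℝ) < 1 / ((m : ℝ) + 1) := by positivity
    linarith
  rw [e]
  refine tendsto_integral_of_dominated_convergence (fun _ => 1)
    (fun m => (continuous_ramp _ _).aestronglyMeasurable) (integrable_const _)
    (fun m => ae_of_all _ fun z => abs_ramp_le _ _ _) ?_
  -- The point c must be discarded: a ramp started at c - 1/(m+1) equals 1 there.
  have hae : ∀ᵐ z ∂γ, z ≠ c := by
    rw [ae_iff]; simp
  filter_upwards [hae] with z hz
  refine tendsto_const_nhds.congr' ?_
  rcases lt_or_gt_of_ne hz with h | h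
  · have h1 : Tendsto (fun m : ℕ => c - 1 / ((m : ℝ) + 1)) atTop (𝓝 (c - 0)) :=
      tendsto_const_nhds.sub tendsto_one_div_add_atTop_nhds_zero_nat
    rw [sub_zero] at h1
    filter_upwards [h1.eventually_const_lt h] with m hm
    have hzx : z ≤ x m := by
      rcases hx m with h' | h' <;> rw [h'] <;> linarith
    rw [ramp_of_le (by positivity) hzx]
    simp [h.le]
  · have h1 : Tendsto (fun m : ℕ => ((m : ℝ) + 1) * (z - c)) atTop atTop :=
      (tendsto_atTop_add_const_right _ _ tendsto_natCast_atTop_atTop).atTop_mul_const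
        (by linarith)
    filter_upwards [h1.eventually_ge_atTop 1] with m hm
    have : 1 ≤ ((m : ℝ) + 1) * (z - x m) := hm.trans (by gcongr; exact hxc m)
    rw [ramp_eq_one this]
    simp [h]

variable {p q lam : ℝ}

/-- The rate of a threshold test is determined up to the mass near the threshold. -/
lemma rate_threshold_bounds {a b c d : ℝ} {v : ℕ → ℝ → ℝ} {code : Option (Fin 2) → ℝ} {t : ℕ}
    (hp0 : 0 < p) (hp1 : p < 1)
    (hv : ∀ᶠ n : ℕ in atTop, Valid p q (connectivity a b c d n)) {θ : ℝ} {ν : Fin 2 → Measure ℝ}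
    (h : ∀ (k : Fin 2) (f : ℝ → ℝ), Continuous f → (∀ x, |f x| ≤ 1) →
      LLN p q d !![a, b; b, c] v code t k (fun x => (f x : ℂ)) (∫ x, f x ∂(ν k) : ℝ))
    {f₁ f₂ : ℝ → ℝ} (hf₁ : Continuous f₁) (hf₂ : Continuous f₂) (hf₁' : ∀ x, |f₁ x| ≤ 1)
    (hf₂' : ∀ x, |f₂ x| ≤ 1) (h₁ : ∀ x, f₁ x ≤ if θ < x then 1 else 0)
    (h₂ : ∀ x, (if θ < x then 1 else 0) ≤ f₂ x) :
    ∫ x, f₁ x ∂(ν 0) - ∫ x, f₂ x ∂(ν 1) ≤ rate p q a b c d (fun _ => threshold v code t θ) ∧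
      rate p q a b c d (fun _ => threshold v code t θ) ≤
        ∫ x, f₂ x ∂(ν 0) - ∫ x, f₁ x ∂(ν 1) := by
  classical
  have hp1' : 0 < 1 - p := by linarith
  have h10 : labelProb p 1 = 1 - p := by simp [labelProb]
  have h00 : labelProb p 0 = p := by simp [labelProb]
  have key : ∀ f f' : ℝ → ℝ, Continuous f → Continuous f' → (∀ x, |f x| ≤ 1) → (∀ x, |f' x| ≤ 1) →
      Tendsto (fun n : ℕ => labelMean p q (connectivity a b c d n) n v code t 0 f / p -
        labelMean p q (connectivity a b c d n) n v code t 1 f' / (1 - p)) atTop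
        (𝓝 (∫ x, f x ∂(ν 0) - ∫ x, f' x ∂(ν 1))) := by
    intro f f' hf hf' hb hb'
    have e0 := ((h 0 f hf hb).tendsto_labelMean hv).div_const p
    have e1 := ((h 1 f' hf' hb').tendsto_labelMean hv).div_const (1 - p)
    rw [h00, mul_div_cancel_left₀ _ hp0.ne'] at e0
    rw [h10, mul_div_cancel_left₀ _ hp1'.ne'] at e1
    exact e0.sub e1
  have k1 := key f₁ f₂ hf₁ hf₂ hf₁' hf₂'
  have k2 := key f₂ f₁ hf₂ hf₁ hf₂' hf₁'
  obtain ⟨b1, b2⟩ := rate_bounds hv (fun n => threshold v code t θ)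
  unfold rate
  constructor
  · rw [← k1.liminf_eq]
    refine liminf_le_liminf ?_ k1.isBoundedUnder_ge b1.isCoboundedUnder_ge
    filter_upwards [hv] with n hn
    rw [Psucc_threshold θ hp1'.ne']
    have := hn.labelMean_mono (n := n) (v := v) (code := code) (t := t) (k := 0) h₁
    have := hn.labelMean_mono (n := n) (v := v) (code := code) (t := t) (k := 1) h₂
    gcongr
  · rw [← k2.liminf_eq]
    refine liminf_le_liminf ?_ b2 k2.isBoundedUnder_le.isCoboundedUnder_ge
    filter_upwards [hv] with n hn
    rw [Psucc_threshold θ hp1'.ne']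
    have := hn.labelMean_mono (n := n) (v := v) (code := code) (t := t) (k := 0) h₂
    have := hn.labelMean_mono (n := n) (v := v) (code := code) (t := t) (k := 1) h₁
    gcongr

/-- The indicator of the half line is squeezed between two ramps of slope m + 1. With m fixed, n and
then d tend to infinity; making the ramps steep afterwards closes the gap, since the limit laws have
no atoms. -/
lemma tendsto_rate_threshold {a b c : ℝ → ℝ} {v : ℝ → ℕ → ℝ → ℝ} {code : Option (Fin 2) → ℝ}
    {t : ℕ} (hp0 : 0 < p) (hp1 : p < 1)
    (hv : ∀ᶠ d in atTop, ∀ᶠ n : ℕ in atTop, Valid p q (connectivity (a d) (b d) (c d) d n)) {θ : ℝ}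
    {ν : ℝ → Fin 2 → Measure ℝ} {γ : Fin 2 → Measure ℝ} [∀ k, IsProbabilityMeasure (γ k)]
    [∀ k, NullSingletonClass (γ k)] (hγ : ∀ k, WeakLim (fun d => ν d k) (γ k))
    (h : ∀ᶠ d in atTop, ∀ (k : Fin 2) (f : ℝ → ℝ), Continuous f → (∀ x, |f x| ≤ 1) →
      LLN p q d !![a d, b d; b d, c d] (v d) code t k (fun x => (f x : ℂ))
        (∫ x, f x ∂(ν d k) : ℝ)) :
    Tendsto (fun d => rate p q (a d) (b d) (c d) d (fun _ => threshold (v d) code t θ)) atTop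
      (𝓝 ((γ 0).real (Set.Ioi θ) - (γ 1).real (Set.Ioi θ))) := by
  set f₁ : ℕ → ℝ → ℝ := fun m => ramp ((m : ℝ) + 1) θ with hf₁
  set f₂ : ℕ → ℝ → ℝ := fun m => ramp ((m : ℝ) + 1) (θ - 1 / ((m : ℝ) + 1)) with hf₂
  have hm : ∀ m : ℕ, (0 : ℝ) < (m : ℝ) + 1 := fun m => by positivity
  have h₁ : ∀ (m : ℕ) (x : ℝ), f₁ m x ≤ if θ < x then 1 else 0 := by
    intro m x
    split_ifs with hx
    · exact ramp_le_one _ _ _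
    · exact (ramp_of_le (hm m).le (not_lt.1 hx)).le
  have h₂ : ∀ (m : ℕ) (x : ℝ), (if θ < x then 1 else 0) ≤ f₂ m x := by
    intro m x
    split_ifs with hx
    · refine (ramp_eq_one ?_).ge
      rw [← div_le_iff₀' (hm m)]; linarith
    · exact ramp_nonneg _ _ _
  have c₁ : ∀ k, Tendsto (fun m => ∫ x, f₁ m x ∂(γ k)) atTop (𝓝 ((γ k).real (Set.Ioi θ))) :=
    fun k => tendsto_integral_ramp (γ k) θ (x := fun _ => θ) fun m => Or.inl rfl
  have c₂ : ∀ k, Tendsto (fun m => ∫ x, f₂ m x ∂(γ k)) atTop (𝓝 ((γ k).real (Set.Ioi θ))) :=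
    fun k => tendsto_integral_ramp (γ k) θ (x := fun m : ℕ => θ - 1 / ((m : ℝ) + 1))
      fun m => Or.inr rfl
  have w₁ : ∀ m k, Tendsto (fun d => ∫ x, f₁ m x ∂(ν d k)) atTop (𝓝 (∫ x, f₁ m x ∂(γ k))) :=
    fun m k => hγ k _ (continuous_ramp _ _) ⟨1, abs_ramp_le _ _⟩
  have w₂ : ∀ m k, Tendsto (fun d => ∫ x, f₂ m x ∂(ν d k)) atTop (𝓝 (∫ x, f₂ m x ∂(γ k))) :=
    fun m k => hγ k _ (continuous_ramp _ _) ⟨1, abs_ramp_le _ _⟩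
  have hb : ∀ m, ∀ᶠ d in atTop,
      ∫ x, f₁ m x ∂(ν d 0) - ∫ x, f₂ m x ∂(ν d 1) ≤
        rate p q (a d) (b d) (c d) d (fun _ => threshold (v d) code t θ) ∧
      rate p q (a d) (b d) (c d) d (fun _ => threshold (v d) code t θ) ≤
        ∫ x, f₂ m x ∂(ν d 0) - ∫ x, f₁ m x ∂(ν d 1) := by
    intro m
    filter_upwards [hv, h] with d hvd hd
    exact rate_threshold_bounds hp0 hp1 hvd hd (continuous_ramp _ _) (continuous_ramp _ _)
      (abs_ramp_le _ _) (abs_ramp_le _ _) (h₁ m) (h₂ m)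
  refine tendsto_order.2 ⟨fun l hl => ?_, fun l hl => ?_⟩
  · obtain ⟨m, hm⟩ := (((c₁ 0).sub (c₂ 1)).eventually_const_lt hl).exists
    filter_upwards [hb m, ((w₁ m 0).sub (w₂ m 1)).eventually_const_lt hm] with d h1 h2
    exact h2.trans_le h1.1
  · obtain ⟨m, hm⟩ := (((c₂ 0).sub (c₁ 1)).eventually_lt_const hl).exists
    filter_upwards [hb m, ((w₂ m 0).sub (w₁ m 1)).eventually_lt_const hm] with d h1 h2
    exact h1.2.trans_lt h2

end Limit

/-! ### Gaussian tails -/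

section GaussianTail

lemma nullSingletonClass_gaussLaw {μ : ℝ} (hμ : 0 < μ) (p : ℝ) (k : Fin 2) : NullSingletonClass (gaussLaw p μ k) :=
  nullSingletonClass_gaussianReal (by simpa using hμ)

lemma gaussianReal_Ioi_sub (m : ℝ) (v : NNReal) (c : ℝ) :
    (gaussianReal m v).real (Set.Ioi c) = (gaussianReal (m - c) v).real (Set.Ioi 0) := by
  rw [← gaussianReal_map_sub_const c, map_measureReal_apply (by fun_prop) measurableSet_Ioi]
  congr 1
  ext x
  simp

/-- The symmetric threshold between the two Gaussian laws of the messages. -/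
lemma gaussLaw_sub {μ : ℝ} (hμ : 0 < μ) (p : ℝ) :
    (gaussLaw p μ 0).real (Set.Ioi (μ * (1 - 2 * p) / 2)) -
      (gaussLaw p μ 1).real (Set.Ioi (μ * (1 - 2 * p) / 2)) =
        2 * (gaussianReal (μ / 2) μ.toNNReal).real (Set.Ioi 0) - 1 := by
  have : NullSingletonClass (gaussianReal (μ / 2) μ.toNNReal) := nullSingletonClass_gaussianReal (by simpa using hμ)
  simp only [gaussLaw, if_true, one_ne_zero, if_false]
  rw [gaussianReal_Ioi_sub, gaussianReal_Ioi_sub (-(μ * p)),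
    show μ * (1 - p) - μ * (1 - 2 * p) / 2 = μ / 2 by ring,
    show -(μ * p) - μ * (1 - 2 * p) / 2 = -(μ / 2) by ring, ← gaussianReal_map_neg,
    map_measureReal_apply measurable_neg measurableSet_Ioi]
  have e : (fun x : ℝ => -x) ⁻¹' Set.Ioi 0 = Set.Iio 0 := by ext x; simp
  have h1 : (gaussianReal (μ / 2) μ.toNNReal).real (Set.Iio 0) =
      1 - (gaussianReal (μ / 2) μ.toNNReal).real (Set.Ioi 0) := by
    rw [measureReal_congr (Iio_ae_eq_Iic (a := (0 : ℝ))), ← Set.compl_Ioi,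
      probReal_compl_eq_one_sub measurableSet_Ioi]
  rw [e, h1]
  ring

/-- Standardising turns the success probability into the mass of a half line that grows with μ,
which gives both monotonicity and continuity in μ. -/
lemma gaussianReal_Ioi_eq {μ : ℝ} (hμ : 0 < μ) :
    (gaussianReal (μ / 2) μ.toNNReal).real (Set.Ioi 0) =
      (gaussianReal 0 1).real (Set.Ioi (-(√μ / 2))) := by
  have h : (gaussianReal 0 1).map (fun x => √μ * x + μ / 2) = gaussianReal (μ / 2) μ.toNNReal := by
    have h1 : (fun x => √μ * x + μ / 2) = (fun x => x + μ / 2) ∘ fun x => √μ * x := rfl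
    rw [h1, ← Measure.map_map (by fun_prop) (by fun_prop), gaussianReal_map_const_mul,
      gaussianReal_map_add_const]
    congr 1
    · simp
    · ext; simp [Real.sq_sqrt hμ.le, hμ.le]
  rw [← h, map_measureReal_apply (by fun_prop) measurableSet_Ioi]
  congr 1
  ext x
  have hs : 0 < √μ := Real.sqrt_pos.2 hμ
  have : √μ * x + μ / 2 = √μ * (x - -(√μ / 2)) := by
    have := Real.mul_self_sqrt hμ.le
    linear_combination (-1 / 2) * this
  simp only [Set.mem_preimage, Set.mem_Ioi, this, mul_pos_iff_of_pos_left hs, sub_pos]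

lemma gaussianReal_Ioi_mono {μ μ' : ℝ} (hμ : 0 < μ) (h : μ ≤ μ') :
    (gaussianReal (μ / 2) μ.toNNReal).real (Set.Ioi 0) ≤
      (gaussianReal (μ' / 2) μ'.toNNReal).real (Set.Ioi 0) := by
  rw [gaussianReal_Ioi_eq hμ, gaussianReal_Ioi_eq (hμ.trans_le h)]
  exact measureReal_mono (Set.Ioi_subset_Ioi (by gcongr))

lemma tendsto_gaussianReal_Ioi {y : ℕ → ℝ} {α : ℝ} (hα : 0 < α) (hy0 : ∀ t, 0 < y t)
    (hyα : ∀ t, y t ≤ α) (hy : Tendsto y atTop (𝓝 α)) :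
    Tendsto (fun t => (gaussianReal (y t / 2) (y t).toNNReal).real (Set.Ioi 0)) atTop
      (𝓝 ((gaussianReal (α / 2) α.toNNReal).real (Set.Ioi 0))) := by
  simp only [gaussianReal_Ioi_eq hα, gaussianReal_Ioi_eq (hy0 _)]
  refine (ENNReal.tendsto_toReal (measure_ne_top _ _)).comp
    (tendsto_measure_of_tendsto_indicator_of_isFiniteMeasure atTop (gaussianReal 0 1)
      (fun _ => measurableSet_Ioi) fun x => ?_)
  have hlim : Tendsto (fun t => -(√(y t) / 2)) atTop (𝓝 (-(√α / 2))) :=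
    (((Real.continuous_sqrt.tendsto α).comp hy).div_const 2).neg
  by_cases hx : -(√α / 2) < x
  · filter_upwards [hlim.eventually_lt_const hx] with t ht
    simp only [Set.mem_Ioi, hx, ht]
  -- As y t ≤ α, the approximating half lines lie inside the limit one. Pointwise convergence thus
  -- holds even at the endpoint.
  · refine Eventually.of_forall fun t => ?_
    have h1 : √(y t) ≤ √α := Real.sqrt_le_sqrt (hyα t)
    have h2 : ¬ -(√(y t) / 2) < x := by linarith
    simp only [Set.mem_Ioi, hx, h2]

end GaussianTail

/-! ### Message passing is a local test -/

section Main

variable {p q lam : ℝ} {a b c : ℝ → ℝ}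

/-- The two balance equations determine a and c from ε = 1 - b, and |ε| = √(λ/d) tends to 0, so all
the entries are eventually nonnegative. -/
lemma eventually_connectivity (hp0 : 0 < p) (hp1 : p < 1)
    (habc : ∀ᶠ d : ℝ in atTop,
      p * a d + (1 - p) * b d = 1 ∧ p * b d + (1 - p) * c d = 1 ∧ d * (1 - b d) ^ 2 = lam) :
    (∀ᶠ d in atTop, ∀ k l, !![a d, b d; b d, c d] k l = 1 + (1 - b d) * kap p k l) ∧
      Tendsto (fun d => 1 - b d) atTop (𝓝 0) ∧
      ∀ᶠ d in atTop, 0 ≤ d ∧ ∀ k l, 0 ≤ !![a d, b d; b d, c d] k l := by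
  have hp1' : 1 - p ≠ 0 := by linarith
  have hK : ∀ᶠ d in atTop, ∀ k l, !![a d, b d; b d, c d] k l = 1 + (1 - b d) * kap p k l := by
    filter_upwards [habc] with d hd k l
    obtain ⟨h1, h2, -⟩ := hd
    fin_cases k <;> fin_cases l <;> simp [kap]
    · field_simp; linarith
    · field_simp; linarith
  have hε : Tendsto (fun d => 1 - b d) atTop (𝓝 0) := by
    have h1 : Tendsto (fun d : ℝ => √(lam / d)) atTop (𝓝 0) := by
      have : Tendsto (fun d : ℝ => lam / d) atTop (𝓝 0) := tendsto_const_nhds.div_atTop tendsto_id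
      simpa [Function.comp_def] using (Real.continuous_sqrt.tendsto 0).comp this
    rw [tendsto_zero_iff_abs_tendsto_zero]
    refine h1.congr' ?_
    filter_upwards [habc, eventually_gt_atTop 0] with d hd hd0
    rw [← hd.2.2, mul_div_cancel_left₀ _ hd0.ne', Real.sqrt_sq_eq_abs]
    rfl
  refine ⟨hK, hε, ?_⟩
  have hpos : ∀ k l, ∀ᶠ d in atTop, 0 < 1 + (1 - b d) * kap p k l := by
    intro k l
    have : Tendsto (fun d => 1 + (1 - b d) * kap p k l) atTop (𝓝 (1 + 0 * kap p k l)) :=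
      tendsto_const_nhds.add (hε.mul_const _)
    exact this.eventually_const_lt (by simp)
  filter_upwards [hK, eventually_ge_atTop 0, hpos 0 0, hpos 0 1, hpos 1 0, hpos 1 1] with
    d hd hd0 h00 h01 h10 h11
  refine ⟨hd0, fun k l => ?_⟩
  rw [hd]
  fin_cases k <;> fin_cases l
  exacts [h00.le, h01.le, h10.le, h11.le]

/-- Thresholded message passing realises the success probability predicted by the recursion. -/
lemma mem_localLimits (hp0 : 0 < p) (hp1 : p < 1) (hq : 0 ≤ q) (hq1 : q ≤ 1) (hlam : 0 ≤ lam)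
    (habc : ∀ᶠ d : ℝ in atTop,
      p * a d + (1 - p) * b d = 1 ∧ p * b d + (1 - p) * c d = 1 ∧ d * (1 - b d) ^ 2 = lam)
    (hv : ∀ᶠ d in atTop, ∀ᶠ n : ℕ in atTop, Valid p q (connectivity (a d) (b d) (c d) d n))
    (t : ℕ) (hμ : 0 < snr lam p q t) :
    2 * (gaussianReal (snr lam p q t / 2) (snr lam p q t).toNNReal).real (Set.Ioi 0) - 1 ∈
      localLimits p q a b c := by
  obtain ⟨hK, hε, hnn⟩ := eventually_connectivity hp0 hp1 habc
  set K : ℝ → Matrix (Fin 2) (Fin 2) ℝ := fun d => !![a d, b d; b d, c d] with hKdef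
  set s : ℝ → ℝ := fun d => (1 - b d) / (p * (1 - p))
  -- The index is shifted: `snr` at t is the ratio of the messages after t + 1 rounds. The threshold
  -- is midway between the two Gaussian means.
  refine ⟨fun d n => threshold (jump p q d (K d) (s d) (nonlin lam p q) (initMsg p)) (initMsg p)
    (t + 1) (snr lam p q t * (1 - 2 * p) / 2), ⟨t + 1, fun d n => isLocal_threshold _ _ _ _⟩, ?_⟩
  rw [← gaussLaw_sub hμ p]
  have := nullSingletonClass_gaussLaw hμ p
  refine tendsto_rate_threshold (γ := gaussLaw p (snr lam p q t)) hp0 hp1 hv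
    (fun k => weakLim_treeLaw hp0 hp1 hq hq1 hlam (habc.mono fun d hd => hd.2.2) hε hK t k) ?_
  filter_upwards [hnn] with d hd k f hf hf1
  have hsymm : ∀ k l, K d k l = K d l k := by
    intro k l; fin_cases k <;> fin_cases l <;> rfl
  have h := lln (s := s d) (code := initMsg p) hp0 hp1 hq hq1 hd.1 hsymm hd.2
    (continuous_nonlin (lam := lam) (q := q) hp0 hp1) (abs_nonlin_le (lam := lam) (q := q) hp0 hp1)
    (t + 1) k (g := fun x => (f x : ℂ)) (Complex.continuous_ofReal.comp hf) (C := 1)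
    (fun x => by simpa using hf1 x)
  rwa [integral_complex_ofReal] at h

end Main

end SBM

theorem proposition3
    (p lam q α β : ℝ) (hp0 : 0 < p) (hp : p < SBM.pStar)
    (hlam : SBM.spinodal p < lam) (hlam1 : lam < 1)
    (hβ : 0 < β) (hβα : β < α)
    (hfix : ∀ μ : ℝ, 0 ≤ μ → (SBM.G lam p μ = μ ↔ μ = 0 ∨ μ = β ∨ μ = α))
    (hq : β * p * (1 - p) / lam < q) (hq1 : q ≤ 1)
    (a b c : ℝ → ℝ)
    (habc : ∀ᶠ d : ℝ in atTop,
      p * a d + (1 - p) * b d = 1 ∧ p * b d + (1 - p) * c d = 1 ∧ d * (1 - b d) ^ 2 = lam) :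
    ∃ L : ℝ, IsLUB (SBM.localLimits p q a b c) L ∧
      L ≤ liminf (fun d : ℝ => SBM.optRate p q (a d) (b d) (c d) d) atTop ∧
      2 * (gaussianReal (α / 2) α.toNNReal).real (Set.Ioi 0) - 1 ≤ L ∧
      ∀ T ∈ SBM.Loc,
        liminf (fun d : ℝ => SBM.rate p q (a d) (b d) (c d) d (T d)) atTop ≤
          liminf (fun d : ℝ => SBM.optRate p q (a d) (b d) (c d) d) atTop := by
  have hp1 : p < 1 := by
    have : 0 ≤ 1 / (2 * √3) := by positivity
    have : SBM.pStar ≤ 1 / 2 := by unfold SBM.pStar; linarith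
    linarith
  have hp1' : 0 < 1 - p := by linarith
  have hlam0 : 0 < lam := (SBM.spinodal_nonneg p).trans_lt hlam
  have hq0 : 0 ≤ q := le_trans (by positivity) hq.le
  have hv : ∀ᶠ d in atTop, ∀ᶠ n : ℕ in atTop,
      SBM.Valid p q (SBM.connectivity (a d) (b d) (c d) d n) := by
    filter_upwards [(SBM.eventually_connectivity hp0 hp1 habc).2.2] with d hd
    exact SBM.eventually_valid hp0 hp1 hq0 hq1 hd.1
      (fun k l => by fin_cases k <;> fin_cases l <;> rfl) hd.2
  have hub : ∀ l ∈ SBM.localLimits p q a b c,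
      l ≤ liminf (fun d : ℝ => SBM.optRate p q (a d) (b d) (c d) d) atTop := by
    rintro l ⟨T, -, hT⟩
    rw [← hT.liminf_eq]
    exact SBM.liminf_rate_le hv T
  -- The lower bound on q says exactly that the first signal-to-noise ratio λq/(p(1-p)) exceeds β.
  have hsnr : β < SBM.snr lam p q 0 := by
    rw [div_lt_iff₀ hlam0] at hq
    rw [SBM.snr, lt_div_iff₀ (by positivity)]
    linarith
  obtain ⟨y, hy, hlim⟩ := SBM.exists_tendsto_le_snr hp0 hp1 hlam0.le hβ hβα hfix
    (fun μ h1 h2 => SBM.lt_G_of_mem_Ioo hp0 hp1 hlam hlam1 hβ hβα hfix h1 h2) hsnr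
  have hmem := fun t => SBM.mem_localLimits hp0 hp1 hq0 hq1 hlam0.le habc hv t
    ((hy t).1.trans_le (hy t).2.1)
  -- The set of limits is nonempty (message passing) and bounded above (optimal test), so its
  -- supremum is a genuine one.
  have hlub : IsLUB (SBM.localLimits p q a b c) (sSup (SBM.localLimits p q a b c)) :=
    isLUB_csSup ⟨_, hmem 0⟩ ⟨_, hub⟩
  refine ⟨_, hlub, hlub.2 hub, ?_, fun T _ => SBM.liminf_rate_le hv T⟩
  -- No convergence of `snr` itself is needed: the success probability increases with the ratio, and
  -- the smaller sequence y tends to α.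
  refine le_of_tendsto (((SBM.tendsto_gaussianReal_Ioi (hβ.trans hβα) (fun t => (hy t).1)
    (fun t => (hy t).2.2) hlim).const_mul 2).sub_const 1) (Eventually.of_forall fun t => ?_)
  refine le_trans ?_ (hlub.1 (hmem t))
  linarith [SBM.gaussianReal_Ioi_mono (hy t).1 (hy t).2.1]
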